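/- Let $\alpha>-1$ and $\theta\ge 1$ be fixed. There are unique sequences of real polynomials $p_j^{(\alpha,\theta)}$, of degree $j$ with positive leading coefficient, and $q_k^{(\alpha,\theta)}$, monic of degree $k$ ($j,k=0,1,2,\dots$), with $$\int_0^\infty p_j^{(\alpha,\theta)}(x)\,q_k^{(\alpha,\theta)}(x^\theta)\,x^\alpha e^{-x}\,dx=\delta_{j,k}.$$ Put $$K_n^{(\alpha,\theta)}(x,y)=\sum_{j=0}^{n-1}p_j^{(\alpha,\theta)}(x)\,q_j^{(\alpha,\theta)}(y^\theta)\,x^\alpha e^{-x}.$$ Then there is a function $K^{(\alpha,\theta)}$ such that $$\lim_{n\to\infty} n^{-1/\theta}K_n^{(\alpha,\theta)}\!\left(\frac{x}{n^{1/\theta}},\frac{y}{n^{1/\theta}}\right)=K^{(\alpha,\theta)}(x,y)$$ uniformly for $x,y$ in compact subsets of $(0,\infty)$, and for $x,y>0$ it has the following three representations. (1) One has $$K^{(\alpha,\theta)}(x,y)=\frac{\theta}{(2\pi i)^2}\int_{c-i\infty}^{c+i\infty}ds\oint_\Sigma dt\,\frac{\Gamma(s+1)\Gamma(\alpha+1+\theta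 s)}{\Gamma(t+1)\Gamma(\alpha+1+\theta t)}\,\frac{\sin\pi s}{\sin\pi t}\,\frac{x^{-\theta s-1}y^{\theta t}}{s-t}$$ for every $c$ with $-\frac{\alpha+1}{\theta}<c<0$ and, if $\theta=1$, also $c\le-\frac{\alpha}{2}$. In particular, if $\theta>1$ or $\alpha\le 1$, one may take $c=\frac12\left(\max\{0,1-\frac{\alpha+1}{\theta}\}-1\right)$. Here $\Sigma$ is the loop that comes from $+\infty+ih$ along a horizontal ray to $d+ih$, descends vertically to $d-ih$, and returns along a horizontal ray to $+\infty-ih$, with arbitrary $d\in(c,0)$ and $h>0$; so it encircles $[0,\infty)$ and lies in $\operatorname{Re}t>c$. The $t$-integral converges absolutely; the $s$-integral converges absolutely if $\theta>1$, and as an improper integral (the two ends tending to infinity independently) if $\theta=1$. (2) One has $$K^{(\alpha,\theta)}(x,y)=\int_0^1p^{(\alpha,\theta)}(ux)\,q^{(\alpha,\theta)}(uy)\,du ,$$ where for $x>0$ $$p^{(\alpha,\theta)}(x)=\frac1{2\pi i}\int_{\kappa-i\infty}^{\kappa+i\infty}\frac{\Gamma(\alpha+s)}{\Gamma((1-s)/\theta)}x^{-s}\,ds,\qquad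 q^{(\alpha,\theta)}(x)=\frac1{2\pi i}\int_\gamma\frac{\Gamma(t/\theta)}{\Gamma(\alpha+1-t)}x^{-t}\,dt .$$ Here $\kappa>-\alpha$ is arbitrary, except that if $\theta=1$ also $\kappa\le\frac{1-\alpha}{2}$; the integral converges absolutely if $\theta>1$ and as an improper integral if $\theta=1$. The loop $\gamma$ comes from $-\infty-ih$ along a horizontal ray to $d-ih$, ascends vertically to $d+ih$, and returns along a horizontal ray to $-\infty+ih$, with arbitrary $d,h>0$; the integral over it converges absolutely. (3) One has $$K^{(\alpha,\theta)}(x,y)=\theta x^\alpha\int_0^1J_{\frac{\alpha+1}\theta,\frac1\theta}(ux)\,J_{\alpha+1,\theta}\big((uy)^\theta\big)\,u^\alpha\,du,$$ where $J_{a,b}(x)=\sum_{j=0}^\infty\frac{(-x)^j}{j!\,\Gamma(a+bj)}$ is Wright's generalized Bessel function. In (2) and (3) the integrals over $[0,1]$ converge absolutely and the two Wright series converge for every real argument. -/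

import Mathlib

open Filter Topology MeasureTheory Set

noncomputable section

/-- The Laguerre biorthogonal polynomials with parameters `α`, `θ`: `p j` has degree `j` and positive
leading coefficient, `q k` is monic of degree `k`, and
`∫₀^∞ p_j(x) q_k(x^θ) x^α e^{-x} dx = δ_{jk}`. -/
structure IsLaguerreBiorthogonal (α θ : ℝ) (p q : ℕ → Polynomial ℝ) : Prop where
  natDegree_left : ∀ j, (p j).natDegree = j
  leadingCoeff_left_pos : ∀ j, 0 < (p j).leadingCoeff
  natDegree_right : ∀ k, (q k).natDegree = k
  monic_right : ∀ k, (q k).Monic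
  biorthogonal : ∀ j k,
    ∫ x in Ioi (0 : ℝ), (p j).eval x * (q k).eval (x ^ θ) * x ^ α * Real.exp (-x)
      = if j = k then 1 else 0

/-- The correlation kernel `∑_{j < n} p_j(x) q_j(y^θ) x^α e^{-x}` built from polynomials `p`, `q`. -/
def biorthogonalKernel (α θ : ℝ) (p q : ℕ → Polynomial ℝ) (n : ℕ) (x y : ℝ) : ℝ :=
  ∑ j ∈ Finset.range n, (p j).eval x * (q j).eval (y ^ θ) * x ^ α * Real.exp (-x)

/-- `∫_{c-i∞}^{c+i∞} f(s) ds` converges to `L` as an improper integral along the upward vertical line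
of abscissa `c` (both ends tend to infinity independently). -/
def HasLineIntegral (f : ℂ → ℂ) (c : ℝ) (L : ℂ) : Prop :=
  LocallyIntegrable (fun τ : ℝ => f (c + τ * Complex.I)) ∧
  Tendsto (fun T : ℝ × ℝ => Complex.I * ∫ τ in (-T.1)..T.2, f (c + τ * Complex.I)) atTop (𝓝 L)

/-- `∫_{c-i∞}^{c+i∞} f(s) ds` converges absolutely. -/
def LineIntegrable (f : ℂ → ℂ) (c : ℝ) : Prop :=
  Integrable (fun τ : ℝ => f (c + τ * Complex.I))

/-- The integral of `f` along the loop that comes from `+∞ + ih` along a horizontal ray to `d + ih`,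
descends to `d - ih`, and returns along a horizontal ray to `+∞ - ih`. -/
def rightLoopIntegral (d h : ℝ) (f : ℂ → ℂ) : ℂ :=
  (∫ x in Ioi d, f (x - h * Complex.I)) - (∫ x in Ioi d, f (x + h * Complex.I))
    - Complex.I * ∫ v in (-h)..h, f (d + v * Complex.I)

/-- Absolute convergence of `rightLoopIntegral d h f`. -/
def RightLoopIntegrable (d h : ℝ) (f : ℂ → ℂ) : Prop :=
  IntegrableOn (fun x : ℝ => f (x - h * Complex.I)) (Ioi d) ∧
  IntegrableOn (fun x : ℝ => f (x + h * Complex.I)) (Ioi d) ∧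
  IntervalIntegrable (fun v : ℝ => f (d + v * Complex.I)) volume (-h) h

/-- The integral of `f` along the loop that comes from `-∞ - ih` along a horizontal ray to `d - ih`,
ascends to `d + ih`, and returns along a horizontal ray to `-∞ + ih`. -/
def leftLoopIntegral (d h : ℝ) (f : ℂ → ℂ) : ℂ :=
  (∫ x in Iio d, f (x - h * Complex.I)) - (∫ x in Iio d, f (x + h * Complex.I))
    + Complex.I * ∫ v in (-h)..h, f (d + v * Complex.I)

/-- Absolute convergence of `leftLoopIntegral d h f`. -/
def LeftLoopIntegrable (d h : ℝ) (f : ℂ → ℂ) : Prop :=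
  IntegrableOn (fun x : ℝ => f (x - h * Complex.I)) (Iio d) ∧
  IntegrableOn (fun x : ℝ => f (x + h * Complex.I)) (Iio d) ∧
  IntervalIntegrable (fun v : ℝ => f (d + v * Complex.I)) volume (-h) h

/-- The integrand of the double contour integral for the hard edge kernel. -/
def hardEdgeIntegrand (α θ x y : ℝ) (s t : ℂ) : ℂ :=
  Complex.Gamma (s + 1) * Complex.Gamma (α + 1 + θ * s)
      / (Complex.Gamma (t + 1) * Complex.Gamma (α + 1 + θ * t))
    * (Complex.sin (Real.pi * s) / Complex.sin (Real.pi * t))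
    * ((x : ℂ) ^ (-θ * s - 1) * (y : ℂ) ^ (θ * t) / (s - t))

/-- The integrand `Γ(α+s) / Γ((1-s)/θ) · x^{-s}`. -/
def mellinBarnesP (α θ x : ℝ) (s : ℂ) : ℂ :=
  Complex.Gamma (α + s) / Complex.Gamma ((1 - s) / θ) * (x : ℂ) ^ (-s)

/-- The integrand `Γ(t/θ) / Γ(α+1-t) · x^{-t}`. -/
def mellinBarnesQ (α θ x : ℝ) (t : ℂ) : ℂ :=
  Complex.Gamma (t / θ) / Complex.Gamma (α + 1 - t) * (x : ℂ) ^ (-t)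

/-- The abscissa `c = (max{0, 1 - (α+1)/θ} - 1)/2`. -/
def standardAbscissa (α θ : ℝ) : ℝ := (max 0 (1 - (α + 1) / θ) - 1) / 2

/-- The abscissas of the vertical `s`-line for which the hard edge double contour integral converges:
the line lies between the poles of `Γ(α+1+θs)` and the pole `t = 0`; if `θ = 1`, where the integrand
has only power decay, also `c ≤ -α/2`. -/
def IsKernelAbscissa (α θ c : ℝ) : Prop :=
  -(α + 1) / θ < c ∧ c < 0 ∧ (1 < θ ∨ c ≤ -α / 2)

/-- The standard abscissa is one of them when `θ > 1` and when `α ≤ 1`. -/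
theorem isKernelAbscissa_standard (α θ : ℝ) (hα : -1 < α) (hθ : 1 ≤ θ) (h : 1 < θ ∨ α ≤ 1) :
    IsKernelAbscissa α θ (standardAbscissa α θ) := by
  have h0 : 0 < (α + 1) / θ := div_pos (by linarith) (by linarith)
  have e : -(α + 1) / θ = -((α + 1) / θ) := neg_div _ _
  unfold IsKernelAbscissa standardAbscissa
  rw [e]
  refine ⟨?_, ?_, ?_⟩
  · have := le_max_right (0 : ℝ) (1 - (α + 1) / θ)
    linarith
  · have : max (0 : ℝ) (1 - (α + 1) / θ) < 1 := max_lt one_pos (by linarith)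
    linarith
  · rcases hθ.lt_or_eq with h1 | h1
    · exact Or.inl h1
    · right
      have h2 : α ≤ 1 := by
        rcases h with h | h
        · linarith
        · exact h
      subst h1
      have : max (0 : ℝ) (1 - (α + 1) / 1) ≤ 1 - α := max_le (by linarith) (by linarith)
      linarith

/-- The abscissas of the vertical line for which the integral of `mellinBarnesP` converges: the line
lies to the right of the poles of `Γ(α+s)`; if `θ = 1`, where the integrand has only power behaviour,
also `κ ≤ (1-α)/2`. -/
def IsPAbscissa (α θ κ : ℝ) : Prop :=
  -α < κ ∧ (1 < θ ∨ κ ≤ (1 - α) / 2)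

/-- The terms of the series of Wright's generalized Bessel function. -/
def wrightBesselTerm (a b x : ℝ) (j : ℕ) : ℝ :=
  (-x) ^ j / (j.factorial * Real.Gamma (a + b * j))

/-- Wright's generalized Bessel function `J_{a,b}(x) = ∑_j (-x)^j / (j! Γ(a + bj))`. -/
def wrightBessel (a b x : ℝ) : ℝ := ∑' j, wrightBesselTerm a b x j

end

/-! Every representation is compared with one absolutely convergent double series, `hardEdgeKernel`:
θ x^α ∑_{k,j} A_k B_j / (α+1+k+θj), where A_k and B_j are the terms of the Wright series
J_{(α+1)/θ,1/θ}(x) and J_{α+1,θ}(y^θ). Writing 1/(α+1+k+θj) = ∫₀¹ u^{α+k+θj} du and integrating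
termwise gives the Wright form (`hasSum_integral_kernelTerm`). The form with p and q is the same
integral, with p(x) = x^α J_{(α+1)/θ,1/θ}(x) and q(x) = θ J_{α+1,θ}(x^θ), once their contour
integrals are known to have these values.

The contour integrals are sums of residues. A right loop picks up the poles t = j of Γ(-t), and a
rectangle argument suffices (`rightLoopIntegral_loopIntegrand`); q reduces to this by t ↦ -t/θ. The
vertical integrals all have the integrand Γ(z)/Γ(a - z/θ) x^{-z} H(z), with H holomorphic and
bounded to the left of the line; the only poles there are z = -k
(`hasLineIntegral_mellinBarnesIntegrand`). For p one takes H = 1. In the double integral the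
reflection formula turns 1/(Γ(t+1) sin πt) into -Γ(-t)/π and Γ(s+1) sin πs into -π/Γ(-s). The loop
then produces ∑_j B_j/(s-j), which is H in the variable z = α+1+θs, and the residues of the
s-integral restore the double series.

Convergence is a matter of Stirling: on Re z = σ the Gamma quotient is O(|τ|^{σ+σ/θ-a}
e^{-(π/2)(1-1/θ)|τ|}). This decays exponentially if θ > 1 but only like a power if θ = 1, whence the
extra conditions on the abscissas. To treat the conditionally convergent case as well, the integral
is moved to the given line from the lines Re z = -N - 1/2, on which it converges absolutely and
tends to 0 as N → ∞.

For the scaling limit, let R_P be P with x^i replaced by the rising factorial (z)_i (`risingEval`).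
Then ∫ P(x) x^{θk} x^α e^{-x} dx = Γ(z) R_P(z) at z = α+1+θk, and e^{-x} P(x) = ∑_m (-x)^m/m! ·
R_P(-m). If R_{p_j}(z) is the binomial coefficient of (z-α-1)/θ over j, divided by Γ(α+1+θj),
biorthogonality is inversion of the binomial matrix, and the second formula expands K_n in a power
series. The sum over j has a closed form (`sum_ascPochhammer_mul_choose`), so the rescaled K_n is
the double series with 1/Γ((α+1+k)/θ) replaced by a weight that tends to it by Euler's limit
formula. A geometric bound for the weight permits dominated convergence. -/

/-! ### Bounds for the Gamma function on vertical lines and strips -/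

/-- Inequalities between the factors |σ + j + iτ| of Euler's product pass to Γ in the limit; both
monotonicity statements for ‖Γ‖ below are obtained in this way. -/
theorem norm_gammaSeq_eq (σ τ : ℝ) {n : ℕ} (hn : n ≠ 0) :
    ‖Complex.GammaSeq (σ + τ * Complex.I) n‖
      = (n : ℝ) ^ σ * n.factorial
        / ∏ j ∈ Finset.range (n + 1), ‖((σ + j : ℝ) : ℂ) + τ * Complex.I‖ := by
  have hn' : (0 : ℝ) < n := by positivity
  rw [Complex.GammaSeq, norm_div, norm_mul, norm_prod, ← Complex.ofReal_natCast n,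
    Complex.norm_cpow_eq_rpow_re_of_pos hn']
  simp only [Complex.add_re, Complex.ofReal_re, Complex.mul_re, Complex.I_re, mul_zero,
    Complex.ofReal_im, Complex.I_im, mul_one, sub_self, add_zero, Complex.norm_natCast]
  congr 1
  refine Finset.prod_congr rfl fun j _ => ?_
  congr 1
  push_cast
  ring

theorem norm_add_mul_I_le_of_abs_le (σ : ℝ) {τ τ' : ℝ} (h : |τ| ≤ |τ'|) :
    ‖(σ : ℂ) + τ * Complex.I‖ ≤ ‖(σ : ℂ) + τ' * Complex.I‖ := by
  rw [Complex.norm_add_mul_I, Complex.norm_add_mul_I]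
  have := sq_le_sq.2 h
  gcongr

theorem le_norm_add_mul_I {σ τ : ℝ} : |σ| ≤ ‖(σ : ℂ) + τ * Complex.I‖ := by
  have := Complex.abs_re_le_norm ((σ : ℂ) + τ * Complex.I)
  simpa using this

theorem abs_le_norm_add_mul_I {σ τ : ℝ} : |τ| ≤ ‖(σ : ℂ) + τ * Complex.I‖ := by
  have := Complex.abs_im_le_norm ((σ : ℂ) + τ * Complex.I)
  simpa using this

/-- On a vertical line in the right half plane `‖Γ‖` decreases away from the real axis. -/
theorem norm_Gamma_anti {σ τ τ' : ℝ} (hσ : 0 < σ) (h : |τ| ≤ |τ'|) :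
    ‖Complex.Gamma (σ + τ' * Complex.I)‖ ≤ ‖Complex.Gamma (σ + τ * Complex.I)‖ := by
  refine le_of_tendsto_of_tendsto
    (Complex.GammaSeq_tendsto_Gamma _).norm (Complex.GammaSeq_tendsto_Gamma _).norm ?_
  filter_upwards [eventually_ne_atTop 0] with n hn
  rw [norm_gammaSeq_eq _ _ hn, norm_gammaSeq_eq _ _ hn]
  have hpos : ∀ j ∈ Finset.range (n + 1), 0 < ‖((σ + j : ℝ) : ℂ) + τ * Complex.I‖ := fun j _ => by
    refine lt_of_lt_of_le ?_ le_norm_add_mul_I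
    positivity
  refine div_le_div_of_nonneg_left (by positivity) (Finset.prod_pos hpos) ?_
  exact Finset.prod_le_prod (fun j hj => (hpos j hj).le)
    fun j _ => norm_add_mul_I_le_of_abs_le _ h

/-- After division by σσ' this says that |1 + iτ/σ| decreases in σ. It compares single factors of
Euler's product. -/
theorem mul_norm_add_mul_I_le {σ σ' : ℝ} (τ : ℝ) (h0 : 0 < σ) (h : σ ≤ σ') :
    σ * ‖(σ' : ℂ) + τ * Complex.I‖ ≤ σ' * ‖(σ : ℂ) + τ * Complex.I‖ := by
  have h0' : 0 < σ' := h0.trans_le h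
  rw [Complex.norm_add_mul_I, Complex.norm_add_mul_I]
  refine abs_le_of_sq_le_sq' ?_ (by positivity) |>.2
  rw [mul_pow, mul_pow, Real.sq_sqrt (by positivity), Real.sq_sqrt (by positivity)]
  have : σ ^ 2 ≤ σ' ^ 2 := by gcongr
  nlinarith [sq_nonneg τ]

/-- `‖Γ(σ + iτ)‖ / Γ(σ)` increases with `σ`. -/
theorem norm_Gamma_mul_Gamma_le {σ σ' : ℝ} (τ : ℝ) (h0 : 0 < σ) (h : σ ≤ σ') :
    ‖Complex.Gamma (σ + τ * Complex.I)‖ * Real.Gamma σ'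
      ≤ Real.Gamma σ * ‖Complex.Gamma (σ' + τ * Complex.I)‖ := by
  refine le_of_tendsto_of_tendsto
    ((Complex.GammaSeq_tendsto_Gamma _).norm.mul (Real.GammaSeq_tendsto_Gamma _))
    ((Real.GammaSeq_tendsto_Gamma _).mul (Complex.GammaSeq_tendsto_Gamma _).norm) ?_
  filter_upwards [eventually_ne_atTop 0] with n hn
  rw [norm_gammaSeq_eq _ _ hn, norm_gammaSeq_eq _ _ hn, Real.GammaSeq, Real.GammaSeq,
    div_mul_div_comm, div_mul_div_comm, ← Finset.prod_mul_distrib, ← Finset.prod_mul_distrib]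
  have h1 : ∀ s : ℝ, 0 < s → ∀ j : ℕ, 0 < ‖((s + j : ℝ) : ℂ) + τ * Complex.I‖ := fun s hs j => by
    refine lt_of_lt_of_le ?_ le_norm_add_mul_I
    positivity
  rw [mul_comm ((n : ℝ) ^ σ * n.factorial)]
  rw [mul_comm ((n : ℝ) ^ σ' * n.factorial)]
  refine div_le_div_of_nonneg_left (by positivity) (Finset.prod_pos fun j _ => ?_)
    (Finset.prod_le_prod (fun j _ => ?_) fun j _ => ?_)
  · exact mul_pos (by positivity) (h1 _ (h0.trans_le h) j)
  · exact (mul_pos (by positivity) (h1 _ (h0.trans_le h) j)).le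
  · rw [mul_comm _ (σ' + (j : ℝ))]
    exact mul_norm_add_mul_I_le τ (by positivity) (by gcongr)

/-- Keep only the part u > B of Euler's integral, where u^x ≥ B^x. As B is free, Γ beats any
prescribed geometric growth with an explicit constant. -/
theorem rpow_mul_exp_neg_le_Gamma {B x : ℝ} (hB : 0 < B) (hx : 0 ≤ x) :
    B ^ x * Real.exp (-B) ≤ Real.Gamma (x + 1) := by
  rw [Real.Gamma_eq_integral (by linarith)]
  have hint := Real.GammaIntegral_convergent (s := x + 1) (by linarith)
  have h1 : ∫ u in Ioi B, Real.exp (-u) * B ^ x ≤ ∫ u in Ioi B, Real.exp (-u) * u ^ (x + 1 - 1) := by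
    refine setIntegral_mono_on ((integrableOn_exp_neg_Ioi B).mul_const _)
      (hint.mono_set (Ioi_subset_Ioi hB.le)) measurableSet_Ioi fun u hu => ?_
    rw [add_sub_cancel_right]
    have : B ≤ u := (mem_Ioi.1 hu).le
    gcongr
  have h2 : ∫ u in Ioi B, Real.exp (-u) * u ^ (x + 1 - 1)
      ≤ ∫ u in Ioi 0, Real.exp (-u) * u ^ (x + 1 - 1) := by
    refine setIntegral_mono_set hint ?_ (Ioi_subset_Ioi hB.le).eventuallyLE
    filter_upwards [ae_restrict_mem measurableSet_Ioi] with u hu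
    have : (0 : ℝ) < u := hu
    simp only [Pi.zero_apply]
    positivity
  rw [integral_mul_const, integral_exp_neg_Ioi] at h1
  linarith

theorem exp_neg_one_le_Gamma {x : ℝ} (hx : 0 < x) : Real.exp (-1) ≤ Real.Gamma x := by
  rcases le_or_gt 1 x with h | h
  · have := rpow_mul_exp_neg_le_Gamma one_pos (x := x - 1) (by linarith)
    simpa using this
  · have h1 := rpow_mul_exp_neg_le_Gamma one_pos (x := x) hx.le
    rw [Real.one_rpow, one_mul, Real.Gamma_add_one hx.ne'] at h1
    exact h1.trans (mul_le_of_le_one_left (Real.Gamma_pos_of_pos hx).le h.le)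

/-- On the line Re s = 1/2 one has 1 - s = conj s, so the reflection formula evaluates the modulus
exactly. -/
theorem norm_Gamma_half_sq (τ : ℝ) :
    ‖Complex.Gamma (((1 / 2 : ℝ) : ℂ) + τ * Complex.I)‖ ^ 2 = Real.pi / Real.cosh (Real.pi * τ) := by
  have h := Complex.Gamma_mul_Gamma_one_sub (((1 / 2 : ℝ) : ℂ) + τ * Complex.I)
  have h1 : (1 : ℂ) - (((1 / 2 : ℝ) : ℂ) + τ * Complex.I)
      = (starRingEnd ℂ) (((1 / 2 : ℝ) : ℂ) + τ * Complex.I) := by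
    simp only [map_add, map_mul, Complex.conj_ofReal, Complex.conj_I]
    push_cast
    ring
  have h2 : Complex.sin (Real.pi * (((1 / 2 : ℝ) : ℂ) + τ * Complex.I))
      = ((Real.cosh (Real.pi * τ) : ℝ) : ℂ) := by
    rw [show (Real.pi : ℂ) * (((1 / 2 : ℝ) : ℂ) + τ * Complex.I)
      = (Real.pi * τ : ℂ) * Complex.I + Real.pi / 2 by push_cast; ring, Complex.sin_add_pi_div_two,
      Complex.cos_mul_I]
    push_cast
    rfl
  rw [h1, Complex.Gamma_conj, Complex.mul_conj, h2, Complex.normSq_eq_norm_sq] at h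
  exact_mod_cast h

theorem norm_Gamma_add_one (σ τ : ℝ) (h : (σ : ℂ) + τ * Complex.I ≠ 0) :
    ‖Complex.Gamma (((σ + 1 : ℝ) : ℂ) + τ * Complex.I)‖
      = ‖(σ : ℂ) + τ * Complex.I‖ * ‖Complex.Gamma (σ + τ * Complex.I)‖ := by
  rw [← norm_mul, ← Complex.Gamma_add_one _ h]
  congr 2
  push_cast
  ring

theorem norm_Gamma_three_halves_sq (τ : ℝ) :
    ‖Complex.Gamma (((3 / 2 : ℝ) : ℂ) + τ * Complex.I)‖ ^ 2
      = (1 / 4 + τ ^ 2) * (Real.pi / Real.cosh (Real.pi * τ)) := by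
  have h : (((1 / 2 : ℝ) : ℂ) + τ * Complex.I) ≠ 0 := fun h0 => by
    have := congrArg Complex.re h0
    simp at this
  have h1 := norm_Gamma_add_one (1 / 2) τ h
  rw [show (1 / 2 + 1 : ℝ) = 3 / 2 by norm_num] at h1
  rw [h1, mul_pow, norm_Gamma_half_sq, Complex.norm_add_mul_I, Real.sq_sqrt (by positivity)]
  norm_num

theorem norm_Gamma_half_le (τ : ℝ) :
    ‖Complex.Gamma (((1 / 2 : ℝ) : ℂ) + τ * Complex.I)‖
      ≤ √(2 * Real.pi) * Real.exp (-(Real.pi * |τ| / 2)) := by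
  refine abs_le_of_sq_le_sq' ?_ (by positivity) |>.2
  rw [norm_Gamma_half_sq, mul_pow, Real.sq_sqrt (by positivity), ← Real.exp_nat_mul]
  have h1 : Real.exp (Real.pi * |τ|) / 2 ≤ Real.cosh (Real.pi * τ) := by
    rw [← Real.cosh_abs, abs_mul, abs_of_pos Real.pi_pos, Real.cosh_eq]
    have := Real.exp_pos (-(Real.pi * |τ|))
    linarith
  rw [div_le_iff₀ (Real.cosh_pos _)]
  have h2 : Real.exp ((2 : ℕ) * -(Real.pi * |τ| / 2)) = (Real.exp (Real.pi * |τ|))⁻¹ := by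
    rw [← Real.exp_neg]
    congr 1
    push_cast
    ring
  rw [h2]
  calc Real.pi = 2 * Real.pi * (Real.exp (Real.pi * |τ|))⁻¹ * (Real.exp (Real.pi * |τ|) / 2) := by
        field_simp
    _ ≤ _ := by gcongr

theorem norm_Gamma_three_halves_le (τ : ℝ) :
    ‖Complex.Gamma (((3 / 2 : ℝ) : ℂ) + τ * Complex.I)‖
      ≤ (1 / 2 + |τ|) * (√(2 * Real.pi) * Real.exp (-(Real.pi * |τ| / 2))) := by
  have h : (((1 / 2 : ℝ) : ℂ) + τ * Complex.I) ≠ 0 := fun h0 => by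
    have := congrArg Complex.re h0
    simp at this
  have h1 := norm_Gamma_add_one (1 / 2) τ h
  rw [show (1 / 2 + 1 : ℝ) = 3 / 2 by norm_num] at h1
  rw [h1]
  gcongr
  · refine (norm_add_le _ _).trans ?_
    simp
  · exact norm_Gamma_half_le τ

theorem norm_Gamma_le_Gamma {σ : ℝ} (τ : ℝ) (hσ : 0 < σ) :
    ‖Complex.Gamma (σ + τ * Complex.I)‖ ≤ Real.Gamma σ := by
  have := norm_Gamma_anti (σ := σ) (τ := 0) (τ' := τ) hσ (by simp)
  simpa [Complex.Gamma_ofReal, abs_of_pos (Real.Gamma_pos_of_pos hσ)] using this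

theorem norm_cexp_sq (w : ℂ) : ‖Complex.exp (w ^ 2)‖ = Real.exp (w.re ^ 2 - w.im ^ 2) := by
  rw [Complex.norm_exp]
  congr 1
  rw [sq, Complex.mul_re]
  ring

/-- The cost e^{2|y|} of moving the ordinate by y (using π/2 ≤ 2) is later absorbed by a Gaussian
factor. -/
theorem exp_abs_add_le (τ y : ℝ) :
    Real.exp (-(Real.pi * |y + τ| / 2)) ≤ Real.exp (-(Real.pi * |τ| / 2)) * Real.exp (2 * |y|) := by
  rw [← Real.exp_add]
  refine Real.exp_le_exp.2 ?_
  have h1 : |τ| ≤ |y + τ| + |y| := by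
    calc |τ| = |y + τ - y| := by ring_nf
      _ ≤ _ := abs_sub _ _
  have h2 := Real.pi_le_four
  have h3 := mul_le_mul_of_nonneg_left h1 Real.pi_pos.le
  nlinarith [abs_nonneg y]

/-- The Stirling upper bound for `‖Γ‖` on the strip `1/2 ≤ Re z ≤ 3/2`. -/
theorem exists_norm_Gamma_le_strip : ∃ C : ℝ, 0 < C ∧ ∀ σ τ : ℝ, 1 / 2 ≤ σ → σ ≤ 3 / 2 → 1 ≤ |τ| →
    ‖Complex.Gamma (σ + τ * Complex.I)‖
      ≤ C * (|τ| ^ (σ - 1 / 2) * Real.exp (-(Real.pi * |τ| / 2))) := by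
  -- The exponent 9/2 is the maximum of 3|v| + 9/4 - v², which arises on the right edge with v = Im
  -- w. The factor 2 comes from 1/2 + |v + τ| ≤ 2 e^{|v|} |τ|.
  set A : ℝ := √(2 * Real.pi) * (2 * Real.exp (9 / 2)) with hA
  have hApos : 0 < A := by positivity
  refine ⟨A, hApos, fun σ τ h1 h2 hτ => ?_⟩
  have hτ0 : 0 < |τ| := by linarith
  set E : ℝ := Real.exp (-(Real.pi * |τ| / 2)) with hE
  have hEpos : 0 < E := Real.exp_pos _
  -- Three lines theorem in w, with τ fixed: the factor e^{w²} makes the edge bounds uniform in Im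
  -- w, and at the real point w = σ it is at least 1. Interpolating between the exponents 0 and 1 of
  -- |τ| gives σ - 1/2.
  set f : ℂ → ℂ := fun w => Complex.Gamma (w + τ * Complex.I) * Complex.exp (w ^ 2) with hf
  have hre : ∀ w : ℂ, w + τ * Complex.I = (w.re : ℂ) + ((w.im + τ : ℝ) : ℂ) * Complex.I := by
    intro w
    nth_rewrite 1 [← Complex.re_add_im w]
    push_cast
    ring
  have hnf : ∀ w : ℂ, ‖f w‖ = ‖Complex.Gamma ((w.re : ℂ) + ((w.im + τ : ℝ) : ℂ) * Complex.I)‖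
      * Real.exp (w.re ^ 2 - w.im ^ 2) := by
    intro w
    rw [hf]
    simp only [norm_mul, norm_cexp_sq]
    rw [hre]
  have hdiff : DifferentiableOn ℂ f {w | 0 < w.re} := by
    intro w hw
    have hw' : 0 < w.re := hw
    refine DifferentiableAt.differentiableWithinAt (DifferentiableAt.mul ?_ (by fun_prop))
    refine DifferentiableAt.comp (g := Complex.Gamma) (f := fun w : ℂ => w + τ * Complex.I) w ?_
      (by fun_prop)
    refine Complex.differentiableAt_Gamma _ fun m hm => ?_
    have := congrArg Complex.re hm
    simp at this
    have hm' : (0 : ℝ) ≤ m := m.cast_nonneg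
    linarith
  have hcl : closure (Complex.HadamardThreeLines.verticalStrip (1 / 2) (3 / 2)) ⊆ {w | 0 < w.re} := by
    refine (closure_minimal (t := Complex.HadamardThreeLines.verticalClosedStrip (1 / 2) (3 / 2))
      ?_ ?_).trans ?_
    · exact preimage_mono Ioo_subset_Icc_self
    · exact isClosed_Icc.preimage Complex.continuous_re
    · intro w hw
      have : 1 / 2 ≤ w.re := hw.1
      simp only [mem_ofPred_eq]
      linarith
  have hbd : BddAbove ((norm ∘ f) '' Complex.HadamardThreeLines.verticalClosedStrip (1 / 2) (3 / 2)) := by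
    have hcont : ContinuousOn Real.Gamma (Icc (1 / 2) (3 / 2)) := by
      intro x hx
      refine (Real.differentiableAt_Gamma fun m hm => ?_).continuousAt.continuousWithinAt
      have hm' : (0 : ℝ) ≤ m := m.cast_nonneg
      have := hx.1
      linarith
    obtain ⟨M, hM⟩ := (isCompact_Icc.image_of_continuousOn hcont).bddAbove
    refine ⟨M * Real.exp (9 / 4), ?_⟩
    rintro _ ⟨w, hw, rfl⟩
    have hw1 : 1 / 2 ≤ w.re := hw.1
    have hw2 : w.re ≤ 3 / 2 := hw.2
    simp only [Function.comp]
    rw [hnf]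
    have hΓ : Real.Gamma w.re ≤ M := hM ⟨w.re, ⟨hw1, hw2⟩, rfl⟩
    have hM0 : 0 ≤ M := (Real.Gamma_pos_of_pos (by linarith)).le.trans hΓ
    refine mul_le_mul ((norm_Gamma_le_Gamma _ (by linarith)).trans hΓ) ?_ (by positivity) hM0
    refine Real.exp_le_exp.2 ?_
    nlinarith [sq_nonneg w.im]
  have hleft : ∀ w ∈ Complex.re ⁻¹' {(1 / 2 : ℝ)}, ‖f w‖ ≤ A * E := by
    intro w hw
    have hw' : w.re = 1 / 2 := hw
    rw [hnf, hw']
    calc _ ≤ √(2 * Real.pi) * (E * Real.exp (2 * |w.im|)) * Real.exp ((1 / 2) ^ 2 - w.im ^ 2) := by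
          gcongr
          refine (norm_Gamma_half_le _).trans ?_
          gcongr
          exact exp_abs_add_le _ _
      _ = √(2 * Real.pi) * (Real.exp (2 * |w.im|) * Real.exp ((1 / 2) ^ 2 - w.im ^ 2)) * E := by ring
      _ ≤ √(2 * Real.pi) * (2 * Real.exp (9 / 2)) * E := by
          have : Real.exp (2 * |w.im|) * Real.exp ((1 / 2) ^ 2 - w.im ^ 2) ≤ Real.exp (9 / 2) := by
            rw [← Real.exp_add]
            refine Real.exp_le_exp.2 ?_
            nlinarith [sq_nonneg (|w.im| - 1), sq_abs w.im]
          refine mul_le_mul_of_nonneg_right (mul_le_mul_of_nonneg_left ?_ (by positivity)) hEpos.le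
          linarith [Real.exp_pos (9 / 2)]
  have hright : ∀ w ∈ Complex.re ⁻¹' {(3 / 2 : ℝ)}, ‖f w‖ ≤ A * E * |τ| := by
    intro w hw
    have hw' : w.re = 3 / 2 := hw
    have h3 : 1 / 2 + |w.im + τ| ≤ 2 * Real.exp |w.im| * |τ| := by
      have e1 := Real.add_one_le_exp |w.im|
      have e2 := abs_add_le w.im τ
      have e3 := abs_nonneg w.im
      nlinarith
    rw [hnf, hw']
    calc _ ≤ (2 * Real.exp |w.im| * |τ|) * (√(2 * Real.pi) * (E * Real.exp (2 * |w.im|)))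
            * Real.exp ((3 / 2) ^ 2 - w.im ^ 2) := by
          gcongr
          refine (norm_Gamma_three_halves_le _).trans ?_
          gcongr
          exact exp_abs_add_le _ _
      _ = √(2 * Real.pi) * (2 * (Real.exp |w.im| * Real.exp (2 * |w.im|)
            * Real.exp ((3 / 2) ^ 2 - w.im ^ 2))) * E * |τ| := by ring
      _ ≤ √(2 * Real.pi) * (2 * Real.exp (9 / 2)) * E * |τ| := by
          gcongr
          rw [← Real.exp_add, ← Real.exp_add]
          refine Real.exp_le_exp.2 ?_
          nlinarith [sq_nonneg (|w.im| - 3 / 2), sq_abs w.im]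
  have key := Complex.HadamardThreeLines.norm_le_interp_of_mem_verticalClosedStrip'
    (f := f) (z := (σ : ℂ)) (l := 1 / 2) (u := 3 / 2) (by norm_num)
    ⟨by simpa using h1, by simpa using h2⟩
    (hdiff.mono hcl).diffContOnCl hbd hleft hright
  have h4 : ‖Complex.Gamma (σ + τ * Complex.I)‖ ≤ ‖f (σ : ℂ)‖ := by
    rw [hnf]
    simp only [Complex.ofReal_re, Complex.ofReal_im, zero_add]
    refine le_mul_of_one_le_right (norm_nonneg _) (Real.one_le_exp ?_)
    nlinarith
  refine h4.trans (key.trans (le_of_eq ?_))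
  simp only [Complex.ofReal_re]
  rw [show (3 / 2 - 1 / 2 : ℝ) = 1 by norm_num, div_one, Real.mul_rpow (by positivity) hτ0.le,
    ← mul_assoc, ← Real.rpow_add (by positivity)]
  ring_nf
  rw [Real.rpow_one]

/-- The Stirling upper bound for `‖Γ‖`, uniformly on vertical strips. -/
theorem exists_norm_Gamma_le (n : ℕ) : ∃ C : ℝ, 0 < C ∧ ∀ σ τ : ℝ, 1 / 2 - n ≤ σ → σ ≤ 3 / 2 + n →
    1 ≤ |τ| → ‖Complex.Gamma (σ + τ * Complex.I)‖
      ≤ C * (|τ| ^ (σ - 1 / 2) * Real.exp (-(Real.pi * |τ| / 2))) := by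
  induction n with
  | zero => simpa using exists_norm_Gamma_le_strip
  | succ n ih =>
    obtain ⟨C, hC, h⟩ := ih
    refine ⟨C * (n + 3), by positivity, fun σ τ h1 h2 hτ => ?_⟩
    push_cast at h1 h2
    have hτ0 : 0 < |τ| := by linarith
    have hn : (0 : ℝ) ≤ n := n.cast_nonneg
    have hne : ∀ r : ℝ, (r : ℂ) + τ * Complex.I ≠ 0 := fun r h0 => by
      have := congrArg Complex.im h0
      simp at this
      simp [this] at hτ0
    have hbig : ∀ B : ℝ, 0 ≤ B → C * B ≤ C * (n + 3) * B := fun B hB => by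
      have : C * B ≤ C * B * (n + 3) := le_mul_of_one_le_right (by positivity) (by linarith)
      linarith
    -- The functional equation widens the strip by one on each side: on the left one divides by |z|
    -- ≥ |τ|, on the right one multiplies by |z - 1| ≤ (n + 3)|τ|.
    rcases lt_or_ge σ (1 / 2 - n) with hlt | hge
    · have e := norm_Gamma_add_one σ τ (hne σ)
      have b := h (σ + 1) τ (by linarith) (by linarith) hτ
      have hz : |τ| ≤ ‖(σ : ℂ) + τ * Complex.I‖ := abs_le_norm_add_mul_I
      refine le_trans ?_ (hbig _ (by positivity))
      refine le_of_mul_le_mul_left ?_ hτ0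
      calc _ ≤ ‖(σ : ℂ) + τ * Complex.I‖ * ‖Complex.Gamma (σ + τ * Complex.I)‖ := by gcongr
        _ ≤ _ := by
          rw [← e]
          refine b.trans (le_of_eq ?_)
          rw [show σ + 1 - 1 / 2 = (σ - 1 / 2) + 1 by ring, Real.rpow_add_one hτ0.ne']
          ring
    · rcases le_or_gt σ (3 / 2 + n) with hle | hgt
      · exact (h σ τ hge hle hτ).trans (hbig _ (by positivity))
      · have e := norm_Gamma_add_one (σ - 1) τ (hne _)
        rw [sub_add_cancel] at e
        have b := h (σ - 1) τ (by linarith) (by linarith) hτ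
        have hz : ‖((σ - 1 : ℝ) : ℂ) + τ * Complex.I‖ ≤ (n + 3) * |τ| := by
          refine (norm_add_le _ _).trans ?_
          rw [Complex.norm_real, norm_mul, Complex.norm_I, Complex.norm_real, Real.norm_eq_abs,
            Real.norm_eq_abs, abs_of_nonneg (by linarith : (0 : ℝ) ≤ σ - 1), mul_one]
          nlinarith
        rw [e]
        calc _ ≤ (n + 3) * |τ| * (C * (|τ| ^ (σ - 1 - 1 / 2) * Real.exp (-(Real.pi * |τ| / 2)))) := by
              gcongr
          _ = _ := by
              rw [show σ - 1 / 2 = (σ - 1 - 1 / 2) + 1 by ring, Real.rpow_add_one hτ0.ne']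
              ring

theorem exists_norm_Gamma_le_Icc (A B : ℝ) : ∃ C : ℝ, 0 < C ∧ ∀ σ τ : ℝ, A ≤ σ → σ ≤ B →
    1 ≤ |τ| → ‖Complex.Gamma (σ + τ * Complex.I)‖
      ≤ C * (|τ| ^ (σ - 1 / 2) * Real.exp (-(Real.pi * |τ| / 2))) := by
  obtain ⟨n, hn⟩ := exists_nat_ge (max (1 / 2 - A) (B - 3 / 2))
  obtain ⟨C, hC, h⟩ := exists_norm_Gamma_le n
  have h1 := (le_max_left _ _).trans hn
  have h2 := (le_max_right _ _).trans hn
  exact ⟨C, hC, fun σ τ hA hB => h σ τ (by linarith) (by linarith)⟩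

/-! ### Cauchy's formula on rectangles and the poles of Gamma -/

/-- The integral of `f` along the boundary of `[a, b] × [c, d]`, counterclockwise. -/
noncomputable def rectIntegral (a b c d : ℝ) (f : ℂ → ℂ) : ℂ :=
  (∫ x in a..b, f (x + c * Complex.I)) - (∫ x in a..b, f (x + d * Complex.I))
    + Complex.I * (∫ y in c..d, f (b + y * Complex.I))
    - Complex.I * ∫ y in c..d, f (a + y * Complex.I)

theorem rectIntegral_eq_zero {a b c d : ℝ} {f : ℂ → ℂ}
    (hf : DifferentiableOn ℂ f (uIcc a b ×ℂ uIcc c d)) : rectIntegral a b c d f = 0 := by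
  have := Complex.integral_boundary_rect_eq_zero_of_differentiableOn f ⟨a, c⟩ ⟨b, d⟩ hf
  simpa [rectIntegral, smul_eq_mul] using this

/-- `S` has to contain only the boundary, so the functions may be singular inside the rectangle. -/
theorem rectIntegral_add_const_mul {a b c d : ℝ} {f g h : ℂ → ℂ} (k : ℂ) {S : Set ℂ}
    (hg : ContinuousOn g S) (hh : ContinuousOn h S) (hf : ∀ z ∈ S, f z = g z + k * h z)
    (h1 : ∀ x ∈ uIcc a b, ∀ y ∈ uIcc c d, x = a ∨ x = b ∨ y = c ∨ y = d →
      (x : ℂ) + y * Complex.I ∈ S) :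
    rectIntegral a b c d f = rectIntegral a b c d g + k * rectIntegral a b c d h := by
  have key : ∀ (γ : ℝ → ℂ) (u v : ℝ), Continuous γ → (∀ x ∈ uIcc u v, γ x ∈ S) →
      ∫ x in u..v, f (γ x) = (∫ x in u..v, g (γ x)) + k * ∫ x in u..v, h (γ x) := by
    intro γ u v hγ hS
    rw [← intervalIntegral.integral_const_mul, ← intervalIntegral.integral_add]
    · exact intervalIntegral.integral_congr fun x hx => hf _ (hS x hx)
    · exact (hg.comp hγ.continuousOn hS).intervalIntegrable
    · exact (continuousOn_const.mul (hh.comp hγ.continuousOn hS)).intervalIntegrable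
  unfold rectIntegral
  rw [key (fun x => x + c * Complex.I) a b (by fun_prop)
      fun x hx => h1 x hx c left_mem_uIcc (by simp),
    key (fun x => x + d * Complex.I) a b (by fun_prop)
      fun x hx => h1 x hx d right_mem_uIcc (by simp),
    key (fun y => b + y * Complex.I) c d (by fun_prop)
      fun y hy => h1 b right_mem_uIcc y hy (by simp),
    key (fun y => a + y * Complex.I) c d (by fun_prop)
      fun y hy => h1 a left_mem_uIcc y hy (by simp)]
  ring

theorem log_neg_of_im_pos {z : ℂ} (h : 0 < z.im) :
    Complex.log (-z) = Complex.log z - Real.pi * Complex.I := by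
  simp only [Complex.log, norm_neg, Complex.arg_neg_eq_arg_sub_pi_of_im_pos h]
  push_cast
  ring

theorem log_neg_of_im_neg {z : ℂ} (h : z.im < 0) :
    Complex.log (-z) = Complex.log z + Real.pi * Complex.I := by
  simp only [Complex.log, norm_neg, Complex.arg_neg_eq_arg_add_pi_of_im_neg h]
  push_cast
  ring

/-- The principal logarithm of z - w is a primitive on three sides. The left side crosses its cut,
so log(-(z - w)) is used there; the mismatch at each of the two left corners contributes πi. -/
theorem rectIntegral_inv_sub {a b c d : ℝ} {w : ℂ} (ha : a < w.re) (hb : w.re < b) (hc : c < w.im)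
    (hd : w.im < d) :
    rectIntegral a b c d (fun z => (z - w)⁻¹) = 2 * Real.pi * Complex.I := by
  have horiz : ∀ y : ℝ, y ≠ w.im → ∫ x in a..b, ((x : ℂ) + y * Complex.I - w)⁻¹
      = Complex.log (b + y * Complex.I - w) - Complex.log (a + y * Complex.I - w) := by
    intro y hy
    have hs : ∀ x : ℝ, (x : ℂ) + y * Complex.I - w ∈ Complex.slitPlane := fun x => by
      refine Complex.mem_slitPlane_iff.2 (Or.inr ?_)
      simpa using sub_ne_zero.2 hy
    refine intervalIntegral.integral_eq_sub_of_hasDerivAt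
      (f := fun x : ℝ => Complex.log (x + y * Complex.I - w)) (fun x _ => ?_) ?_
    · have h1 : HasDerivAt (fun x : ℝ => (x : ℂ) + y * Complex.I - w) 1 x :=
        ((Complex.ofRealCLM.hasDerivAt (x := x)).add_const _).sub_const _
      simpa using h1.clog_real (hs x)
    · refine Continuous.intervalIntegrable ?_ _ _
      exact Continuous.inv₀ (by fun_prop) fun x => Complex.slitPlane_ne_zero (hs x)
  have vert : ∀ (x : ℝ) (ε : ℂ), ε ≠ 0 → (∀ y : ℝ, ε * (x + y * Complex.I - w) ∈ Complex.slitPlane) →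
      Complex.I * ∫ y in c..d, ((x : ℂ) + y * Complex.I - w)⁻¹
        = Complex.log (ε * (x + d * Complex.I - w)) - Complex.log (ε * (x + c * Complex.I - w)) := by
    intro x ε hε hs
    rw [← intervalIntegral.integral_const_mul]
    refine intervalIntegral.integral_eq_sub_of_hasDerivAt
      (f := fun y : ℝ => Complex.log (ε * (x + y * Complex.I - w))) (fun y _ => ?_) ?_
    · have h1 : HasDerivAt (fun y : ℝ => ε * ((x : ℂ) + y * Complex.I - w)) (ε * Complex.I) y := by
        have := ((((Complex.ofRealCLM.hasDerivAt (x := y)).mul_const Complex.I).const_add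
          (x : ℂ)).sub_const w).const_mul ε
        simpa using this
      have h2 := h1.clog_real (hs y)
      have h3 := Complex.slitPlane_ne_zero (hs y)
      have h4 : (x : ℂ) + y * Complex.I - w ≠ 0 := right_ne_zero_of_mul h3
      rwa [mul_div_mul_left _ _ hε, div_eq_mul_inv] at h2
    · refine Continuous.intervalIntegrable ?_ _ _
      refine continuous_const.mul (Continuous.inv₀ (by fun_prop) fun y => ?_)
      exact right_ne_zero_of_mul (Complex.slitPlane_ne_zero (hs y))
  unfold rectIntegral
  rw [horiz c hc.ne, horiz d hd.ne', vert b 1 one_ne_zero, vert a (-1) (by norm_num)]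
  · rw [one_mul, one_mul, neg_one_mul, neg_one_mul, log_neg_of_im_pos, log_neg_of_im_neg]
    · ring
    · simpa using hc
    · simpa using hd
  · intro y
    refine Complex.mem_slitPlane_iff.2 (Or.inl ?_)
    simpa using ha
  · intro y
    refine Complex.mem_slitPlane_iff.2 (Or.inl ?_)
    simpa using hb

/-- Cauchy's integral formula for a rectangle. -/
theorem rectIntegral_div_sub {a b c d : ℝ} {w : ℂ} {f F : ℂ → ℂ} {U : Set ℂ}
    (ha : a < w.re) (hb : w.re < b) (hc : c < w.im) (hd : w.im < d) (hU : IsOpen U)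
    (hsub : Icc a b ×ℂ Icc c d ⊆ U) (hF : DifferentiableOn ℂ F U)
    (hf : ∀ z ∈ Icc a b ×ℂ Icc c d, z ≠ w → f z = F z / (z - w)) :
    rectIntegral a b c d f = 2 * Real.pi * Complex.I * F w := by
  have hab : a ≤ b := (ha.trans hb).le
  have hcd : c ≤ d := (hc.trans hd).le
  have hw : w ∈ U := hsub ⟨⟨ha.le, hb.le⟩, ⟨hc.le, hd.le⟩⟩
  have hG : DifferentiableOn ℂ (dslope F w) U :=
    (Complex.differentiableOn_dslope (hU.mem_nhds hw)).2 hF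
  -- Split off the polar part: f = (F(z) - F(w))/(z - w) + F(w)/(z - w), where the first summand
  -- extends holomorphically as `dslope F w`.
  rw [rectIntegral_add_const_mul (f := f) (g := dslope F w) (h := fun z => (z - w)⁻¹) (F w)
    (S := (Icc a b ×ℂ Icc c d) \ {w}), rectIntegral_inv_sub ha hb hc hd, rectIntegral_eq_zero]
  · ring
  · rw [uIcc_of_le hab, uIcc_of_le hcd]
    exact hG.mono hsub
  · exact hG.continuousOn.mono (sdiff_subset.trans hsub)
  · exact ContinuousOn.inv₀ (by fun_prop) fun z hz => sub_ne_zero.2 hz.2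
  · intro z hz
    have hz' : z - w ≠ 0 := sub_ne_zero.2 hz.2
    rw [hf z hz.1 hz.2, dslope_of_ne _ hz.2, slope_def_field]
    field_simp
    ring
  · intro x hx y hy h
    rw [uIcc_of_le hab] at hx
    rw [uIcc_of_le hcd] at hy
    refine ⟨⟨by simpa using hx, by simpa using hy⟩, fun h0 => ?_⟩
    have e1 := congrArg Complex.re (mem_singleton_iff.1 h0)
    have e2 := congrArg Complex.im (mem_singleton_iff.1 h0)
    simp at e1 e2
    subst e1 e2
    rcases h with h | h | h | h <;> simp [h] at ha hb hc hd

/-- The regular factor `(z + k) Γ(z)` of the Gamma function at its pole `-k`. -/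
noncomputable def gammaRegular (k : ℕ) (z : ℂ) : ℂ :=
  Complex.Gamma (z + k + 1) / ∏ i ∈ Finset.range k, (z + i)

theorem Gamma_eq_gammaRegular_div (k : ℕ) {z : ℂ} (hz : ∀ i ≤ k, z ≠ -(i : ℂ)) :
    Complex.Gamma z = gammaRegular k z / (z - -(k : ℂ)) := by
  induction k with
  | zero =>
    have h0 : z ≠ 0 := by simpa using hz 0 le_rfl
    simp [gammaRegular, Complex.Gamma_add_one z h0, h0]
  | succ k ih =>
    have hk : z + (k + 1 : ℕ) ≠ 0 := fun h => hz (k + 1) le_rfl (eq_neg_of_add_eq_zero_left h)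
    have hk' : z + k ≠ 0 := fun h => hz k (by omega) (eq_neg_of_add_eq_zero_left h)
    rw [ih fun i hi => hz i (by omega)]
    unfold gammaRegular
    rw [Finset.prod_range_succ, Complex.Gamma_add_one _ hk]
    have e : z + (k + 1 : ℕ) = z + k + 1 := by push_cast; ring
    rw [e] at hk ⊢
    rw [sub_neg_eq_add, sub_neg_eq_add, div_div, div_div, show z + ((k + 1 : ℕ) : ℂ) = z + k + 1 from e,
      mul_div_mul_comm (z + k + 1)]
    have hP : ∏ i ∈ Finset.range k, (z + (i : ℂ)) ≠ 0 := Finset.prod_ne_zero_iff.2 fun i hi h =>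
      hz i (by have := Finset.mem_range.1 hi; omega) (eq_neg_of_add_eq_zero_left h)
    field_simp

/-- This is the residue of Γ at -k: the product in the denominator becomes (-1)^k k!. -/
theorem gammaRegular_neg (k : ℕ) : gammaRegular k (-(k : ℂ)) = (-1) ^ k / k.factorial := by
  have h : ∏ i ∈ Finset.range k, (-(k : ℂ) + i) = (-1) ^ k * k.factorial := by
    have h2 : ∀ i ∈ Finset.range k, (-(k : ℂ) + i) = (-1) * (((k - 1 - i : ℕ) : ℂ) + 1) := by
      intro i hi
      have := Finset.mem_range.1 hi
      rw [Nat.cast_sub (by omega), Nat.cast_sub (by omega)]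
      push_cast
      ring
    rw [Finset.prod_congr rfl h2, Finset.prod_mul_distrib, Finset.prod_const, Finset.card_range,
      Finset.prod_range_reflect (fun i => ((i : ℂ) + 1)) k, ← Finset.prod_range_add_one_eq_factorial]
    push_cast
    rfl
  rw [gammaRegular, h, neg_add_cancel, zero_add, Complex.Gamma_one]
  have : ((-1 : ℂ) ^ k) * (-1) ^ k = 1 := by rw [← mul_pow]; simp
  have hf : (k.factorial : ℂ) ≠ 0 := by exact_mod_cast k.factorial_ne_zero
  have hm : ((-1 : ℂ) ^ k) ≠ 0 := pow_ne_zero _ (by norm_num)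
  field_simp
  rw [sq, this]

/-- A region where `gammaRegular k` is holomorphic. -/
theorem differentiableOn_gammaRegular (k : ℕ) :
    DifferentiableOn ℂ (gammaRegular k) {z | -(k : ℝ) - 1 < z.re ∧ (k = 0 ∨ z.re < -(k : ℝ) + 1)} := by
  intro z hz
  refine DifferentiableAt.differentiableWithinAt (DifferentiableAt.div ?_ ?_ ?_)
  · refine DifferentiableAt.comp (g := Complex.Gamma) (f := fun z : ℂ => z + k + 1) z ?_ (by fun_prop)
    refine Complex.differentiableAt_Gamma _ fun m hm => ?_
    have := congrArg Complex.re hm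
    simp at this
    have hm' : (0 : ℝ) ≤ m := m.cast_nonneg
    have := hz.1
    linarith
  · exact DifferentiableAt.fun_finsetProd fun i _ => by fun_prop
  · refine Finset.prod_ne_zero_iff.2 fun i hi h => ?_
    have hi' := Finset.mem_range.1 hi
    rcases hz.2 with h0 | h1
    · omega
    · have := congrArg Complex.re h
      simp at this
      have : (i : ℝ) + 1 ≤ k := by exact_mod_cast hi'
      linarith

theorem Gamma_eq_gammaRegular_div_of_re {k : ℕ} {z : ℂ}
    (hz : -(k : ℝ) - 1 < z.re ∧ (k = 0 ∨ z.re < -(k : ℝ) + 1)) (hk : z ≠ -(k : ℂ)) :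
    Complex.Gamma z = gammaRegular k z / (z - -(k : ℂ)) := by
  refine Gamma_eq_gammaRegular_div k fun i hi h => ?_
  rcases hi.lt_or_eq with hlt | rfl
  · rcases hz.2 with h0 | h1
    · omega
    · have := congrArg Complex.re h
      simp at this
      have : (i : ℝ) + 1 ≤ k := by exact_mod_cast hlt
      linarith
  · exact hk h

/-! ### Improper integrals along vertical lines -/

theorem HasLineIntegral.of_integrable {f : ℂ → ℂ} {c : ℝ} (hf : LineIntegrable f c) :
    HasLineIntegral f c (Complex.I * ∫ τ : ℝ, f (c + τ * Complex.I)) := by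
  refine ⟨hf.locallyIntegrable, ?_⟩
  refine Tendsto.const_mul _ ?_
  refine intervalIntegral_tendsto_integral hf ?_ ?_
  · rw [← prod_atTop_atTop_eq]
    exact tendsto_neg_atTop_atBot.comp tendsto_fst
  · rw [← prod_atTop_atTop_eq]
    exact tendsto_snd

theorem HasLineIntegral.congr_ae {f g : ℂ → ℂ} {c : ℝ} {L : ℂ} (hf : HasLineIntegral f c L)
    (h : ∀ᵐ τ : ℝ, f (c + τ * Complex.I) = g (c + τ * Complex.I)) : HasLineIntegral g c L := by
  refine ⟨fun x => ?_, hf.2.congr fun T => ?_⟩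
  · obtain ⟨s, hs, hi⟩ := hf.1 x
    exact ⟨s, hs, hi.congr (ae_restrict_of_ae h)⟩
  · congr 1
    exact intervalIntegral.integral_congr_ae (h.mono fun τ hτ _ => hτ)

theorem HasLineIntegral.const_mul {f : ℂ → ℂ} {c : ℝ} {L : ℂ} (hf : HasLineIntegral f c L) (k : ℂ) :
    HasLineIntegral (fun s => k * f s) c (k * L) := by
  refine ⟨fun x => ?_, ?_⟩
  · obtain ⟨s, hs, hi⟩ := hf.1 x
    exact ⟨s, hs, hi.const_mul k⟩
  · refine (hf.2.const_mul k).congr fun T => ?_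
    rw [intervalIntegral.integral_const_mul]
    ring

/-- Moving a line integral across a simple pole at `w`, to the right. -/
theorem HasLineIntegral.shift {f F : ℂ → ℂ} {a b : ℝ} {w L : ℂ} {U : Set ℂ}
    (ha : a < w.re) (hb : w.re < b) (hU : IsOpen U) (hsub : Complex.re ⁻¹' Icc a b ⊆ U)
    (hF : DifferentiableOn ℂ F U) (hf : ∀ z ∈ Complex.re ⁻¹' Icc a b, z ≠ w → f z = F z / (z - w))
    (htop : Tendsto (fun T : ℝ => ∫ x in a..b, f (x + T * Complex.I)) atTop (𝓝 0))
    (hbot : Tendsto (fun T : ℝ => ∫ x in a..b, f (x + (-T : ℝ) * Complex.I)) atTop (𝓝 0))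
    (hL : HasLineIntegral f a L) : HasLineIntegral f b (L + 2 * Real.pi * Complex.I * F w) := by
  have hab : a ≤ b := (ha.trans hb).le
  refine ⟨Continuous.locallyIntegrable ?_, ?_⟩
  · have hne : ∀ τ : ℝ, (b : ℂ) + τ * Complex.I - w ≠ 0 := fun τ h => by
      have := congrArg Complex.re h
      simp at this
      linarith
    have hmem : ∀ τ : ℝ, (b : ℂ) + τ * Complex.I ∈ Complex.re ⁻¹' Icc a b := fun τ => by simpa using hab
    have h1 : Continuous fun τ : ℝ => F (b + τ * Complex.I) :=
      hF.continuousOn.comp_continuous (by fun_prop) fun τ => hsub (hmem τ)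
    have h2 : (fun τ : ℝ => f (b + τ * Complex.I))
        = fun τ : ℝ => F (b + τ * Complex.I) / (b + τ * Complex.I - w) :=
      funext fun τ => hf _ (hmem τ) (sub_ne_zero.1 (hne τ))
    rw [h2]
    exact h1.div (by fun_prop) hne
  · have h1 : Tendsto (fun T : ℝ × ℝ => T.1) atTop atTop := by
      rw [← prod_atTop_atTop_eq]
      exact tendsto_fst
    have h2 : Tendsto (fun T : ℝ × ℝ => T.2) atTop atTop := by
      rw [← prod_atTop_atTop_eq]
      exact tendsto_snd
    have hlim := ((hL.2.add_const (2 * Real.pi * Complex.I * F w)).sub (hbot.comp h1)).add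
      (htop.comp h2)
    simp only [sub_zero, add_zero] at hlim
    refine hlim.congr' ?_
    -- Once both ends lie beyond Im w the pole is inside the rectangle; the two horizontal sides are
    -- the only discrepancy, and they tend to 0 independently.
    filter_upwards [h1.eventually (eventually_gt_atTop (-w.im)), h2.eventually (eventually_gt_atTop w.im)]
      with T hT1 hT2
    have hr := rectIntegral_div_sub (c := -T.1) (d := T.2) ha hb (by linarith) hT2 hU
      (fun z hz => hsub hz.1) hF fun z hz => hf z hz.1
    rw [← hr, rectIntegral]
    simp only [Function.comp]
    push_cast
    ring

/-! ### Mellin-Barnes integrals as sums of residues -/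

theorem norm_sin_le_exp (w : ℂ) : ‖Complex.sin w‖ ≤ Real.exp |w.im| := by
  rw [Complex.sin, norm_div, norm_mul, Complex.norm_I, mul_one, Complex.norm_ofNat]
  have h1 : ‖Complex.exp (-w * Complex.I)‖ ≤ Real.exp |w.im| := by
    rw [Complex.norm_exp]
    exact Real.exp_le_exp.2 (by simpa using le_abs_self _)
  have h2 : ‖Complex.exp (w * Complex.I)‖ ≤ Real.exp |w.im| := by
    rw [Complex.norm_exp]
    exact Real.exp_le_exp.2 (by simpa using neg_le_abs _)
  have := norm_sub_le (Complex.exp (-w * Complex.I)) (Complex.exp (w * Complex.I))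
  linarith

/-- By reflection an upper bound for 1/Γ follows from an upper bound for Γ and the trivial one for
the sine, so no lower Stirling bound is needed. -/
theorem inv_Gamma_eq (w : ℂ) (hw : w.im ≠ 0) :
    (Complex.Gamma w)⁻¹ = Complex.Gamma (1 - w) * Complex.sin (Real.pi * w) / Real.pi := by
  have h := Complex.Gamma_mul_Gamma_one_sub w
  have hΓ : Complex.Gamma w ≠ 0 := Complex.Gamma_ne_zero fun m hm => hw (by simp [hm])
  have hs : Complex.sin (Real.pi * w) ≠ 0 := by
    rw [Complex.sin_ne_zero_iff]
    intro k hk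
    rw [mul_comm (k : ℂ)] at hk
    have := mul_left_cancel₀ (Complex.ofReal_ne_zero.2 Real.pi_ne_zero) hk
    exact hw (by simp [this])
  have hπ : (Real.pi : ℂ) ≠ 0 := Complex.ofReal_ne_zero.2 Real.pi_ne_zero
  rw [eq_div_iff hs] at h
  rw [eq_div_iff hπ, inv_mul_eq_iff_eq_mul₀ hΓ, ← mul_assoc, h]

theorem rpow_le_rpow_add_rpow {x u t v : ℝ} (hx : 0 < x) (hu : u ≤ t) (hv : t ≤ v) :
    x ^ t ≤ x ^ u + x ^ v := by
  rcases le_total 1 x with h | h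
  · have := Real.rpow_le_rpow_of_exponent_le h hv
    have := (Real.rpow_pos_of_pos hx u).le
    linarith
  · have := Real.rpow_le_rpow_of_exponent_ge hx h hu
    have := (Real.rpow_pos_of_pos hx v).le
    linarith

/-- Stirling upper bound for the Gamma quotient of the Mellin-Barnes integrand. -/
theorem exists_norm_Gamma_div_Gamma_le (a θ A B : ℝ) (hθ : 1 ≤ θ) :
    ∃ C : ℝ, 0 < C ∧ ∀ σ τ : ℝ, A ≤ σ → σ ≤ B → θ ≤ |τ| →
      ‖Complex.Gamma (σ + τ * Complex.I) / Complex.Gamma (a - (σ + τ * Complex.I) / θ)‖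
        ≤ C * (|τ| ^ (σ + σ / θ - a) * Real.exp (-(Real.pi / 2 * (1 - 1 / θ) * |τ|))) := by
  have hθ0 : 0 < θ := by linarith
  obtain ⟨C₁, hC₁, h₁⟩ := exists_norm_Gamma_le_Icc A B
  obtain ⟨C₂, hC₂, h₂⟩ := exists_norm_Gamma_le_Icc (1 - a + A / θ) (1 - a + B / θ)
  refine ⟨C₁ * C₂ * θ ^ (-(1 / 2 - a + A / θ)), by positivity, fun σ τ hA hB hτ => ?_⟩
  have hτ1 : 1 ≤ |τ| := hθ.trans hτ
  have hτ0 : 0 < |τ| := by linarith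
  have hτθ : |τ / θ| = |τ| / θ := by rw [abs_div, abs_of_pos hθ0]
  have b₁ := h₁ σ τ hA hB hτ1
  have b₂ := h₂ (1 - a + σ / θ) (τ / θ) (by gcongr) (by gcongr)
    (by rw [hτθ, le_div_iff₀ hθ0]; linarith)
  have him : ((a : ℂ) - (σ + τ * Complex.I) / θ).im = -(τ / θ) := by
    have e : (a : ℂ) - (σ + τ * Complex.I) / θ
        = ((a - σ / θ : ℝ) : ℂ) + ((-(τ / θ) : ℝ) : ℂ) * Complex.I := by
      push_cast
      ring
    rw [e]
    simp
  have hne : ((a : ℂ) - (σ + τ * Complex.I) / θ).im ≠ 0 := by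
    rw [him]
    refine neg_ne_zero.2 (div_ne_zero (fun h => ?_) hθ0.ne')
    simp [h] at hτ0
  rw [div_eq_mul_inv, inv_Gamma_eq _ hne, norm_mul, norm_div, norm_mul, Complex.norm_real,
    Real.norm_eq_abs, abs_of_pos Real.pi_pos]
  have e1 : (1 : ℂ) - (a - (σ + τ * Complex.I) / θ)
      = ((1 - a + σ / θ : ℝ) : ℂ) + ((τ / θ : ℝ) : ℂ) * Complex.I := by
    push_cast
    ring
  have hsin : ‖Complex.sin (Real.pi * (a - (σ + τ * Complex.I) / θ))‖
      ≤ Real.exp (Real.pi * (|τ| / θ)) := by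
    refine (norm_sin_le_exp _).trans (le_of_eq ?_)
    rw [Complex.im_ofReal_mul, him, abs_mul, abs_neg, hτθ, abs_of_pos Real.pi_pos]
  rw [e1]
  -- The power of θ is made independent of σ by means of σ ≥ A and θ ≥ 1.
  have hpow : (|τ| / θ) ^ (1 - a + σ / θ - 1 / 2)
      ≤ |τ| ^ (1 - a + σ / θ - 1 / 2) * θ ^ (-(1 / 2 - a + A / θ)) := by
    rw [Real.div_rpow hτ0.le hθ0.le, div_eq_mul_inv, ← Real.rpow_neg hθ0.le]
    refine mul_le_mul_of_nonneg_left (Real.rpow_le_rpow_of_exponent_le hθ ?_) (by positivity)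
    have : A / θ ≤ σ / θ := by gcongr
    linarith
  rw [hτθ] at b₂
  calc _ ≤ (C₁ * (|τ| ^ (σ - 1 / 2) * Real.exp (-(Real.pi * |τ| / 2))))
        * ((C₂ * ((|τ| ^ (1 - a + σ / θ - 1 / 2) * θ ^ (-(1 / 2 - a + A / θ)))
          * Real.exp (-(Real.pi * (|τ| / θ) / 2)))) * Real.exp (Real.pi * (|τ| / θ)) / 1) := by
        gcongr
        · exact b₂.trans (by gcongr)
        · linarith [Real.pi_gt_three]
    -- The exponential rates add up to -π/2 - π/(2θ) + π/θ = -(π/2)(1 - 1/θ).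
    _ = C₁ * C₂ * θ ^ (-(1 / 2 - a + A / θ))
        * ((|τ| ^ (σ - 1 / 2) * |τ| ^ (1 - a + σ / θ - 1 / 2))
        * (Real.exp (-(Real.pi * |τ| / 2)) * Real.exp (-(Real.pi * (|τ| / θ) / 2))
          * Real.exp (Real.pi * (|τ| / θ)))) := by ring
    _ = _ := by
        rw [← Real.rpow_add hτ0, ← Real.exp_add, ← Real.exp_add]
        ring_nf

/-- The Mellin-Barnes integrand `Γ(z) / Γ(a - z/θ) · x^{-z} · H(z)`. -/
noncomputable def mellinBarnesIntegrand (a θ x : ℝ) (H : ℂ → ℂ) (z : ℂ) : ℂ :=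
  Complex.Gamma z / Complex.Gamma (a - z / θ) * (x : ℂ) ^ (-z) * H z

theorem norm_ofReal_cpow_neg {x : ℝ} (hx : 0 < x) (σ τ : ℝ) :
    ‖(x : ℂ) ^ (-((σ : ℂ) + τ * Complex.I))‖ = x ^ (-σ) := by
  rw [Complex.norm_cpow_eq_rpow_re_of_pos hx]
  simp

theorem norm_mellinBarnesIntegrand {a θ x : ℝ} (hx : 0 < x) (H : ℂ → ℂ) (σ τ : ℝ) :
    ‖mellinBarnesIntegrand a θ x H (σ + τ * Complex.I)‖
      = ‖Complex.Gamma (σ + τ * Complex.I) / Complex.Gamma (a - (σ + τ * Complex.I) / θ)‖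
        * x ^ (-σ) * ‖H (σ + τ * Complex.I)‖ := by
  rw [mellinBarnesIntegrand, norm_mul, norm_mul, norm_ofReal_cpow_neg hx]

/-- For `θ > 1` the integrand decays faster than any power. -/
theorem exists_norm_mellinBarnesIntegrand_le_pow {a θ x A B M : ℝ} (hθ : 1 < θ) (hx : 0 < x)
    (hM0 : 0 ≤ M)
    {H : ℂ → ℂ} (hM : ∀ z : ℂ, z.re ≤ B → ‖H z‖ ≤ M) (N : ℝ) :
    ∃ C : ℝ, 0 ≤ C ∧ ∀ σ τ : ℝ, A ≤ σ → σ ≤ B → θ ≤ |τ| →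
      ‖mellinBarnesIntegrand a θ x H (σ + τ * Complex.I)‖ ≤ C * |τ| ^ (-N) := by
  obtain ⟨C, hC, h⟩ := exists_norm_Gamma_div_Gamma_le a θ A B hθ.le
  have hθ0 : 0 < θ := by linarith
  set δ := Real.pi / 2 * (1 - 1 / θ) with hδ
  have hδ0 : 0 < δ := by
    have : 1 / θ < 1 := by rw [div_lt_one hθ0]; exact hθ
    have := Real.pi_pos
    rw [hδ]
    exact mul_pos (by positivity) (by linarith)
  obtain ⟨n, hn⟩ := exists_nat_ge (B + B / θ - a + N)
  refine ⟨C * (n.factorial / δ ^ n) * (x ^ (-B) + x ^ (-A)) * M, by positivity,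
    fun σ τ hA hB hτ => ?_⟩
  have hτ1 : 1 ≤ |τ| := hθ.le.trans hτ
  have hτ0 : 0 < |τ| := by linarith
  have key : |τ| ^ (σ + σ / θ - a) * Real.exp (-(δ * |τ|)) ≤ n.factorial / δ ^ n * |τ| ^ (-N) := by
    have h1 : |τ| ^ (σ + σ / θ - a) ≤ |τ| ^ n * |τ| ^ (-N) := by
      rw [← Real.rpow_natCast, ← Real.rpow_add hτ0]
      refine Real.rpow_le_rpow_of_exponent_le hτ1 ?_
      have : σ / θ ≤ B / θ := by gcongr
      linarith
    have h2 := Real.pow_div_factorial_le_exp (δ * |τ|) (by positivity) n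
    have h3 : |τ| ^ n * Real.exp (-(δ * |τ|)) ≤ n.factorial / δ ^ n := by
      rw [Real.exp_neg, ← div_eq_mul_inv, div_le_div_iff₀ (Real.exp_pos _) (by positivity)]
      rw [div_le_iff₀ (by positivity), mul_pow] at h2
      linarith
    calc _ ≤ |τ| ^ n * |τ| ^ (-N) * Real.exp (-(δ * |τ|)) := by gcongr
      _ = |τ| ^ n * Real.exp (-(δ * |τ|)) * |τ| ^ (-N) := by ring
      _ ≤ _ := by gcongr
  rw [norm_mellinBarnesIntegrand hx]
  calc _ ≤ C * (n.factorial / δ ^ n * |τ| ^ (-N)) * (x ^ (-B) + x ^ (-A)) * M := by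
        gcongr
        · exact (h σ τ hA hB hτ).trans (by gcongr)
        · exact rpow_le_rpow_add_rpow hx (by linarith) (by linarith)
        · exact hM _ (by simpa using hB)
    _ = _ := by ring

/-- Decay of the integrand along horizontal lines. -/
theorem exists_norm_mellinBarnesIntegrand_le {a θ x A c M r : ℝ} (hθ : 1 ≤ θ) (hx : 0 < x)
    (hM0 : 0 ≤ M)
    {H : ℂ → ℂ} (hM : ∀ z : ℂ, z.re ≤ c → ‖H z‖ ≤ M)
    (hMr : ∀ z : ℂ, z.re ≤ c → 1 ≤ |z.im| → ‖H z‖ ≤ M * |z.im| ^ (-r))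
    (hc : 1 < θ ∨ 2 * c - a * θ - r ≤ 0) :
    ∃ C : ℝ, 0 ≤ C ∧ ∀ σ τ : ℝ, A ≤ σ → σ ≤ c → θ ≤ |τ| →
      ‖mellinBarnesIntegrand a θ x H (σ + τ * Complex.I)‖ ≤ C * |τ| ^ (σ - c) := by
  rcases hθ.lt_or_eq with hθ1 | rfl
  · obtain ⟨C, hC, h⟩ := exists_norm_mellinBarnesIntegrand_le_pow (a := a) (A := A) hθ1 hx hM0 hM (c - A)
    refine ⟨C, hC, fun σ τ hA hB hτ => (h σ τ hA hB hτ).trans ?_⟩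
    gcongr
    · linarith
    · linarith
  · obtain ⟨C, hC, h⟩ := exists_norm_Gamma_div_Gamma_le a 1 A c le_rfl
    -- Here the restriction on the abscissa for θ = 1 enters: together with σ ≤ c it gives 2σ - a -
    -- r ≤ σ - c.
    have hc' : 2 * c - a - r ≤ 0 := by
      rcases hc with h | h
      · exact absurd h (lt_irrefl _)
      · simpa using h
    refine ⟨C * (x ^ (-c) + x ^ (-A)) * M, by positivity, fun σ τ hA hB hτ => ?_⟩
    have hτ0 : 0 < |τ| := by linarith
    have b := h σ τ hA hB hτ
    rw [norm_mellinBarnesIntegrand hx]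
    simp only [div_one, sub_self, mul_zero, zero_mul, neg_zero, Real.exp_zero, mul_one] at b
    calc _ ≤ C * |τ| ^ (σ + σ - a) * (x ^ (-c) + x ^ (-A)) * (M * |τ| ^ (-r)) := by
          gcongr
          · exact rpow_le_rpow_add_rpow hx (by linarith) (by linarith)
          · simpa using hMr (σ + τ * Complex.I) (by simpa using hB) (by simpa using hτ)
      _ = C * (x ^ (-c) + x ^ (-A)) * M * (|τ| ^ (σ + σ - a) * |τ| ^ (-r)) := by ring
      _ ≤ _ := by
          rw [← Real.rpow_add hτ0]
          gcongr
          · linarith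

/-- The holomorphic factor of the Mellin-Barnes integrand. -/
noncomputable def mellinBarnesFactor (a θ x : ℝ) (H : ℂ → ℂ) (z : ℂ) : ℂ :=
  (Complex.Gamma (a - z / θ))⁻¹ * (x : ℂ) ^ (-z) * H z

theorem mellinBarnesIntegrand_eq (a θ x : ℝ) (H : ℂ → ℂ) (z : ℂ) :
    mellinBarnesIntegrand a θ x H z = Complex.Gamma z * mellinBarnesFactor a θ x H z := by
  rw [mellinBarnesIntegrand, mellinBarnesFactor, div_eq_mul_inv]
  ring

theorem differentiableOn_mellinBarnesFactor {a θ x b : ℝ} (hx : 0 < x) {H : ℂ → ℂ}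
    (hH : DifferentiableOn ℂ H {z | z.re < b}) :
    DifferentiableOn ℂ (mellinBarnesFactor a θ x H) {z | z.re < b} := by
  refine DifferentiableOn.mul (Differentiable.differentiableOn ?_) hH
  refine Differentiable.mul ?_ ?_
  · exact Complex.differentiable_one_div_Gamma.comp (f := fun z : ℂ => a - z / θ) (by fun_prop)
  · have : (x : ℂ) ≠ 0 := Complex.ofReal_ne_zero.2 hx.ne'
    intro z
    exact DifferentiableAt.const_cpow (by fun_prop) (Or.inl this)

theorem continuous_mellinBarnesIntegrand_line {a θ x b c : ℝ} (hx : 0 < x) {H : ℂ → ℂ}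
    (hH : DifferentiableOn ℂ H {z | z.re < b}) (hc : c < b) (hpole : ∀ m : ℕ, c ≠ -m) :
    Continuous fun τ : ℝ => mellinBarnesIntegrand a θ x H (c + τ * Complex.I) := by
  simp only [mellinBarnesIntegrand_eq]
  refine Continuous.mul ?_ ?_
  · refine continuous_iff_continuousAt.2 fun τ => ?_
    refine ContinuousAt.comp (g := Complex.Gamma) (f := fun τ : ℝ => (c : ℂ) + τ * Complex.I) ?_
      (by fun_prop)
    refine (Complex.differentiableAt_Gamma _ fun m hm => hpole m ?_).continuousAt
    simpa using congrArg Complex.re hm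
  · exact (differentiableOn_mellinBarnesFactor hx hH).continuousOn.comp_continuous (by fun_prop)
      fun τ => by simpa using hc

/-- The bound C T^{u-c} tends to 0 for every u < c and stays below C up to u = c. Dominated
convergence therefore works even if the segment ends at e = c, where there may be no decay at all.
The sign `ε` serves the two ends of the line. -/
theorem tendsto_horizontal_mellinBarnesIntegrand {a θ x A b c M r : ℝ} (hθ : 1 ≤ θ) (hx : 0 < x)
    (hM0 : 0 ≤ M) {e : ℝ} (he : e ≤ c) (hAe : A ≤ e) (hcb : c < b)
    {H : ℂ → ℂ} (hH : DifferentiableOn ℂ H {z | z.re < b}) (hM : ∀ z : ℂ, z.re ≤ c → ‖H z‖ ≤ M)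
    (hMr : ∀ z : ℂ, z.re ≤ c → 1 ≤ |z.im| → ‖H z‖ ≤ M * |z.im| ^ (-r))
    (hc : 1 < θ ∨ 2 * c - a * θ - r ≤ 0) (ε : ℝ) (hε : |ε| = 1) :
    Tendsto (fun T : ℝ => ∫ u in A..e,
      mellinBarnesIntegrand a θ x H (u + (ε * T : ℝ) * Complex.I)) atTop (𝓝 0) := by
  obtain ⟨C, hC, h⟩ := exists_norm_mellinBarnesIntegrand_le (a := a) (A := A) hθ hx hM0 hM hMr hc
  have habs : ∀ T : ℝ, 0 < T → |ε * T| = T := fun T hT => by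
    rw [abs_mul, hε, one_mul, abs_of_pos hT]
  have hb : ∀ T : ℝ, θ ≤ T → ∀ u ∈ uIoc A e,
      ‖mellinBarnesIntegrand a θ x H (u + (ε * T : ℝ) * Complex.I)‖ ≤ C * T ^ (u - c) := by
    intro T hT u hu
    rw [uIoc_of_le hAe] at hu
    have e1 := habs T (by linarith)
    have := h u (ε * T) hu.1.le (hu.2.trans he) (by rwa [e1])
    rwa [e1] at this
  have key := intervalIntegral.tendsto_integral_filter_of_dominated_convergence
    (μ := volume) (a := A) (b := e) (l := atTop) (f := fun _ => (0 : ℂ))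
    (F := fun (T : ℝ) (u : ℝ) => mellinBarnesIntegrand a θ x H (u + (ε * T : ℝ) * Complex.I))
    (fun _ => C) ?_ ?_ ?_ ?_
  · simpa using key
  · filter_upwards [eventually_ge_atTop θ] with T hT
    refine ContinuousOn.aestronglyMeasurable ?_ measurableSet_uIoc
    simp only [mellinBarnesIntegrand_eq]
    refine ContinuousOn.mul ?_ ?_
    · refine fun u _ => ContinuousAt.continuousWithinAt ?_
      refine ContinuousAt.comp (g := Complex.Gamma)
        (f := fun u : ℝ => (u : ℂ) + (ε * T : ℝ) * Complex.I) ?_ (by fun_prop)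
      refine (Complex.differentiableAt_Gamma _ fun m hm => ?_).continuousAt
      have e1 := habs T (by linarith)
      have := congrArg Complex.im hm
      simp only [Complex.add_im, Complex.ofReal_im, Complex.mul_im, Complex.ofReal_re,
        Complex.I_im, mul_one, Complex.I_re, mul_zero, add_zero, zero_add, Complex.neg_im,
        Complex.natCast_im, neg_zero] at this
      rw [this] at e1
      simp at e1
      linarith
    · refine (differentiableOn_mellinBarnesFactor hx hH).continuousOn.comp (by fun_prop) fun u hu => ?_
      rw [uIoc_of_le hAe] at hu
      have := hu.2
      simp
      linarith
  · filter_upwards [eventually_ge_atTop θ] with T hT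
    refine Eventually.of_forall fun u hu => (hb T hT u hu).trans ?_
    rw [uIoc_of_le hAe] at hu
    refine mul_le_of_le_one_right hC (Real.rpow_le_one_of_one_le_of_nonpos (by linarith) ?_)
    linarith [hu.2]
  · exact intervalIntegrable_const
  · filter_upwards [Measure.ae_ne volume c] with u hu hmem
    have hlt : u < c := by
      refine lt_of_le_of_ne ?_ hu
      rw [uIoc_of_le hAe] at hmem
      exact hmem.2.trans he
    refine squeeze_zero_norm' (a := fun T : ℝ => C * T ^ (-(c - u))) ?_ ?_
    · filter_upwards [eventually_ge_atTop θ] with T hT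
      have := hb T hT u hmem
      rwa [neg_sub]
    · simpa using (tendsto_rpow_neg_atTop (sub_pos.2 hlt)).const_mul C

theorem integrable_of_continuous_of_le {f : ℝ → ℂ} (hf : Continuous f) {C R : ℝ}
    (h : ∀ τ : ℝ, R ≤ |τ| → ‖f τ‖ ≤ C * (1 + τ ^ 2)⁻¹) : Integrable f := by
  rw [← integrableOn_univ, ← union_compl_self (Icc (-R) R)]
  refine IntegrableOn.union (hf.continuousOn.integrableOn_compact isCompact_Icc) ?_
  refine Integrable.mono' ((integrable_inv_one_add_sq.const_mul C).integrableOn)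
    hf.aestronglyMeasurable ?_
  filter_upwards [ae_restrict_mem measurableSet_Icc.compl] with τ hτ
  refine h τ ?_
  by_contra hlt
  exact hτ (abs_le.1 (not_le.1 hlt).le)

theorem lineIntegrable_mellinBarnesIntegrand {a θ x b c M : ℝ} (hθ : 1 < θ) (hx : 0 < x)
    (hM0 : 0 ≤ M) (hc0 : 0 < c) (hcb : c < b) {H : ℂ → ℂ}
    (hH : DifferentiableOn ℂ H {z | z.re < b}) (hM : ∀ z : ℂ, z.re ≤ c → ‖H z‖ ≤ M) :
    LineIntegrable (mellinBarnesIntegrand a θ x H) c := by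
  obtain ⟨C, hC, h⟩ := exists_norm_mellinBarnesIntegrand_le_pow (a := a) (A := c) hθ hx hM0 hM 2
  refine integrable_of_continuous_of_le (C := 2 * C) (R := θ)
    (continuous_mellinBarnesIntegrand_line hx hH hcb fun m => ?_) fun τ hτ => ?_
  · have : (0 : ℝ) ≤ m := m.cast_nonneg
    linarith
  · refine (h c τ le_rfl le_rfl hτ).trans ?_
    have hτ1 : 1 ≤ |τ| := hθ.le.trans hτ
    have h2 : |τ| ^ (-2 : ℝ) = (τ ^ 2)⁻¹ := by
      rw [Real.rpow_neg (abs_nonneg _), ← sq_abs]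
      norm_num
    have h3 : 1 ≤ τ ^ 2 := by
      rw [← sq_abs]
      nlinarith
    rw [h2, mul_comm 2 C, mul_assoc]
    gcongr
    rw [← div_eq_mul_inv, le_div_iff₀ (by positivity), inv_mul_le_iff₀ (by linarith)]
    linarith

/-- Both Gamma factors are bounded below by multiples of g = |Γ(3/2 + iτ)|, and g² cosh(πτ) = π(1/4
+ τ²) exactly. So the exponentials cancel for every θ ≥ 1 and an integrable function of τ remains,
with 1/Γ(s) to spare. -/
theorem inv_norm_Gamma_mul_norm_Gamma_le {s t : ℝ} (τ : ℝ) {τ' : ℝ} (hs : 3 / 2 ≤ s) (ht : 3 / 2 ≤ t)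
    (hτ : |τ'| ≤ |τ|) :
    (‖Complex.Gamma (s + τ * Complex.I)‖ * ‖Complex.Gamma (t + τ' * Complex.I)‖
        * Real.cosh (Real.pi * τ))⁻¹
      ≤ Real.Gamma (3 / 2) ^ 2 * Real.exp 1 / Real.Gamma s * (Real.pi * (1 / 4 + τ ^ 2))⁻¹ := by
  have hΓs := Real.Gamma_pos_of_pos (show 0 < s by linarith)
  have hΓt := Real.Gamma_pos_of_pos (show 0 < t by linarith)
  have hΓ := Real.Gamma_pos_of_pos (show (0 : ℝ) < 3 / 2 by norm_num)
  set g := ‖Complex.Gamma (((3 / 2 : ℝ) : ℂ) + τ * Complex.I)‖ with hg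
  have hg2 : g ^ 2 * Real.cosh (Real.pi * τ) = Real.pi * (1 / 4 + τ ^ 2) := by
    rw [hg, norm_Gamma_three_halves_sq]
    have := (Real.cosh_pos (Real.pi * τ)).ne'
    field_simp
  have hg0 : 0 ≤ g := norm_nonneg _
  have h1 := norm_Gamma_mul_Gamma_le τ (by norm_num) hs
  have h2 := norm_Gamma_mul_Gamma_le τ' (by norm_num) ht
  have h3 : g ≤ ‖Complex.Gamma (((3 / 2 : ℝ) : ℂ) + τ' * Complex.I)‖ :=
    norm_Gamma_anti (by norm_num) hτ
  have h4 := exp_neg_one_le_Gamma (show 0 < t by linarith)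
  have hcosh := Real.cosh_pos (Real.pi * τ)
  have hpi := Real.pi_pos
  have h5 : g * Real.exp (-1) ≤ Real.Gamma (3 / 2) * ‖Complex.Gamma (t + τ' * Complex.I)‖ :=
    le_trans (by gcongr) h2
  have h6 : Real.pi * (1 / 4 + τ ^ 2) * (Real.Gamma s * Real.exp (-1))
      ≤ Real.Gamma (3 / 2) ^ 2 * (‖Complex.Gamma (s + τ * Complex.I)‖
        * ‖Complex.Gamma (t + τ' * Complex.I)‖ * Real.cosh (Real.pi * τ)) := by
    rw [← hg2]
    calc _ = (g * Real.Gamma s) * (g * Real.exp (-1)) * Real.cosh (Real.pi * τ) := by ring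
      _ ≤ (Real.Gamma (3 / 2) * ‖Complex.Gamma (s + τ * Complex.I)‖)
          * (Real.Gamma (3 / 2) * ‖Complex.Gamma (t + τ' * Complex.I)‖)
          * Real.cosh (Real.pi * τ) := by gcongr
      _ = _ := by ring
  have hpos : 0 < Real.pi * (1 / 4 + τ ^ 2) * (Real.Gamma s * Real.exp (-1)) := by positivity
  rw [Real.exp_neg] at h6 hpos
  have hne : 0 < ‖Complex.Gamma (s + τ * Complex.I)‖
        * ‖Complex.Gamma (t + τ' * Complex.I)‖ * Real.cosh (Real.pi * τ) :=
    pos_of_mul_pos_right (hpos.trans_le h6) (by positivity)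
  calc _ ≤ Real.Gamma (3 / 2) ^ 2 / (Real.pi * (1 / 4 + τ ^ 2) * (Real.Gamma s * (Real.exp 1)⁻¹)) := by
        rw [inv_eq_one_div, div_le_div_iff₀ hne hpos]
        linarith
    _ = _ := by
        field_simp

/-- The integrand on the lines half way between the poles far to the left. -/
theorem exists_norm_mellinBarnesIntegrand_left_le {a θ x c M : ℝ} (hθ : 1 ≤ θ) (hx : 0 < x) (hc0 : 0 < c)
    {H : ℂ → ℂ} (hM : ∀ z : ℂ, z.re ≤ c → ‖H z‖ ≤ M) :
    ∃ (C : ℝ) (N₀ : ℕ), 0 ≤ C ∧ ∀ N ≥ N₀, ∀ τ : ℝ,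
      ‖mellinBarnesIntegrand a θ x H (((-(N : ℝ) - 1 / 2 : ℝ) : ℂ) + τ * Complex.I)‖
        ≤ C * (1 / 2) ^ N * (1 + τ ^ 2)⁻¹ := by
  have hθ0 : 0 < θ := by linarith
  have hM0 : 0 ≤ M := (norm_nonneg _).trans (hM 0 (by simpa using hc0.le))
  -- From this index on, the argument of the Gamma function in the denominator has real part at
  -- least 3/2.
  obtain ⟨N₁, hN₁⟩ := exists_nat_ge ((3 / 2 - a) * θ)
  set K := Real.Gamma (3 / 2) ^ 2 * Real.exp 1 with hK
  refine ⟨K * Real.exp (2 * x) * (4 * M), N₁ + 1, by positivity, fun N hN τ => ?_⟩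
  have hN' : (N₁ : ℝ) + 1 ≤ N := by exact_mod_cast hN
  have hN1 : (1 : ℝ) ≤ N := by
    have : (0 : ℝ) ≤ N₁ := N₁.cast_nonneg
    linarith
  have hpi := Real.pi_pos
  have hre : 3 / 2 ≤ a + ((N : ℝ) + 1 / 2) / θ := by
    have : 3 / 2 - a ≤ ((N : ℝ) + 1 / 2) / θ := by
      rw [le_div_iff₀ hθ0]
      linarith
    linarith
  have hle := inv_norm_Gamma_mul_norm_Gamma_le (s := (N : ℝ) + 3 / 2) (-τ)
    (τ' := -(τ / θ)) (by linarith) hre (by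
      rw [abs_neg, abs_neg, abs_div, abs_of_pos hθ0]
      exact div_le_self (abs_nonneg _) hθ)
  set z : ℂ := ((-(N : ℝ) - 1 / 2 : ℝ) : ℂ) + τ * Complex.I with hz
  have e1 : 1 - z = (((N : ℝ) + 3 / 2 : ℝ) : ℂ) + ((-τ : ℝ) : ℂ) * Complex.I := by
    rw [hz]; push_cast; ring
  have e2 : (a : ℂ) - z / θ
      = ((a + ((N : ℝ) + 1 / 2) / θ : ℝ) : ℂ) + ((-(τ / θ) : ℝ) : ℂ) * Complex.I := by
    rw [hz]; push_cast; ring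
  -- Half way between the poles |sin πz| is exactly cosh πτ, without zeros.
  have hsin : ‖Complex.sin (Real.pi * z)‖ = Real.cosh (Real.pi * τ) := by
    have e : (Real.pi : ℂ) * z = (Real.pi * τ : ℂ) * Complex.I - Real.pi / 2 - (N : ℂ) * Real.pi := by
      rw [hz]; push_cast; ring
    rw [e, Complex.sin_antiperiodic.sub_nat_mul_eq, Complex.sin_sub_pi_div_two, Complex.cos_mul_I, norm_mul,
      norm_pow, norm_neg, norm_neg, norm_one, one_pow, one_mul, ← Complex.ofReal_mul,
      ← Complex.ofReal_cosh, Complex.norm_real, Real.norm_eq_abs, abs_of_pos (Real.cosh_pos _)]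
  have hrefl : ‖Complex.Gamma z‖ = Real.pi * (‖Complex.Gamma (1 - z)‖ * Real.cosh (Real.pi * τ))⁻¹ := by
    have h := congrArg norm (Complex.Gamma_mul_Gamma_one_sub z)
    rw [norm_mul, norm_div, hsin, Complex.norm_real, Real.norm_eq_abs, abs_of_pos hpi] at h
    have h1 : ‖Complex.Gamma (1 - z)‖ ≠ 0 := by
      rw [norm_ne_zero_iff]
      refine Complex.Gamma_ne_zero_of_re_pos ?_
      rw [e1]
      simp
      linarith
    rw [mul_inv, ← eq_div_iff h1] at *
    rw [h]
    ring
  rw [hz, norm_mellinBarnesIntegrand hx, ← hz, norm_div, hrefl, e1, e2]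
  have hHz : ‖H z‖ ≤ M := hM z (by rw [hz]; simp; linarith)
  -- Choosing B = 2x in the lower bound for Γ beats the power of x by the geometric factor 2^{-N}.
  have hG : x ^ (-(-(N : ℝ) - 1 / 2)) / Real.Gamma ((N : ℝ) + 3 / 2)
      ≤ Real.exp (2 * x) * (1 / 2) ^ N := by
    have h1 := rpow_mul_exp_neg_le_Gamma (B := 2 * x) (x := (N : ℝ) + 1 / 2) (by linarith) (by linarith)
    rw [show (N : ℝ) + 1 / 2 + 1 = N + 3 / 2 by ring, Real.mul_rpow (by norm_num) hx.le] at h1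
    rw [div_le_iff₀ (Real.Gamma_pos_of_pos (by linarith)),
      show -(-(N : ℝ) - 1 / 2) = N + 1 / 2 by ring]
    have h2 : (2 : ℝ) ^ N ≤ 2 ^ ((N : ℝ) + 1 / 2) := by
      rw [← Real.rpow_natCast]
      exact Real.rpow_le_rpow_of_exponent_le (by norm_num) (by linarith)
    calc x ^ ((N : ℝ) + 1 / 2) = Real.exp (2 * x) * (1 / 2) ^ N
          * (2 ^ N * x ^ ((N : ℝ) + 1 / 2) * Real.exp (-(2 * x))) := by
          rw [Real.exp_neg, one_div, inv_pow]
          field_simp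
      _ ≤ _ := by
          refine mul_le_mul_of_nonneg_left (le_trans ?_ h1) (by positivity)
          gcongr
  rw [mul_neg, Real.cosh_neg, neg_sq] at hle
  have hA : (Real.pi * (1 / 4 + τ ^ 2))⁻¹ ≤ Real.pi⁻¹ * (4 * (1 + τ ^ 2)⁻¹) := by
    rw [mul_inv]
    gcongr
    rw [← div_eq_mul_inv, le_div_iff₀ (by positivity), inv_mul_le_iff₀ (by positivity)]
    nlinarith [sq_nonneg τ]
  have hΓN := Real.Gamma_pos_of_pos (show 0 < (N : ℝ) + 3 / 2 by linarith)
  calc _ = Real.pi * (‖Complex.Gamma ((((N : ℝ) + 3 / 2 : ℝ) : ℂ) + ((-τ : ℝ) : ℂ) * Complex.I)‖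
        * ‖Complex.Gamma (((a + ((N : ℝ) + 1 / 2) / θ : ℝ) : ℂ) + ((-(τ / θ) : ℝ) : ℂ) * Complex.I)‖
        * Real.cosh (Real.pi * τ))⁻¹ * x ^ (-(-(N : ℝ) - 1 / 2)) * ‖H z‖ := by
        rw [div_eq_mul_inv, mul_inv, mul_inv, mul_inv]
        ring
    _ ≤ Real.pi * (K / Real.Gamma ((N : ℝ) + 3 / 2) * (Real.pi⁻¹ * (4 * (1 + τ ^ 2)⁻¹)))
        * x ^ (-(-(N : ℝ) - 1 / 2)) * M := by
        gcongr
        exact hle.trans (by gcongr)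
    _ = K * (x ^ (-(-(N : ℝ) - 1 / 2)) / Real.Gamma ((N : ℝ) + 3 / 2)) * (4 * M) * (1 + τ ^ 2)⁻¹ := by
        field_simp
    _ ≤ K * (Real.exp (2 * x) * (1 / 2) ^ N) * (4 * M) * (1 + τ ^ 2)⁻¹ := by gcongr
    _ = _ := by ring

theorem hasLineIntegral_unique {f : ℂ → ℂ} {c : ℝ} {L L' : ℂ} (h : HasLineIntegral f c L)
    (h' : HasLineIntegral f c L') : L = L' := tendsto_nhds_unique h.2 h'.2

/-- The residue sum of a Mellin-Barnes integral whose `x`-power and multiplier are `x^{-z} H(z)`. -/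
noncomputable def mellinBarnesResidue (a θ x : ℝ) (H : ℂ → ℂ) (k : ℕ) : ℂ :=
  (-x) ^ k / (k.factorial * Real.Gamma (a + 1 / θ * k)) * H (-(k : ℂ))

theorem gammaRegular_mul_mellinBarnesFactor (a θ x : ℝ) (H : ℂ → ℂ) (k : ℕ) :
    gammaRegular k (-(k : ℂ)) * mellinBarnesFactor a θ x H (-(k : ℂ)) = mellinBarnesResidue a θ x H k := by
  have e : (a : ℂ) - -(k : ℂ) / θ = ((a + 1 / θ * k : ℝ) : ℂ) := by push_cast; ring
  rw [gammaRegular_neg, mellinBarnesFactor, mellinBarnesResidue, e, Complex.Gamma_ofReal, neg_neg,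
    Complex.cpow_natCast, neg_pow (x : ℂ)]
  ring

section
variable {a θ x b c M r : ℝ} {H : ℂ → ℂ}

/-- The target abscissa must stay to the left of the next pole -k + 1; for k = 0 there is none, and
it may be any e ≤ c with e > 0. -/
theorem HasLineIntegral.shift_mellinBarnes (hθ : 1 ≤ θ) (hx : 0 < x) (hM0 : 0 ≤ M)
    (hcb : c < b) (hH : DifferentiableOn ℂ H {z | z.re < b}) (hM : ∀ z : ℂ, z.re ≤ c → ‖H z‖ ≤ M)
    (hMr : ∀ z : ℂ, z.re ≤ c → 1 ≤ |z.im| → ‖H z‖ ≤ M * |z.im| ^ (-r))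
    (hc : 1 < θ ∨ 2 * c - a * θ - r ≤ 0) {k : ℕ} {e : ℝ} (hke : -(k : ℝ) < e) (he : e ≤ c)
    (hk : k = 0 ∨ e < -(k : ℝ) + 1) {L : ℂ}
    (hL : HasLineIntegral (mellinBarnesIntegrand a θ x H) (-(k : ℝ) - 1 / 2) L) :
    HasLineIntegral (mellinBarnesIntegrand a θ x H) e
      (L + 2 * Real.pi * Complex.I * mellinBarnesResidue a θ x H k) := by
  rw [← gammaRegular_mul_mellinBarnesFactor]
  have hUopen : IsOpen {z : ℂ | (-(k : ℝ) - 1 < z.re ∧ (k = 0 ∨ z.re < -(k : ℝ) + 1)) ∧ z.re < b} := by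
    refine IsOpen.inter (IsOpen.inter ?_ ?_) ?_
    · exact isOpen_lt continuous_const Complex.continuous_re
    · exact (isOpen_const (p := k = 0)).union (isOpen_lt Complex.continuous_re continuous_const)
    · exact isOpen_lt Complex.continuous_re continuous_const
  have hsub : Complex.re ⁻¹' Icc (-(k : ℝ) - 1 / 2) e
      ⊆ {z : ℂ | (-(k : ℝ) - 1 < z.re ∧ (k = 0 ∨ z.re < -(k : ℝ) + 1)) ∧ z.re < b} := by
    intro z hz
    have h1 : -(k : ℝ) - 1 / 2 ≤ z.re := hz.1
    have h2 : z.re ≤ e := hz.2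
    refine ⟨⟨by linarith, ?_⟩, by linarith⟩
    rcases hk with h | h
    · exact Or.inl h
    · exact Or.inr (by linarith)
  refine HasLineIntegral.shift (F := fun z => gammaRegular k z * mellinBarnesFactor a θ x H z)
    (by simp) (by simpa using hke) hUopen hsub ?_ ?_ ?_ ?_ hL
  · exact ((differentiableOn_gammaRegular k).mono fun z hz => hz.1).mul
      ((differentiableOn_mellinBarnesFactor hx hH).mono fun z hz => hz.2)
  · intro z hz hne
    rw [mellinBarnesIntegrand_eq, Gamma_eq_gammaRegular_div_of_re (hsub hz).1 hne]
    ring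
  · simpa using tendsto_horizontal_mellinBarnesIntegrand (A := -(k : ℝ) - 1 / 2) hθ hx hM0 he (by linarith)
      hcb hH hM hMr hc 1 (by simp)
  · simpa using tendsto_horizontal_mellinBarnesIntegrand (A := -(k : ℝ) - 1 / 2) hθ hx hM0 he (by linarith)
      hcb hH hM hMr hc (-1) (by simp)

/-- A Mellin-Barnes integral is the sum of the residues to the left of the line. -/
theorem hasLineIntegral_mellinBarnesIntegrand (hθ : 1 ≤ θ) (hx : 0 < x) (hM0 : 0 ≤ M) (hc0 : 0 < c)
    (hcb : c < b) (hH : DifferentiableOn ℂ H {z | z.re < b}) (hM : ∀ z : ℂ, z.re ≤ c → ‖H z‖ ≤ M)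
    (hMr : ∀ z : ℂ, z.re ≤ c → 1 ≤ |z.im| → ‖H z‖ ≤ M * |z.im| ^ (-r))
    (hc : 1 < θ ∨ 2 * c - a * θ - r ≤ 0) {S : ℂ} (hS : HasSum (mellinBarnesResidue a θ x H) S) :
    HasLineIntegral (mellinBarnesIntegrand a θ x H) c (2 * Real.pi * Complex.I * S) := by
  set f := mellinBarnesIntegrand a θ x H with hf
  -- Start half way between two poles and cross one pole at a time; the last crossing, at 0, leads
  -- directly to the line `c`.
  have hshift : ∀ (N : ℕ) (L : ℂ), HasLineIntegral f (-(N : ℝ) - 1 / 2) L →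
      HasLineIntegral f c (L + 2 * Real.pi * Complex.I
        * ∑ k ∈ Finset.range (N + 1), mellinBarnesResidue a θ x H k) := by
    intro N
    induction N with
    | zero =>
      intro L hL
      simpa using HasLineIntegral.shift_mellinBarnes hθ hx hM0 hcb hH hM hMr hc (k := 0) (e := c)
        (by simpa using hc0) le_rfl (Or.inl rfl) hL
    | succ N ih =>
      intro L hL
      have hN : (0 : ℝ) ≤ N := N.cast_nonneg
      have h1 := HasLineIntegral.shift_mellinBarnes hθ hx hM0 hcb hH hM hMr hc (k := N + 1)
        (e := -(N : ℝ) - 1 / 2) (by push_cast; linarith) (by linarith)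
        (Or.inr (by push_cast; linarith)) hL
      have h2 := ih _ h1
      rw [Finset.sum_range_succ _ (N + 1)]
      convert h2 using 1
      ring
  obtain ⟨C, N₀, hC, hle⟩ := exists_norm_mellinBarnesIntegrand_left_le (a := a) hθ hx hc0 hM
  have hint : ∀ N ≥ N₀, LineIntegrable f (-(N : ℝ) - 1 / 2) := by
    intro N hN
    have hN0 : (0 : ℝ) ≤ N := N.cast_nonneg
    refine integrable_of_continuous_of_le (C := C * (1 / 2) ^ N) (R := 0)
      (continuous_mellinBarnesIntegrand_line hx hH (by linarith) fun m hm => ?_) fun τ _ => hle N hN τ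
    have h2 : ((2 * N + 1 : ℕ) : ℝ) = (2 * m : ℕ) := by push_cast; linarith
    have := Nat.cast_injective h2
    omega
  set I : ℕ → ℂ := fun N => Complex.I * ∫ τ : ℝ, f (((-(N : ℝ) - 1 / 2 : ℝ) : ℂ) + τ * Complex.I)
    with hI
  have hIle : ∀ N ≥ N₀, ‖I N‖ ≤ C * (1 / 2) ^ N * Real.pi := by
    intro N hN
    rw [hI]
    simp only [norm_mul, Complex.norm_I, one_mul]
    rw [← integral_univ_inv_one_add_sq, ← integral_const_mul]
    exact norm_integral_le_of_norm_le (integrable_inv_one_add_sq.const_mul _)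
      (Eventually.of_forall (hle N hN))
  have hI0 : Tendsto I atTop (𝓝 0) := by
    refine squeeze_zero_norm' (a := fun N : ℕ => C * (1 / 2) ^ N * Real.pi) ?_ ?_
    · filter_upwards [eventually_ge_atTop N₀] with N hN using hIle N hN
    · have := ((tendsto_pow_atTop_nhds_zero_of_lt_one (r := (1 / 2 : ℝ)) (by norm_num)
        (by norm_num)).const_mul C).mul_const Real.pi
      simpa using this
  have hmain : ∀ N ≥ N₀, HasLineIntegral f c (I N + 2 * Real.pi * Complex.I
      * ∑ k ∈ Finset.range (N + 1), mellinBarnesResidue a θ x H k) := fun N hN =>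
    hshift N _ (HasLineIntegral.of_integrable (hint N hN))
  have hlim : Tendsto (fun N : ℕ => I N + 2 * Real.pi * Complex.I
      * ∑ k ∈ Finset.range (N + 1), mellinBarnesResidue a θ x H k) atTop
      (𝓝 (2 * Real.pi * Complex.I * S)) := by
    have := hI0.add ((hS.tendsto_sum_nat.comp (tendsto_add_atTop_nat 1)).const_mul
      (2 * Real.pi * Complex.I))
    simpa using this
  -- The value on the line `c` does not depend on N, by uniqueness of limits, so it equals the limit
  -- as N → ∞.
  have hconst : Tendsto (fun N : ℕ => I N + 2 * Real.pi * Complex.I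
      * ∑ k ∈ Finset.range (N + 1), mellinBarnesResidue a θ x H k) atTop
      (𝓝 (I N₀ + 2 * Real.pi * Complex.I
      * ∑ k ∈ Finset.range (N₀ + 1), mellinBarnesResidue a θ x H k)) := by
    refine tendsto_const_nhds.congr' ?_
    filter_upwards [eventually_ge_atTop N₀] with N hN
    exact hasLineIntegral_unique (hmain N₀ le_rfl) (hmain N hN)
  rw [tendsto_nhds_unique hlim hconst]
  exact hmain N₀ le_rfl

end

/-! ### Wright's generalized Bessel function -/

/-- Since Γ ≥ 1/e on the positive axis, the exponential series is a majorant. -/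
theorem summable_wrightBesselTerm {a b : ℝ} (ha : 0 < a) (hb : 0 < b) (z : ℝ) :
    Summable (wrightBesselTerm a b z) := by
  refine Summable.of_norm_bounded ((Real.summable_pow_div_factorial |z|).mul_right (Real.exp 1))
    fun j => ?_
  have hpos : 0 < a + b * j := by positivity
  have h := exp_neg_one_le_Gamma hpos
  rw [Real.exp_neg] at h
  have hΓ := Real.Gamma_pos_of_pos hpos
  rw [wrightBesselTerm, norm_div, norm_pow, norm_neg, Real.norm_eq_abs, Real.norm_eq_abs,
    abs_of_pos (show 0 < (j.factorial : ℝ) * Real.Gamma (a + b * j) by positivity), ← div_div, div_le_iff₀ hΓ, mul_assoc]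
  refine le_mul_of_one_le_right (by positivity) ?_
  calc (1 : ℝ) = Real.exp 1 * (Real.exp 1)⁻¹ := (mul_inv_cancel₀ (Real.exp_pos 1).ne').symm
    _ ≤ _ := by gcongr

theorem continuous_wrightBessel {a b : ℝ} (ha : 0 < a) (hb : 0 < b) :
    Continuous (wrightBessel a b) := by
  refine continuous_iff_continuousAt.2 fun z => ?_
  have hc : ContinuousOn (wrightBessel a b) (Metric.ball 0 (|z| + 1)) := by
    refine continuousOn_tsum (u := fun j => ‖wrightBesselTerm a b (|z| + 1) j‖) (fun j => ?_)
      (summable_wrightBesselTerm ha hb _).norm fun j w hw => ?_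
    · unfold wrightBesselTerm
      fun_prop
    · rw [wrightBesselTerm, wrightBesselTerm, norm_div, norm_div, norm_pow, norm_pow, norm_neg, norm_neg]
      have : ‖w‖ ≤ ‖|z| + 1‖ := by
        rw [mem_ball_zero_iff] at hw
        exact hw.le.trans (le_abs_self _)
      gcongr
  exact hc.continuousAt (Metric.isOpen_ball.mem_nhds (by simp))

/-! ### Right loop integrals as sums of residues -/

theorem abs_sinh_im_le_norm_sin (w : ℂ) : |Real.sinh w.im| ≤ ‖Complex.sin w‖ := by
  rw [Complex.sin, norm_div, norm_mul, Complex.norm_I, mul_one, Complex.norm_ofNat]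
  have h1 : ‖Complex.exp (-w * Complex.I)‖ = Real.exp w.im := by
    rw [Complex.norm_exp]
    simp
  have h2 : ‖Complex.exp (w * Complex.I)‖ = Real.exp (-w.im) := by
    rw [Complex.norm_exp]
    simp
  have := abs_norm_sub_norm_le (Complex.exp (-w * Complex.I)) (Complex.exp (w * Complex.I))
  rw [h1, h2] at this
  rw [Real.sinh_eq, abs_div, abs_two]
  gcongr

theorem one_le_norm_sin_half (N : ℕ) (v : ℝ) :
    1 ≤ ‖Complex.sin (Real.pi * (((N + 1 / 2 : ℝ) : ℂ) + v * Complex.I))‖ := by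
  have e : (Real.pi : ℂ) * (((N + 1 / 2 : ℝ) : ℂ) + v * Complex.I)
      = (Real.pi * v : ℂ) * Complex.I + Real.pi / 2 + (N : ℂ) * Real.pi := by
    push_cast; ring
  rw [e, Complex.sin_antiperiodic.add_nat_mul_eq, Complex.sin_add_pi_div_two, Complex.cos_mul_I,
    norm_mul, norm_pow, norm_neg, norm_one, one_pow, one_mul, ← Complex.ofReal_mul,
    ← Complex.ofReal_cosh, Complex.norm_real, Real.norm_eq_abs, abs_of_pos (Real.cosh_pos _)]
  exact Real.one_le_cosh _

theorem rectIntegral_add_adjacent {a b c u v : ℝ} {f : ℂ → ℂ}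
    (hu : IntervalIntegrable (fun x : ℝ => f (x + u * Complex.I)) volume a b)
    (hu' : IntervalIntegrable (fun x : ℝ => f (x + u * Complex.I)) volume b c)
    (hv : IntervalIntegrable (fun x : ℝ => f (x + v * Complex.I)) volume a b)
    (hv' : IntervalIntegrable (fun x : ℝ => f (x + v * Complex.I)) volume b c) :
    rectIntegral a b u v f + rectIntegral b c u v f = rectIntegral a c u v f := by
  unfold rectIntegral
  rw [← intervalIntegral.integral_add_adjacent_intervals hu hu',
    ← intervalIntegral.integral_add_adjacent_intervals hv hv']
  ring

/-- The loop integrand `Γ(-t) / Γ(β + θt) · y^{θt} · g(t)`. -/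
noncomputable def loopIntegrand (β θ y : ℝ) (g : ℂ → ℂ) (t : ℂ) : ℂ :=
  Complex.Gamma (-t) / Complex.Gamma (β + θ * t) * (y : ℂ) ^ ((θ : ℂ) * t) * g t

/-- The holomorphic factor of the loop integrand. -/
noncomputable def loopFactor (β θ y : ℝ) (g : ℂ → ℂ) (t : ℂ) : ℂ :=
  (Complex.Gamma (β + θ * t))⁻¹ * (y : ℂ) ^ ((θ : ℂ) * t) * g t

theorem loopIntegrand_eq (β θ y : ℝ) (g : ℂ → ℂ) (t : ℂ) :
    loopIntegrand β θ y g t = Complex.Gamma (-t) * loopFactor β θ y g t := by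
  rw [loopIntegrand, loopFactor, div_eq_mul_inv]
  ring

theorem differentiableOn_loopFactor {β θ y e : ℝ} (hy : 0 < y) {g : ℂ → ℂ}
    (hg : DifferentiableOn ℂ g {t | e < t.re}) :
    DifferentiableOn ℂ (loopFactor β θ y g) {t | e < t.re} := by
  refine DifferentiableOn.mul (Differentiable.differentiableOn ?_) hg
  refine Differentiable.mul ?_ ?_
  · exact Complex.differentiable_one_div_Gamma.comp (f := fun t : ℂ => β + θ * t) (by fun_prop)
  · have : (y : ℂ) ≠ 0 := Complex.ofReal_ne_zero.2 hy.ne'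
    intro z
    exact DifferentiableAt.const_cpow (by fun_prop) (Or.inl this)

theorem differentiableAt_loopIntegrand {β θ y e : ℝ} (hy : 0 < y) {g : ℂ → ℂ}
    (hg : DifferentiableOn ℂ g {t | e < t.re}) {t : ℂ} (ht : e < t.re) (hpole : ∀ m : ℕ, t ≠ m) :
    DifferentiableAt ℂ (loopIntegrand β θ y g) t := by
  have h : loopIntegrand β θ y g = fun t => Complex.Gamma (-t) * loopFactor β θ y g t :=
    funext (loopIntegrand_eq β θ y g)
  rw [h]
  refine DifferentiableAt.mul ?_ ?_
  · refine DifferentiableAt.comp (g := Complex.Gamma) (f := fun t : ℂ => -t) t ?_ (by fun_prop)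
    exact Complex.differentiableAt_Gamma _ fun m hm => hpole m (neg_injective hm)
  · exact (differentiableOn_loopFactor hy hg).differentiableAt
      ((isOpen_lt continuous_const Complex.continuous_re).mem_nhds ht)

/-- Decay of the loop integrand to the right. -/
theorem exists_norm_loopIntegrand_mul_sin_le {β θ y h d M : ℝ} (hβ : 0 < β) (hθ : 1 ≤ θ) (hy : 0 < y)
    (hd : d < 0) {g : ℂ → ℂ} (hM : ∀ t : ℂ, d ≤ t.re → ‖g t‖ ≤ M) :
    ∃ C : ℝ, 0 ≤ C ∧ ∀ σ τ : ℝ, 1 ≤ σ → |τ| ≤ h →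
      ‖loopIntegrand β θ y g (σ + τ * Complex.I)‖
        * ‖Complex.sin (Real.pi * (σ + τ * Complex.I))‖ ≤ C * Real.exp (-σ) := by
  have hθ0 : 0 < θ := by linarith
  have hM0 : 0 ≤ M := (norm_nonneg _).trans (hM 0 (by simpa using hd.le))
  have hpi := Real.pi_pos
  have hgpos : ∀ s : ℝ, 0 < ‖Complex.Gamma (((1 : ℝ) : ℂ) + (s : ℝ) * Complex.I)‖ := fun s => by
    rw [norm_pos_iff]
    exact Complex.Gamma_ne_zero_of_re_pos (by simp)
  have hlow : ∀ s r τ : ℝ, 1 ≤ s → |τ| ≤ r →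
      ‖Complex.Gamma (((1 : ℝ) : ℂ) + (r : ℝ) * Complex.I)‖ * Real.Gamma s
        ≤ ‖Complex.Gamma (s + τ * Complex.I)‖ := by
    intro s r τ hs hr
    have h1 := norm_Gamma_mul_Gamma_le τ one_pos hs
    have h2 : ‖Complex.Gamma (((1 : ℝ) : ℂ) + (r : ℝ) * Complex.I)‖
        ≤ ‖Complex.Gamma (((1 : ℝ) : ℂ) + (τ : ℝ) * Complex.I)‖ :=
      norm_Gamma_anti one_pos (hr.trans (le_abs_self r))
    rw [Real.Gamma_one, one_mul] at h1
    have := (Real.Gamma_pos_of_pos (show 0 < s by linarith)).le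
    exact le_trans (by gcongr) h1
  set g₁ := ‖Complex.Gamma (((1 : ℝ) : ℂ) + (h : ℝ) * Complex.I)‖ with hg₁
  set g₂ := ‖Complex.Gamma (((1 : ℝ) : ℂ) + (θ * h : ℝ) * Complex.I)‖ with hg₂
  have hg₁0 : 0 < g₁ := hgpos h
  have hg₂0 : 0 < g₂ := hgpos _
  -- With the extra factor e in B, the lower bound for Γ(σ + 1) yields (y^θ)^σ / Γ(σ + 1) ≤ e^B
  -- e^{-σ}.
  set B := y ^ θ * Real.exp 1 with hB
  have hB0 : 0 < B := by positivity
  refine ⟨Real.pi * Real.exp B * Real.exp 1 * M / (g₁ * g₂), by positivity, fun σ τ hσ hτ => ?_⟩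
  set t : ℂ := σ + τ * Complex.I with ht
  have e1 : 1 + t = ((1 + σ : ℝ) : ℂ) + τ * Complex.I := by rw [ht]; push_cast; ring
  have e2 : (β : ℂ) + θ * t = ((β + θ * σ : ℝ) : ℂ) + ((θ * τ : ℝ) : ℂ) * Complex.I := by
    rw [ht]; push_cast; ring
  have b1 : g₁ * Real.Gamma (σ + 1) ≤ ‖Complex.Gamma (1 + t)‖ := by
    rw [e1, add_comm σ]
    exact hlow _ _ _ (by linarith) hτ
  have b2 : g₂ * Real.exp (-1) ≤ ‖Complex.Gamma (β + θ * t)‖ := by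
    rw [e2]
    have hs : 1 ≤ β + θ * σ := by nlinarith
    refine le_trans ?_ (hlow _ (θ * h) _ hs (by rw [abs_mul, abs_of_pos hθ0]; gcongr))
    gcongr
    exact exp_neg_one_le_Gamma (by linarith)
  have b3 : (y ^ θ) ^ σ * Real.exp σ ≤ Real.exp B * Real.Gamma (σ + 1) := by
    have := rpow_mul_exp_neg_le_Gamma hB0 (x := σ) (by linarith)
    rw [hB, Real.mul_rpow (by positivity) (Real.exp_pos 1).le, Real.exp_one_rpow, ← hB, Real.exp_neg,
      ← div_eq_mul_inv, div_le_iff₀ (Real.exp_pos _)] at this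
    linarith
  -- Keeping the sine as a factor avoids dividing by it near the poles. Only an inequality holds: at
  -- integers the left side is 0.
  have b4 : ‖Complex.Gamma (-t)‖ * ‖Complex.Gamma (1 + t)‖ * ‖Complex.sin (Real.pi * t)‖ ≤ Real.pi := by
    have h := Complex.Gamma_mul_Gamma_one_sub (-t)
    rw [sub_neg_eq_add, mul_neg, Complex.sin_neg] at h
    rw [← norm_mul, h, norm_div, norm_neg, Complex.norm_real, Real.norm_eq_abs, abs_of_pos hpi]
    rcases eq_or_ne ‖Complex.sin (Real.pi * t)‖ 0 with h0 | h0
    · rw [h0, mul_zero]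
      exact hpi.le
    · rw [div_mul_cancel₀ _ h0]
  have hΓ := Real.Gamma_pos_of_pos (show 0 < σ + 1 by linarith)
  have n1 : 0 < ‖Complex.Gamma (1 + t)‖ := lt_of_lt_of_le (by positivity) b1
  have n2 : 0 < ‖Complex.Gamma (β + θ * t)‖ := lt_of_lt_of_le (by positivity) b2
  have e3 : ‖(y : ℂ) ^ ((θ : ℂ) * t)‖ = (y ^ θ) ^ σ := by
    rw [Complex.norm_cpow_eq_rpow_re_of_pos hy, ← Real.rpow_mul hy.le, Complex.re_ofReal_mul, ht]
    simp
  have hgt : ‖g t‖ ≤ M := hM t (by rw [ht]; simp; linarith)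
  rw [loopIntegrand, norm_mul, norm_mul, norm_div, e3]
  have b5 : ‖Complex.Gamma (-t)‖ * ‖Complex.sin (Real.pi * t)‖ ≤ Real.pi / (g₁ * Real.Gamma (σ + 1)) := by
    rw [le_div_iff₀ (by positivity)]
    refine le_trans ?_ b4
    calc _ ≤ ‖Complex.Gamma (-t)‖ * ‖Complex.sin (Real.pi * t)‖ * ‖Complex.Gamma (1 + t)‖ := by gcongr
      _ = _ := by ring
  calc _ = (‖Complex.Gamma (-t)‖ * ‖Complex.sin (Real.pi * t)‖) * (y ^ θ) ^ σ
          / ‖Complex.Gamma (β + θ * t)‖ * ‖g t‖ := by ring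
    _ ≤ Real.pi / (g₁ * Real.Gamma (σ + 1)) * (Real.exp B * Real.Gamma (σ + 1) * Real.exp (-σ))
          / (g₂ * Real.exp (-1)) * M := by
        gcongr
        rw [Real.exp_neg, ← div_eq_mul_inv, le_div_iff₀ (Real.exp_pos _)]
        exact b3
    _ = _ := by
        rw [Real.exp_neg 1]
        field_simp

section
variable {β θ y h d e M : ℝ} {g : ℂ → ℂ}

/-- Off the real axis |sin πt| ≥ |sinh πv| > 0 along the whole ray, so the bound for the product
with the sine leaves an e^{-x} majorant beyond 1; the part before 1 is compact. -/
theorem integrableOn_loopIntegrand_ray (hβ : 0 < β) (hθ : 1 ≤ θ) (hy : 0 < y)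
    (hd : d < 0) (hed : e < d) (hg : DifferentiableOn ℂ g {t | e < t.re})
    (hM : ∀ t : ℂ, d ≤ t.re → ‖g t‖ ≤ M) {v : ℝ} (hv : v ≠ 0) :
    IntegrableOn (fun x : ℝ => loopIntegrand β θ y g (x + v * Complex.I)) (Ioi d) := by
  have hcont : ContinuousOn (fun x : ℝ => loopIntegrand β θ y g (x + v * Complex.I)) (Ioi e) := by
    intro x hx
    refine ContinuousAt.continuousWithinAt ?_
    refine ContinuousAt.comp (f := fun x : ℝ => (x : ℂ) + v * Complex.I)
      (differentiableAt_loopIntegrand hy hg ?_ fun m hm => hv ?_).continuousAt (by fun_prop)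
    · simpa using hx
    · simpa using congrArg Complex.im hm
  obtain ⟨C, hC, hle⟩ := exists_norm_loopIntegrand_mul_sin_le hβ hθ hy (h := |v|) hd hM
  rw [← Ioc_union_Ioi_eq_Ioi (show d ≤ 1 by linarith)]
  refine IntegrableOn.union ?_ ?_
  · refine ((hcont.mono fun x hx => ?_).integrableOn_compact isCompact_Icc).mono_set Ioc_subset_Icc_self
    exact lt_of_lt_of_le hed hx.1
  · have hs : 0 < |Real.sinh (Real.pi * v)| := by
      rw [abs_pos, Real.sinh_ne_zero]
      exact mul_ne_zero Real.pi_ne_zero hv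
    refine Integrable.mono' ((integrableOn_exp_neg_Ioi 1).const_mul (C / |Real.sinh (Real.pi * v)|))
      ((hcont.mono fun x hx => ?_).aestronglyMeasurable measurableSet_Ioi) ?_
    · have : (1 : ℝ) < x := hx
      simp only [mem_Ioi]
      linarith
    · filter_upwards [ae_restrict_mem measurableSet_Ioi] with x hx
      have h1 := hle x v (le_of_lt hx) le_rfl
      have h2 := abs_sinh_im_le_norm_sin (Real.pi * (x + v * Complex.I))
      rw [Complex.im_ofReal_mul] at h2
      simp only [Complex.add_im, Complex.ofReal_im, Complex.mul_im, Complex.ofReal_re, Complex.I_im,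
        mul_one, Complex.I_re, mul_zero, add_zero, zero_add] at h2
      rw [div_mul_eq_mul_div, le_div_iff₀ hs]
      exact le_trans (by gcongr) h1

theorem rightLoopIntegrable_loopIntegrand (hβ : 0 < β) (hθ : 1 ≤ θ) (hy : 0 < y)
    (hd : d < 0) (hh : 0 < h) (hed : e < d) (hg : DifferentiableOn ℂ g {t | e < t.re})
    (hM : ∀ t : ℂ, d ≤ t.re → ‖g t‖ ≤ M) :
    RightLoopIntegrable d h (loopIntegrand β θ y g) := by
  refine ⟨?_, integrableOn_loopIntegrand_ray hβ hθ hy hd hed hg hM hh.ne', ?_⟩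
  · simpa [sub_eq_add_neg] using
      integrableOn_loopIntegrand_ray hβ hθ hy hd hed hg hM (neg_ne_zero.2 hh.ne')
  · refine Continuous.intervalIntegrable (continuous_iff_continuousAt.2 fun v => ?_) _ _
    refine ContinuousAt.comp (f := fun v : ℝ => (d : ℂ) + v * Complex.I)
      (differentiableAt_loopIntegrand hy hg ?_ fun m hm => ?_).continuousAt (by fun_prop)
    · simpa using hed
    · have : d = m := by simpa using congrArg Complex.re hm
      have hm : (0 : ℝ) ≤ m := m.cast_nonneg
      linarith

/-- The terms of the residue sum of the loop integral. -/
noncomputable def loopResidue (β θ y : ℝ) (g : ℂ → ℂ) (j : ℕ) : ℂ :=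
  (-(y ^ θ : ℝ)) ^ j / (j.factorial * Real.Gamma (β + θ * j)) * g j

theorem gammaRegular_mul_loopFactor (hy : 0 < y) (j : ℕ) :
    gammaRegular j (-(j : ℂ)) * loopFactor β θ y g j = loopResidue β θ y g j := by
  have e : (β : ℂ) + θ * j = ((β + θ * j : ℝ) : ℂ) := by push_cast; ring
  rw [gammaRegular_neg, loopFactor, loopResidue, e, Complex.Gamma_ofReal, Complex.cpow_mul_nat,
    ← Complex.ofReal_cpow hy.le, neg_pow ((y ^ θ : ℝ) : ℂ)]
  ring

/-- The minus sign comes from -t - (-j) = -(t - j). The condition j - 1 < u keeps the previous pole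
outside; for j = 0 there is no previous pole. -/
theorem rectIntegral_loopIntegrand_single (hy : 0 < y) (hh : 0 < h)
    (hg : DifferentiableOn ℂ g {t | e < t.re}) {j : ℕ} {u : ℝ} (hu : u < j) (heu : e < u)
    (hj : j = 0 ∨ (j : ℝ) - 1 < u) :
    rectIntegral u (j + 1 / 2) (-h) h (loopIntegrand β θ y g)
      = -(2 * Real.pi * Complex.I * loopResidue β θ y g j) := by
  rw [← gammaRegular_mul_loopFactor hy]
  have hUopen : IsOpen {t : ℂ | (-(j : ℝ) - 1 < (-t).re ∧ (j = 0 ∨ (-t).re < -(j : ℝ) + 1)) ∧ e < t.re} := by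
    refine IsOpen.inter (IsOpen.inter ?_ ?_) ?_
    · exact isOpen_lt continuous_const (Complex.continuous_re.comp continuous_neg)
    · exact (isOpen_const (p := j = 0)).union
        (isOpen_lt (Complex.continuous_re.comp continuous_neg) continuous_const)
    · exact isOpen_lt continuous_const Complex.continuous_re
  have hsub : Icc u ((j : ℝ) + 1 / 2) ×ℂ Icc (-h) h
      ⊆ {t : ℂ | (-(j : ℝ) - 1 < (-t).re ∧ (j = 0 ∨ (-t).re < -(j : ℝ) + 1)) ∧ e < t.re} := by
    intro t ht
    have h1 : u ≤ t.re := ht.1.1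
    have h2 : t.re ≤ j + 1 / 2 := ht.1.2
    refine ⟨⟨by simp only [Complex.neg_re]; linarith, ?_⟩, by linarith⟩
    rcases hj with h | h
    · exact Or.inl h
    · refine Or.inr ?_
      simp only [Complex.neg_re]
      linarith
  rw [rectIntegral_div_sub (w := (j : ℂ)) (F := fun t => -(gammaRegular j (-t) * loopFactor β θ y g t))
    (by simpa using hu) (by simp) (by simpa using hh) (by simpa using hh) hUopen hsub]
  · ring
  · refine DifferentiableOn.neg (DifferentiableOn.mul ?_
      ((differentiableOn_loopFactor hy hg).mono fun t ht => ht.2))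
    exact (differentiableOn_gammaRegular j).comp (f := fun t : ℂ => -t) (by fun_prop)
      fun t ht => ht.1
  · intro t ht hne
    rw [loopIntegrand_eq, Gamma_eq_gammaRegular_div_of_re (hsub ht).1 fun h => hne (neg_injective h)]
    rw [show -t - -(j : ℂ) = -(t - j) by ring, div_neg, neg_div, neg_mul, div_mul_eq_mul_div]

/-- The loop integral is the (negative) sum of the residues it encircles. -/
theorem rightLoopIntegral_loopIntegrand (hβ : 0 < β) (hθ : 1 ≤ θ) (hy : 0 < y)
    (hd : d < 0) (hh : 0 < h) (hed : e < d) (hg : DifferentiableOn ℂ g {t | e < t.re})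
    (hM : ∀ t : ℂ, d ≤ t.re → ‖g t‖ ≤ M) {S : ℂ} (hS : HasSum (loopResidue β θ y g) S) :
    rightLoopIntegral d h (loopIntegrand β θ y g) = -(2 * Real.pi * Complex.I * S) := by
  set f := loopIntegrand β θ y g with hf
  have hray : ∀ v : ℝ, v ≠ 0 → IntegrableOn (fun x : ℝ => f (x + v * Complex.I)) (Ioi d) :=
    fun v hv => integrableOn_loopIntegrand_ray hβ hθ hy hd hed hg hM hv
  have hii : ∀ v : ℝ, v ≠ 0 → ∀ a b : ℝ, d ≤ a → a ≤ b →
      IntervalIntegrable (fun x : ℝ => f (x + v * Complex.I)) volume a b := by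
    intro v hv a b ha hab
    rw [intervalIntegrable_iff_integrableOn_Ioc_of_le hab]
    exact (hray v hv).mono_set fun x hx => lt_of_le_of_lt ha hx.1
  have hrect : ∀ N : ℕ, rectIntegral d (N + 1 / 2) (-h) h f
      = -(2 * Real.pi * Complex.I * ∑ j ∈ Finset.range (N + 1), loopResidue β θ y g j) := by
    -- Adjacent rectangles, cut at the half-integers, each contain one pole; their common edges
    -- cancel.
    intro N
    induction N with
    | zero =>
      have := rectIntegral_loopIntegrand_single (β := β) (θ := θ) (g := g) hy hh hg (j := 0) (u := d)
        (by simpa using hd) hed (Or.inl rfl)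
      simpa using this
    | succ N ih =>
      have hN : (0 : ℝ) ≤ N := N.cast_nonneg
      have h1 := rectIntegral_loopIntegrand_single (β := β) (θ := θ) (g := g) hy hh hg (j := N + 1)
        (u := N + 1 / 2) (by push_cast; linarith) (by linarith) (Or.inr (by push_cast; linarith))
      rw [Finset.sum_range_succ, mul_add, neg_add, ← ih, ← h1]
      have hh' : (-h) ≠ 0 := neg_ne_zero.2 hh.ne'
      refine (rectIntegral_add_adjacent ?_ ?_ ?_ ?_).symm
      · exact hii _ hh' _ _ le_rfl (by linarith)
      · exact hii _ hh' _ _ (by linarith) (by push_cast; linarith)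
      · exact hii _ hh.ne' _ _ le_rfl (by linarith)
      · exact hii _ hh.ne' _ _ (by linarith) (by push_cast; linarith)
  have hend : Tendsto (fun N : ℕ => (N : ℝ) + 1 / 2) atTop atTop :=
    tendsto_atTop_add_const_right _ _ tendsto_natCast_atTop_atTop
  -- On the closing edge Re t = N + 1/2 the sine has modulus at least 1, so the bound e^{-σ} applies
  -- without loss.
  have hright : Tendsto (fun N : ℕ => ∫ v in (-h)..h, f (((N + 1 / 2 : ℝ) : ℂ) + v * Complex.I))
      atTop (𝓝 0) := by
    obtain ⟨C, hC, hle⟩ := exists_norm_loopIntegrand_mul_sin_le hβ hθ hy (h := h) hd hM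
    refine squeeze_zero_norm' (a := fun N : ℕ => C * Real.exp (-((N : ℝ) + 1 / 2)) * |h - -h|) ?_ ?_
    · filter_upwards [eventually_ge_atTop 1] with N hN
      have hN' : (1 : ℝ) ≤ N := by exact_mod_cast hN
      refine intervalIntegral.norm_integral_le_of_norm_le_const fun v hv => ?_
      rw [uIoc_of_le (by linarith)] at hv
      have h1 := hle (N + 1 / 2) v (by linarith) (abs_le.2 ⟨hv.1.le, hv.2⟩)
      exact (le_mul_of_one_le_right (norm_nonneg _) (one_le_norm_sin_half N v)).trans h1
    · have := (Real.tendsto_exp_neg_atTop_nhds_zero.comp hend).const_mul C |>.mul_const |h - -h|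
      simpa using this
  have hlim1 : Tendsto (fun N : ℕ => rectIntegral d (N + 1 / 2) (-h) h f) atTop
      (𝓝 (rightLoopIntegral d h f)) := by
    have t1 := intervalIntegral_tendsto_integral_Ioi d (hray (-h) (neg_ne_zero.2 hh.ne')) hend
    have t2 := intervalIntegral_tendsto_integral_Ioi d (hray h hh.ne') hend
    have := ((t1.sub t2).add (hright.const_mul Complex.I)).sub_const
      (Complex.I * ∫ v in (-h)..h, f (d + v * Complex.I))
    refine (this.congr fun N => ?_).trans (le_of_eq ?_)
    · simp [rectIntegral]
    · simp [rightLoopIntegral, sub_eq_add_neg]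
  have hlim2 : Tendsto (fun N : ℕ => rectIntegral d (N + 1 / 2) (-h) h f) atTop
      (𝓝 (-(2 * Real.pi * Complex.I * S))) := by
    simp only [hrect]
    exact ((hS.tendsto_sum_nat.comp (tendsto_add_atTop_nat 1)).const_mul _).neg
  exact tendsto_nhds_unique hlim1 hlim2

end

/-! ### Affine changes of variable -/

theorem HasLineIntegral.comp_affine {g : ℂ → ℂ} {β θ c : ℝ} (hθ : 0 < θ) {L : ℂ}
    (hg : HasLineIntegral g (β + θ * c) L) :
    HasLineIntegral (fun s => θ * g (β + θ * s)) c L := by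
  have e : ∀ τ : ℝ, (β : ℂ) + θ * (c + τ * Complex.I)
      = ((β + θ * c : ℝ) : ℂ) + ((θ * τ : ℝ) : ℂ) * Complex.I := fun τ => by push_cast; ring
  have hint : ∀ a b : ℝ, IntervalIntegrable (fun τ : ℝ => g (((β + θ * c : ℝ) : ℂ) + τ * Complex.I))
      volume a b := fun a b =>
    ((hg.1.integrableOn_isCompact isCompact_uIcc).intervalIntegrable)
  refine ⟨?_, ?_⟩
  · simp only [e]
    rw [locallyIntegrable_iff]
    intro k hk
    obtain ⟨R, hR⟩ := hk.isBounded.subset_closedBall 0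
    have h1 := ((hint (θ * -R) (θ * R)).comp_mul_left (c := θ)).const_mul (θ : ℂ)
    rw [mul_div_cancel_left₀ _ hθ.ne', mul_div_cancel_left₀ _ hθ.ne'] at h1
    refine ((intervalIntegrable_iff' enorm_ne_top).1 h1).mono_set (hR.trans ?_)
    rw [Real.closedBall_eq_Icc, zero_sub, zero_add]
    exact Icc_subset_uIcc
  · have hmap : Tendsto (fun T : ℝ × ℝ => (θ * T.1, θ * T.2)) atTop atTop := by
      rw [← prod_atTop_atTop_eq]
      exact (tendsto_id.const_mul_atTop hθ).prodMap (tendsto_id.const_mul_atTop hθ)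
    refine (hg.2.comp hmap).congr fun T => ?_
    simp only [Function.comp, e]
    rw [intervalIntegral.integral_const_mul, intervalIntegral.integral_comp_mul_left
      (fun τ : ℝ => g (((β + θ * c : ℝ) : ℂ) + τ * Complex.I)) hθ.ne', Complex.real_smul, mul_neg]
    have : (θ : ℂ) ≠ 0 := Complex.ofReal_ne_zero.2 hθ.ne'
    push_cast
    field_simp

theorem LineIntegrable.comp_affine {g : ℂ → ℂ} {β θ c : ℝ} (hθ : 0 < θ)
    (hg : LineIntegrable g (β + θ * c)) : LineIntegrable (fun s => g (β + θ * s)) c := by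
  have e : ∀ τ : ℝ, (β : ℂ) + θ * (c + τ * Complex.I)
      = ((β + θ * c : ℝ) : ℂ) + ((θ * τ : ℝ) : ℂ) * Complex.I := fun τ => by push_cast; ring
  unfold LineIntegrable
  simp only [e]
  exact Integrable.comp_mul_left' hg hθ.ne'

theorem integral_Iio_comp_neg_mul {φ : ℝ → ℂ} {θ : ℝ} (hθ : 0 < θ) (d : ℝ) :
    ∫ u in Iio d, φ (θ⁻¹ * -u) = θ * ∫ u in Ioi (θ⁻¹ * -d), φ u := by
  rw [← integral_Iic_eq_integral_Iio, integral_comp_neg_Iic d (fun w => φ (θ⁻¹ * w)),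
    integral_comp_mul_left_Ioi φ (-d) (inv_pos.2 hθ), inv_inv, Complex.real_smul]

theorem integrableOn_Iio_comp_neg_mul {φ : ℝ → ℂ} {θ : ℝ} (hθ : 0 < θ) {d : ℝ}
    (h : IntegrableOn φ (Ioi (θ⁻¹ * -d))) : IntegrableOn (fun u => φ (θ⁻¹ * -u)) (Iio d) := by
  have h1 := ((integrableOn_Ioi_comp_mul_left_iff φ (-d) (inv_pos.2 hθ)).2 h).comp_neg
  simpa using h1

section
variable {f g : ℂ → ℂ} {θ d h : ℝ}

theorem left_ray_eq (hθ : 0 < θ) (hfg : ∀ t, f t = g (-t / θ)) (u v : ℝ) :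
    f (u + v * Complex.I) = (fun w : ℝ => g (w - ((v / θ : ℝ) : ℂ) * Complex.I)) (θ⁻¹ * -u) := by
  have : (θ : ℂ) ≠ 0 := Complex.ofReal_ne_zero.2 hθ.ne'
  rw [hfg]
  simp only
  congr 1
  push_cast
  field_simp
  ring

theorem left_edge_eq (hθ : 0 < θ) (hfg : ∀ t, f t = g (-t / θ)) (v : ℝ) :
    f (d + v * Complex.I)
      = (fun w : ℝ => g (((θ⁻¹ * -d : ℝ) : ℂ) + w * Complex.I)) (-θ⁻¹ * v) := by
  have : (θ : ℂ) ≠ 0 := Complex.ofReal_ne_zero.2 hθ.ne'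
  rw [hfg]
  simp only
  congr 1
  push_cast
  field_simp
  ring

/-- The map t ↦ w = -t/θ sends the lower ray of the left loop to the upper ray of the right loop, so
the directions of travel agree, and dt = -θ dw gives the factor. -/
theorem leftLoopIntegral_eq_rightLoopIntegral (hθ : 0 < θ) (hfg : ∀ t, f t = g (-t / θ)) :
    leftLoopIntegral d h f = -θ * rightLoopIntegral (θ⁻¹ * -d) (h / θ) g := by
  unfold leftLoopIntegral rightLoopIntegral
  have e1 : ∫ x in Iio d, f (x + h * Complex.I)
      = θ * ∫ x in Ioi (θ⁻¹ * -d), g (x - ((h / θ : ℝ) : ℂ) * Complex.I) := by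
    simp only [left_ray_eq hθ hfg]
    rw [integral_Iio_comp_neg_mul (φ := fun w : ℝ => g (w - ((h / θ : ℝ) : ℂ) * Complex.I)) hθ]
  have e2 : ∫ x in Iio d, f (x - h * Complex.I)
      = θ * ∫ x in Ioi (θ⁻¹ * -d), g (x + ((h / θ : ℝ) : ℂ) * Complex.I) := by
    have : ∀ x : ℝ, f (x - h * Complex.I) = f (x + ((-h : ℝ) : ℂ) * Complex.I) := fun x => by
      push_cast; ring_nf
    simp only [this, left_ray_eq hθ hfg]
    rw [integral_Iio_comp_neg_mul (φ := fun w : ℝ => g (w - ((-h / θ : ℝ) : ℂ) * Complex.I)) hθ]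
    congr 2
    funext x
    congr 1
    push_cast
    ring
  have e3 : ∫ v in (-h)..h, f (d + v * Complex.I)
      = θ * ∫ v in (-(h / θ))..(h / θ), g (((θ⁻¹ * -d : ℝ) : ℂ) + v * Complex.I) := by
    simp only [left_edge_eq hθ hfg]
    rw [intervalIntegral.integral_comp_mul_left
      (fun w : ℝ => g (((θ⁻¹ * -d : ℝ) : ℂ) + w * Complex.I)) (neg_ne_zero.2 (inv_ne_zero hθ.ne')),
      intervalIntegral.integral_symm, Complex.real_smul]
    rw [show -θ⁻¹ * h = -(h / θ) by ring, show -θ⁻¹ * -h = h / θ by ring, inv_neg, inv_inv]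
    push_cast
    ring
  rw [e1, e2, e3]
  ring

theorem leftLoopIntegrable_of_rightLoopIntegrable (hθ : 0 < θ) (hfg : ∀ t, f t = g (-t / θ))
    (hg : RightLoopIntegrable (θ⁻¹ * -d) (h / θ) g) : LeftLoopIntegrable d h f := by
  refine ⟨?_, ?_, ?_⟩
  · have : ∀ x : ℝ, f (x - h * Complex.I) = f (x + ((-h : ℝ) : ℂ) * Complex.I) := fun x => by
      push_cast; ring_nf
    simp only [this, left_ray_eq hθ hfg]
    refine integrableOn_Iio_comp_neg_mul (φ := fun w : ℝ => g (w - ((-h / θ : ℝ) : ℂ) * Complex.I)) hθ ?_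
    refine hg.2.1.congr_fun (fun x _ => ?_) measurableSet_Ioi
    simp only
    congr 1
    push_cast
    ring
  · simp only [left_ray_eq hθ hfg]
    exact integrableOn_Iio_comp_neg_mul (φ := fun w : ℝ => g (w - ((h / θ : ℝ) : ℂ) * Complex.I)) hθ hg.1
  · simp only [left_edge_eq hθ hfg]
    have h1 := hg.2.2.comp_mul_left (c := -θ⁻¹)
    rw [show -(h / θ) / -θ⁻¹ = h by field_simp, show h / θ / -θ⁻¹ = -h by field_simp] at h1
    exact h1.symm

end

/-! ### The functions p and q -/

section
variable {α θ : ℝ}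

theorem mellinBarnesResidue_one (a x : ℝ) (k : ℕ) :
    mellinBarnesResidue a θ x 1 k = (wrightBesselTerm a (1 / θ) x k : ℝ) := by
  rw [mellinBarnesResidue, wrightBesselTerm]
  push_cast
  simp

theorem mellinBarnesP_eq (hθ : 0 < θ) {x : ℝ} (hx : 0 < x) (s : ℂ) :
    mellinBarnesP α θ x s
      = (x : ℂ) ^ (α : ℂ) * mellinBarnesIntegrand ((α + 1) / θ) θ x 1 (α + s) := by
  have hθ' : (θ : ℂ) ≠ 0 := Complex.ofReal_ne_zero.2 hθ.ne'
  have hx' : (x : ℂ) ≠ 0 := Complex.ofReal_ne_zero.2 hx.ne'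
  have e : (((α + 1) / θ : ℝ) : ℂ) - (α + s) / θ = (1 - s) / θ := by
    push_cast
    field_simp
    ring
  rw [mellinBarnesP, mellinBarnesIntegrand, e, Pi.one_apply, mul_one, mul_left_comm, ← Complex.cpow_add _ _ hx']
  congr 2
  ring

/-- The shift z = α + s brings the integrand to the general form with multiplier 1. This multiplier
has no decay (r = 0), and for θ = 1 the convergence condition becomes κ ≤ (1 - α)/2. -/
theorem lineIntegral_mellinBarnesP (hα : -1 < α) (hθ : 1 ≤ θ) {x κ : ℝ} (hx : 0 < x)
    (hκ : IsPAbscissa α θ κ) :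
    (1 < θ → LineIntegrable (mellinBarnesP α θ x) κ) ∧
    HasLineIntegral (fun s => 1 / (2 * Real.pi * Complex.I) * mellinBarnesP α θ x s) κ
      ((x ^ α * wrightBessel ((α + 1) / θ) (1 / θ) x : ℝ) : ℂ) := by
  have hθ0 : 0 < θ := by linarith
  have hc0 : 0 < α + 1 * κ := by linarith [hκ.1]
  have ha : 0 < (α + 1) / θ := div_pos (by linarith) hθ0
  have hone : ∀ z : ℂ, ‖(1 : ℂ → ℂ) z‖ ≤ 1 := fun z => by simp
  have hdiff : DifferentiableOn ℂ (1 : ℂ → ℂ) {z | z.re < α + 1 * κ + 1} :=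
    differentiableOn_const (c := (1 : ℂ))
  have hf : ∀ s, mellinBarnesP α θ x s
      = (x : ℂ) ^ (α : ℂ) * mellinBarnesIntegrand ((α + 1) / θ) θ x 1 (α + ((1 : ℝ) : ℂ) * s) := fun s => by
    rw [mellinBarnesP_eq hθ0 hx, Complex.ofReal_one, one_mul]
  constructor
  · intro h1
    have := LineIntegrable.comp_affine one_pos (lineIntegrable_mellinBarnesIntegrand
      (a := (α + 1) / θ) h1 hx zero_le_one hc0 (lt_add_one _) hdiff fun z _ => hone z)
    unfold LineIntegrable
    simp only [hf]
    exact Integrable.const_mul this _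
  · have hS : HasSum (mellinBarnesResidue ((α + 1) / θ) θ x 1)
        ((wrightBessel ((α + 1) / θ) (1 / θ) x : ℝ) : ℂ) := by
      rw [funext (mellinBarnesResidue_one (θ := θ) ((α + 1) / θ) x)]
      exact Complex.hasSum_ofReal.2 (summable_wrightBesselTerm ha (one_div_pos.2 hθ0) x).hasSum
    have hcond : 1 < θ ∨ 2 * (α + 1 * κ) - (α + 1) / θ * θ - 0 ≤ 0 := by
      refine hκ.2.imp id fun h => ?_
      rw [div_mul_cancel₀ _ hθ0.ne']
      linarith
    have := (HasLineIntegral.comp_affine one_pos (hasLineIntegral_mellinBarnesIntegrand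
      (a := (α + 1) / θ) (r := 0) hθ hx zero_le_one hc0 (lt_add_one _) hdiff (fun z _ => hone z)
      (fun z _ _ => by simp) hcond hS)).const_mul (1 / (2 * Real.pi * Complex.I) * (x : ℂ) ^ (α : ℂ))
    convert this using 1
    · funext s
      rw [hf, Complex.ofReal_one]
      ring
    · have hpi : (Real.pi : ℂ) ≠ 0 := Complex.ofReal_ne_zero.2 Real.pi_ne_zero
      push_cast
      rw [Complex.ofReal_cpow hx.le]
      field_simp

theorem mellinBarnesQ_eq (hθ : 0 < θ) (x : ℝ) (t : ℂ) :
    mellinBarnesQ α θ x t = loopIntegrand (α + 1) θ x 1 (-t / θ) := by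
  have hθ' : (θ : ℂ) ≠ 0 := Complex.ofReal_ne_zero.2 hθ.ne'
  have e1 : -(-t / (θ : ℂ)) = t / θ := by ring
  have e2 : (θ : ℂ) * (-t / θ) = -t := by field_simp
  rw [mellinBarnesQ, loopIntegrand, e1, e2, Pi.one_apply, mul_one]
  push_cast
  ring_nf

theorem loopResidue_eq (β y : ℝ) (g : ℂ → ℂ) (j : ℕ) :
    loopResidue β θ y g j = (wrightBesselTerm β θ (y ^ θ) j : ℝ) * g j := by
  rw [loopResidue, wrightBesselTerm]
  push_cast
  rfl

/-- After t ↦ -t/θ the residue terms are the Wright terms themselves; the two minus signs, from the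
substitution and from the residues, cancel. -/
theorem leftLoopIntegral_mellinBarnesQ (hα : -1 < α) (hθ : 1 ≤ θ) {x d h : ℝ} (hx : 0 < x)
    (hd : 0 < d) (hh : 0 < h) :
    LeftLoopIntegrable d h (mellinBarnesQ α θ x) ∧
    ((θ * wrightBessel (α + 1) θ (x ^ θ) : ℝ) : ℂ)
      = 1 / (2 * Real.pi * Complex.I) * leftLoopIntegral d h (mellinBarnesQ α θ x) := by
  have hθ0 : 0 < θ := by linarith
  have hβ : 0 < α + 1 := by linarith
  have hd' : θ⁻¹ * -d < 0 := mul_neg_of_pos_of_neg (inv_pos.2 hθ0) (neg_lt_zero.2 hd)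
  have hh' : 0 < h / θ := div_pos hh hθ0
  have hdiff : DifferentiableOn ℂ (1 : ℂ → ℂ) {t | θ⁻¹ * -d - 1 < t.re} :=
    differentiableOn_const (c := (1 : ℂ))
  have hone : ∀ t : ℂ, θ⁻¹ * -d ≤ t.re → ‖(1 : ℂ → ℂ) t‖ ≤ 1 := fun t _ => by simp
  have hS : HasSum (loopResidue (α + 1) θ x 1) ((wrightBessel (α + 1) θ (x ^ θ) : ℝ) : ℂ) := by
    rw [funext (loopResidue_eq (α + 1) x 1)]
    simp only [Pi.one_apply, mul_one]
    exact Complex.hasSum_ofReal.2 (summable_wrightBesselTerm hβ hθ0 _).hasSum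
  refine ⟨leftLoopIntegrable_of_rightLoopIntegrable hθ0 (mellinBarnesQ_eq hθ0 x)
    (rightLoopIntegrable_loopIntegrand hβ hθ hx hd' hh' (sub_one_lt _) hdiff hone), ?_⟩
  rw [leftLoopIntegral_eq_rightLoopIntegral hθ0 (mellinBarnesQ_eq hθ0 x),
    rightLoopIntegral_loopIntegrand hβ hθ hx hd' hh' (sub_one_lt _) hdiff hone hS]
  have hpi : (Real.pi : ℂ) ≠ 0 := Complex.ofReal_ne_zero.2 Real.pi_ne_zero
  push_cast
  field_simp

end

/-! ### The double series and its integral over [0, 1] -/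

/-- The terms of the double series of the hard edge kernel. -/
noncomputable def kernelTerm (α θ x y : ℝ) (i : ℕ × ℕ) : ℝ :=
  wrightBesselTerm ((α + 1) / θ) (1 / θ) x i.1 * wrightBesselTerm (α + 1) θ (y ^ θ) i.2
    / (α + 1 + i.1 + θ * i.2)

/-- The hard edge kernel. -/
noncomputable def hardEdgeKernel (α θ x y : ℝ) : ℝ :=
  θ * x ^ α * ∑' i : ℕ × ℕ, kernelTerm α θ x y i

/-- The factor of the `s`-integrand coming from the loop integral, as a function of `z = α + 1 + θs`. -/
noncomputable def stieltjesSum (α θ y : ℝ) (z : ℂ) : ℂ :=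
  ∑' j : ℕ, (wrightBesselTerm (α + 1) θ (y ^ θ) j : ℂ) / ((z - (α + 1)) / θ - j)

section
variable {α θ x y : ℝ}

theorem wrightBesselTerm_mul (a b z u : ℝ) (k : ℕ) :
    wrightBesselTerm a b (u * z) k = u ^ k * wrightBesselTerm a b z k := by
  rw [wrightBesselTerm, wrightBesselTerm, neg_mul_eq_mul_neg, mul_pow]
  ring

theorem summable_kernelTerm (hα : -1 < α) (hθ : 0 < θ) (x y : ℝ) : Summable (kernelTerm α θ x y) := by
  have ha : 0 < (α + 1) / θ := div_pos (by linarith) hθ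
  have hα' : 0 < α + 1 := by linarith
  refine Summable.of_norm_bounded
    (((summable_wrightBesselTerm ha (one_div_pos.2 hθ) x).norm.mul_norm
      (summable_wrightBesselTerm hα' hθ (y ^ θ)).norm).mul_right (α + 1)⁻¹) fun i => ?_
  rw [kernelTerm, norm_div, norm_mul, div_eq_mul_inv]
  gcongr
  rw [Real.norm_of_nonneg (by positivity)]
  have : 0 ≤ θ * (i.2 : ℝ) := by positivity
  have : (0 : ℝ) ≤ i.1 := by positivity
  linarith

/-- Each term integrates by ∫₀¹ u^{α+k+θj} du = 1/(α+1+k+θj). Sum and integral commute because the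
integral of the norm of a term is the norm of its integral, and these norms are summable. -/
theorem hasSum_integral_kernelTerm (hα : -1 < α) (hθ : 0 < θ) (x : ℝ) (hy : 0 < y) :
    HasSum (kernelTerm α θ x y)
      (∫ u in (0 : ℝ)..1, wrightBessel ((α + 1) / θ) (1 / θ) (u * x)
        * wrightBessel (α + 1) θ ((u * y) ^ θ) * u ^ α) := by
  have ha : 0 < (α + 1) / θ := div_pos (by linarith) hθ
  have hα' : 0 < α + 1 := by linarith
  set A := wrightBesselTerm ((α + 1) / θ) (1 / θ) with hA
  set B := wrightBesselTerm (α + 1) θ with hB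
  set F : ℕ × ℕ → ℝ → ℝ := fun i u => A x i.1 * B (y ^ θ) i.2 * u ^ (α + i.1 + θ * i.2) with hF
  have hexp : ∀ i : ℕ × ℕ, -1 < α + i.1 + θ * i.2 := fun i => by
    have : 0 ≤ θ * (i.2 : ℝ) := by positivity
    have : (0 : ℝ) ≤ i.1 := by positivity
    linarith
  have hint : ∀ (i : ℕ × ℕ) (k : ℝ), ∫ u in (0 : ℝ)..1, k * u ^ (α + i.1 + θ * i.2)
      = k / (α + 1 + i.1 + θ * i.2) := fun i k => by
    have h1 := hexp i
    rw [intervalIntegral.integral_const_mul, integral_rpow (Or.inl (hexp i)), Real.one_rpow,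
      Real.zero_rpow (by linarith)]
    rw [sub_zero, mul_one_div]
    congr 1
    ring
  have hFint : ∀ i, IntegrableOn (F i) (Ioc 0 1) := fun i => by
    rw [← intervalIntegrable_iff_integrableOn_Ioc_of_le zero_le_one]
    exact (intervalIntegral.intervalIntegrable_rpow' (hexp i)).const_mul _
  have hnorm : ∀ i, ∫ u in Ioc (0 : ℝ) 1, ‖F i u‖ = ‖kernelTerm α θ x y i‖ := fun i => by
    have h1 := hexp i
    rw [kernelTerm, norm_div, Real.norm_of_nonneg (show 0 ≤ α + 1 + i.1 + θ * i.2 by linarith), ← hint,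
      intervalIntegral.integral_of_le zero_le_one]
    refine setIntegral_congr_fun measurableSet_Ioc fun u hu => ?_
    simp only [hF, norm_mul]
    rw [Real.norm_of_nonneg (Real.rpow_nonneg hu.1.le _)]
  have key := hasSum_integral_of_summable_integral_norm (F := F) (μ := volume.restrict (Ioc 0 1)) hFint
    (by simpa only [hnorm] using (summable_kernelTerm hα hθ x y).norm)
  have h1 : ∀ i, ∫ u in Ioc (0 : ℝ) 1, F i u = kernelTerm α θ x y i := fun i => by
    rw [← intervalIntegral.integral_of_le zero_le_one, kernelTerm, ← hint]
  simp only [h1] at key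
  rw [intervalIntegral.integral_of_le zero_le_one]
  refine (congrArg (HasSum (kernelTerm α θ x y)) ?_).mpr key
  refine setIntegral_congr_fun (measurableSet_Ioc (a := (0 : ℝ)) (b := 1)) fun u hu => ?_
  have e : ∀ i : ℕ × ℕ, F i u = A (u * x) i.1 * B ((u * y) ^ θ) i.2 * u ^ α := fun i => by
    have hu0 : 0 < u := hu.1
    rw [hF, hA, hB, Real.mul_rpow hu0.le hy.le, wrightBesselTerm_mul _ _ x, wrightBesselTerm_mul _ _ (y ^ θ),
      ← Real.rpow_natCast u, ← Real.rpow_natCast (u ^ θ), ← Real.rpow_mul hu0.le]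
    simp only
    rw [Real.rpow_add hu0, Real.rpow_add hu0]
    ring
  simp only [e]
  rw [tsum_mul_right, wrightBessel, wrightBessel, tsum_mul_tsum_of_summable_norm
    (summable_wrightBesselTerm ha (one_div_pos.2 hθ) _).norm
    (summable_wrightBesselTerm hα' hθ _).norm]

theorem intervalIntegrable_wrightBessel_mul (hα : -1 < α) (hθ : 0 < θ) (x y : ℝ) :
    IntervalIntegrable (fun u => wrightBessel ((α + 1) / θ) (1 / θ) (u * x)
        * wrightBessel (α + 1) θ ((u * y) ^ θ) * u ^ α) volume 0 1 := by
  have ha : 0 < (α + 1) / θ := div_pos (by linarith) hθ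
  have hα' : 0 < α + 1 := by linarith
  refine (intervalIntegral.intervalIntegrable_rpow' hα).continuousOn_mul (Continuous.continuousOn ?_)
  refine Continuous.mul ?_ ?_
  · exact (continuous_wrightBessel ha (one_div_pos.2 hθ)).comp (by fun_prop)
  · refine (continuous_wrightBessel hα' hθ).comp ?_
    exact Continuous.rpow_const (by fun_prop) fun _ => Or.inr hθ.le

theorem hardEdgeKernel_eq_integral (hα : -1 < α) (hθ : 0 < θ) (x : ℝ) (hy : 0 < y) :
    hardEdgeKernel α θ x y = θ * x ^ α * ∫ u in (0 : ℝ)..1,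
      wrightBessel ((α + 1) / θ) (1 / θ) (u * x) * wrightBessel (α + 1) θ ((u * y) ^ θ) * u ^ α := by
  rw [hardEdgeKernel, (hasSum_integral_kernelTerm hα hθ x hy).tsum_eq]

theorem re_affine_div (z : ℂ) : ((z - (α + 1)) / θ).re = (z.re - (α + 1)) / θ := by
  rw [Complex.div_ofReal_re]
  simp

theorem im_affine_div (z : ℂ) : ((z - (α + 1)) / θ).im = z.im / θ := by
  rw [Complex.div_ofReal_im]
  simp

theorem le_norm_affine_sub (hθ : 0 < θ) {z : ℂ} {e : ℝ} (he : z.re ≤ e) (j : ℕ) :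
    (α + 1 - e) / θ ≤ ‖(z - (α + 1)) / θ - j‖ := by
  refine le_trans ?_ (Complex.abs_re_le_norm _)
  rw [Complex.sub_re, re_affine_div, Complex.natCast_re]
  refine le_trans ?_ (neg_le_abs _)
  have h1 : (z.re - (α + 1)) / θ ≤ (e - (α + 1)) / θ := by gcongr
  have h2 : (α + 1 - e) / θ = -((e - (α + 1)) / θ) := by ring
  have h3 : (0 : ℝ) ≤ j := j.cast_nonneg
  linarith

theorem abs_im_le_norm_affine_sub (hθ : 0 < θ) (z : ℂ) (j : ℕ) :
    |z.im| / θ ≤ ‖(z - (α + 1)) / θ - j‖ := by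
  refine le_trans (le_of_eq ?_) (Complex.abs_im_le_norm _)
  rw [Complex.sub_im, im_affine_div, Complex.natCast_im, sub_zero, abs_div, abs_of_pos hθ]

/-- Any lower bound `δ` for the distance from s = (z - α - 1)/θ to the points j is admitted. A
constant one gives boundedness on left half planes, δ = |Im z|/θ gives the decay 1/|Im z|. -/
theorem hasSum_stieltjesSum (hα : -1 < α) (hθ : 0 < θ) (y : ℝ) {z : ℂ} {δ : ℝ} (hδ : 0 < δ)
    (hz : ∀ j : ℕ, δ ≤ ‖(z - (α + 1)) / θ - j‖) :
    HasSum (fun j : ℕ => (wrightBesselTerm (α + 1) θ (y ^ θ) j : ℂ) / ((z - (α + 1)) / θ - j))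
      (stieltjesSum α θ y z) ∧
    ‖stieltjesSum α θ y z‖ ≤ (∑' j, ‖wrightBesselTerm (α + 1) θ (y ^ θ) j‖) / δ := by
  have hs := (summable_wrightBesselTerm (show 0 < α + 1 by linarith) hθ (y ^ θ)).norm
  have hle : ∀ j : ℕ, ‖(wrightBesselTerm (α + 1) θ (y ^ θ) j : ℂ) / ((z - (α + 1)) / θ - j)‖
      ≤ ‖wrightBesselTerm (α + 1) θ (y ^ θ) j‖ / δ := fun j => by
    rw [norm_div, Complex.norm_real]
    gcongr
    exact hz j
  refine ⟨(Summable.of_norm_bounded (hs.div_const δ) hle).hasSum, ?_⟩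
  rw [← tsum_div_const]
  exact tsum_of_norm_bounded (hs.div_const δ).hasSum hle

theorem differentiableOn_stieltjesSum (hα : -1 < α) (hθ : 0 < θ) (y : ℝ) :
    DifferentiableOn ℂ (stieltjesSum α θ y) {z | z.re < α + 1} := by
  intro z hz
  have hz' : z.re < α + 1 := hz
  obtain ⟨e, he1, he2⟩ := exists_between hz'
  have hδ : 0 < (α + 1 - e) / θ := div_pos (by linarith) hθ
  have hopen : IsOpen {w : ℂ | w.re < e} := isOpen_lt Complex.continuous_re continuous_const
  have hs := (summable_wrightBesselTerm (show 0 < α + 1 by linarith) hθ (y ^ θ)).norm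
  have hθ' : (θ : ℂ) ≠ 0 := Complex.ofReal_ne_zero.2 hθ.ne'
  have h : DifferentiableOn ℂ (stieltjesSum α θ y) {w | w.re < e} := by
    refine Complex.differentiableOn_tsum_of_summable_norm (hs.div_const ((α + 1 - e) / θ)) (fun j => ?_) hopen
      fun j w hw => ?_
    · refine DifferentiableOn.div (by fun_prop) (by fun_prop) fun w hw h0 => ?_
      have := le_norm_affine_sub (α := α) hθ (le_of_lt hw) j
      rw [h0, norm_zero] at this
      linarith
    · rw [norm_div, Complex.norm_real]
      gcongr
      exact le_norm_affine_sub hθ (le_of_lt hw) j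
  exact (h.differentiableAt (hopen.mem_nhds he1)).differentiableWithinAt

/-- At z = -k the denominator (z - α - 1)/θ - j equals -(α+1+k+θj)/θ, so summing first over j and
then over k runs through -θ times the double series. -/
theorem hasSum_mellinBarnesResidue_stieltjesSum (hα : -1 < α) (hθ : 0 < θ) (x y : ℝ) :
    HasSum (mellinBarnesResidue ((α + 1) / θ) θ x (stieltjesSum α θ y))
      ((-θ * ∑' i : ℕ × ℕ, kernelTerm α θ x y i : ℝ) : ℂ) := by
  have hθ' : (θ : ℂ) ≠ 0 := Complex.ofReal_ne_zero.2 hθ.ne'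
  have hα' : 0 < α + 1 := by linarith
  have h1 : HasSum (fun i : ℕ × ℕ => ((-θ * kernelTerm α θ x y i : ℝ) : ℂ))
      ((-θ * ∑' i : ℕ × ℕ, kernelTerm α θ x y i : ℝ) : ℂ) :=
    Complex.hasSum_ofReal.2 ((summable_kernelTerm hα hθ x y).hasSum.mul_left (-θ))
  refine h1.prod_fiberwise fun k => ?_
  have h2 := (hasSum_stieltjesSum hα hθ y (z := -(k : ℂ)) (div_pos hα' hθ) fun j => by
    simpa using le_norm_affine_sub (α := α) hθ (z := -(k : ℂ)) (e := 0) (by simp) j).1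
  have hk : ((wrightBesselTerm ((α + 1) / θ) (1 / θ) x k : ℝ) : ℂ)
      = (-(x : ℂ)) ^ k / (k.factorial * Real.Gamma ((α + 1) / θ + 1 / θ * k)) := by
    rw [wrightBesselTerm]
    push_cast
    rfl
  rw [mellinBarnesResidue, ← hk]
  refine (congrArg (HasSum · _) (funext fun j => ?_)).mp
    (h2.mul_left (wrightBesselTerm ((α + 1) / θ) (1 / θ) x k : ℂ))
  have h3 : (α : ℂ) + 1 + k + θ * j ≠ 0 := by
    have : 0 < α + 1 + k + θ * j := by positivity
    exact_mod_cast this.ne'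
  have h4 : (-(k : ℂ) - (α + 1)) / θ - j = -((α + 1 + k + θ * j) / θ) := by
    field_simp
    ring
  rw [h4, kernelTerm]
  push_cast
  field_simp
-- The double contour integral
/-- The `s`-dependent prefactor of the double contour integrand. -/
noncomputable def hardEdgeWeight (α θ x : ℝ) (s : ℂ) : ℂ :=
  Complex.Gamma (s + 1) * Complex.Gamma (α + 1 + θ * s) * Complex.sin (Real.pi * s)
    * (x : ℂ) ^ (-θ * s - 1)

theorem ne_of_im_ne_zero {t : ℂ} (ht : t.im ≠ 0) (m : ℤ) : t ≠ m := fun h => ht (by simp [h])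

theorem sin_pi_mul_ne_zero_of_im {t : ℂ} (ht : t.im ≠ 0) : Complex.sin (Real.pi * t) ≠ 0 := by
  rw [Complex.sin_ne_zero_iff]
  intro k hk
  rw [mul_comm (k : ℂ)] at hk
  exact ne_of_im_ne_zero ht k (mul_left_cancel₀ (Complex.ofReal_ne_zero.2 Real.pi_ne_zero) hk)

theorem Gamma_neg_mul_Gamma_add_one (t : ℂ) :
    Complex.Gamma (-t) * Complex.Gamma (t + 1) = -(Real.pi / Complex.sin (Real.pi * t)) := by
  have h := Complex.Gamma_mul_Gamma_one_sub (-t)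
  rw [sub_neg_eq_add, mul_neg, Complex.sin_neg, div_neg, add_comm] at h
  exact h

theorem Gamma_ne_zero_of_im_ne_zero {t : ℂ} (ht : t.im ≠ 0) : Complex.Gamma t ≠ 0 :=
  Complex.Gamma_ne_zero fun m hm => ht (by simp [hm])

/-- By reflection 1/(Γ(t+1) sin πt) = -Γ(-t)/π. Off the real axis nothing is divided by zero. -/
theorem hardEdgeIntegrand_eq (y : ℝ) (s : ℂ) {t : ℂ} (ht : t.im ≠ 0) :
    hardEdgeIntegrand α θ x y s t = -(hardEdgeWeight α θ x s / Real.pi)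
      * loopIntegrand (α + 1) θ y (fun t => (s - t)⁻¹) t := by
  have hpi : (Real.pi : ℂ) ≠ 0 := Complex.ofReal_ne_zero.2 Real.pi_ne_zero
  have hs := sin_pi_mul_ne_zero_of_im ht
  have hΓ : Complex.Gamma (t + 1) ≠ 0 := Gamma_ne_zero_of_im_ne_zero (by simpa using ht)
  have h : Complex.Gamma (-t) = -(Real.pi / (Complex.sin (Real.pi * t) * Complex.Gamma (t + 1))) := by
    rw [← div_div, ← neg_div, eq_div_iff hΓ]
    exact Gamma_neg_mul_Gamma_add_one t
  rw [hardEdgeIntegrand, hardEdgeWeight, loopIntegrand, h, div_eq_mul_inv, div_eq_mul_inv, div_eq_mul_inv,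
    div_eq_mul_inv, div_eq_mul_inv, div_eq_mul_inv, mul_inv, mul_inv, Complex.ofReal_add,
    Complex.ofReal_one]
  have e : (Real.pi : ℂ) * (Real.pi : ℂ)⁻¹ = 1 := mul_inv_cancel₀ hpi
  linear_combination (-(Complex.Gamma (s + 1) * Complex.Gamma (α + 1 + θ * s) * Complex.sin (Real.pi * s)
    * (x : ℂ) ^ (-θ * s - 1) * ((Complex.Gamma (t + 1))⁻¹ * (Complex.Gamma (α + 1 + θ * t))⁻¹
    * (Complex.sin (Real.pi * t))⁻¹ * (y : ℂ) ^ ((θ : ℂ) * t) * (s - t)⁻¹))) * e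

/-- Reflection gives Γ(s+1) sin πs = -π/Γ(-s), and -s = (α+1)/θ - z/θ for z = α+1+θs, which is the
general Mellin-Barnes form. -/
theorem hardEdgeWeight_eq (hθ : 0 < θ) (hx : 0 < x) {s : ℂ} (hs : s.im ≠ 0) (H : ℂ → ℂ) :
    hardEdgeWeight α θ x s * H (α + 1 + θ * s)
      = -(Real.pi * (x : ℂ) ^ (α : ℂ))
        * mellinBarnesIntegrand ((α + 1) / θ) θ x H ((α + 1 : ℝ) + θ * s) := by
  have hθ' : (θ : ℂ) ≠ 0 := Complex.ofReal_ne_zero.2 hθ.ne'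
  have hx' : (x : ℂ) ≠ 0 := Complex.ofReal_ne_zero.2 hx.ne'
  have hsin := sin_pi_mul_ne_zero_of_im hs
  have hΓ : Complex.Gamma (-s) ≠ 0 := Gamma_ne_zero_of_im_ne_zero (by simpa using hs)
  have h1 : Complex.Gamma (s + 1) * Complex.sin (Real.pi * s) = -(Real.pi / Complex.Gamma (-s)) := by
    have h := Gamma_neg_mul_Gamma_add_one s
    rw [← neg_div, eq_div_iff hsin] at h
    rw [← neg_div, eq_div_iff hΓ, ← h]
    ring
  have e1 : (((α + 1) / θ : ℝ) : ℂ) - ((α + 1 : ℝ) + θ * s) / θ = -s := by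
    push_cast
    field_simp
    ring
  have e2 : (x : ℂ) ^ (-(θ : ℂ) * s - 1) = (x : ℂ) ^ (α : ℂ) * (x : ℂ) ^ (-(((α + 1 : ℝ) : ℂ) + θ * s)) := by
    rw [← Complex.cpow_add _ _ hx']
    congr 1
    push_cast
    ring
  rw [hardEdgeWeight, mellinBarnesIntegrand, e1, e2, div_eq_mul_inv]
  rw [div_eq_mul_inv] at h1
  push_cast
  linear_combination (Complex.Gamma (α + 1 + θ * s) * ((x : ℂ) ^ (α : ℂ)
    * (x : ℂ) ^ (-((α : ℂ) + 1 + θ * s))) * H (α + 1 + θ * s)) * h1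

/-- The loop meets the real axis at one point only, so the values there do not matter. -/
theorem rightLoopIntegral_congr {f g : ℂ → ℂ} {d h : ℝ} (hh : 0 < h)
    (hfg : ∀ t : ℂ, t.im ≠ 0 → f t = g t) :
    rightLoopIntegral d h f = rightLoopIntegral d h g := by
  unfold rightLoopIntegral
  congr 1
  · congr 1
    · congr 1
      funext u
      exact hfg _ (by simpa using hh.ne')
    · congr 1
      funext u
      exact hfg _ (by simpa using hh.ne')
  · congr 1
    refine intervalIntegral.integral_congr_ae ?_
    filter_upwards [Measure.ae_ne volume (0 : ℝ)] with v hv _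
    exact hfg _ (by simpa using hv)

theorem RightLoopIntegrable.congr {f g : ℂ → ℂ} {d h : ℝ} (hg : RightLoopIntegrable d h g) (hh : 0 < h)
    (hfg : ∀ t : ℂ, t.im ≠ 0 → f t = g t) : RightLoopIntegrable d h f := by
  refine ⟨?_, ?_, ?_⟩
  · have : ∀ u : ℝ, f (u - h * Complex.I) = g (u - h * Complex.I) := fun u =>
      hfg _ (by simpa using hh.ne')
    simp only [this]
    exact hg.1
  · have : ∀ u : ℝ, f (u + h * Complex.I) = g (u + h * Complex.I) := fun u =>
      hfg _ (by simpa using hh.ne')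
    simp only [this]
    exact hg.2.1
  · refine hg.2.2.congr_ae ?_
    filter_upwards [ae_restrict_of_ae (Measure.ae_ne volume (0 : ℝ))] with v hv
    exact (hfg _ (by simpa using hv)).symm

theorem RightLoopIntegrable.const_mul {f : ℂ → ℂ} {d h : ℝ} (hf : RightLoopIntegrable d h f) (k : ℂ) :
    RightLoopIntegrable d h (fun t => k * f t) :=
  ⟨hf.1.const_mul k, hf.2.1.const_mul k, hf.2.2.const_mul k⟩

theorem rightLoopIntegral_const_mul (f : ℂ → ℂ) (d h : ℝ) (k : ℂ) :
    rightLoopIntegral d h (fun t => k * f t) = k * rightLoopIntegral d h f := by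
  unfold rightLoopIntegral
  rw [integral_const_mul, integral_const_mul, intervalIntegral.integral_const_mul]
  ring

theorem differentiableOn_inv_sub {c : ℝ} {s : ℂ} (hs : s.re = c) :
    DifferentiableOn ℂ (fun t => (s - t)⁻¹) {t | c < t.re} := by
  refine DifferentiableOn.inv (by fun_prop) fun t ht h0 => ?_
  have h1 : c < t.re := ht
  rw [sub_eq_zero.1 h0] at hs
  linarith

theorem norm_inv_sub_le {c d : ℝ} (hcd : c < d) {s t : ℂ} (hs : s.re = c) (ht : d ≤ t.re) :
    ‖(s - t)⁻¹‖ ≤ (d - c)⁻¹ := by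
  rw [norm_inv]
  refine inv_anti₀ (by linarith) (le_trans ?_ (Complex.abs_re_le_norm _))
  rw [Complex.sub_re, hs]
  refine le_trans ?_ (neg_le_abs _)
  linarith

/-- For fixed s the loop integral is, up to the prefactor, the Stieltjes sum at z = α+1+θs. The
remaining s-integral is of Mellin-Barnes type with this sum as multiplier; c < 0 keeps the line to
the left of its first pole z = α+1. -/
theorem lineIntegral_hardEdge (hα : -1 < α) (hθ : 1 ≤ θ) (hx : 0 < x) (hy : 0 < y) {c d h : ℝ}
    (hc : IsKernelAbscissa α θ c) (hcd : c < d) (hd : d < 0) (hh : 0 < h) :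
    (∀ s : ℂ, s.re = c → RightLoopIntegrable d h (hardEdgeIntegrand α θ x y s)) ∧
    (1 < θ → LineIntegrable (fun s => rightLoopIntegral d h (hardEdgeIntegrand α θ x y s)) c) ∧
    HasLineIntegral (fun s => θ / (2 * Real.pi * Complex.I) ^ 2
      * rightLoopIntegral d h (hardEdgeIntegrand α θ x y s)) c (hardEdgeKernel α θ x y) := by
  have hθ0 : 0 < θ := by linarith
  have hβ : 0 < α + 1 := by linarith
  obtain ⟨hc1, hc2, hc3⟩ := hc
  have hpi : (Real.pi : ℂ) ≠ 0 := Complex.ofReal_ne_zero.2 Real.pi_ne_zero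
  have hc0 : 0 < (α + 1) + θ * c := by
    rw [div_lt_iff₀ hθ0] at hc1
    linarith
  have hcb : (α + 1) + θ * c < α + 1 := by nlinarith
  have hint : ∀ s : ℂ, s.re = c → RightLoopIntegrable d h (hardEdgeIntegrand α θ x y s) := fun s hs =>
    ((rightLoopIntegrable_loopIntegrand hβ hθ hy hd hh hcd (differentiableOn_inv_sub hs)
      fun t ht => norm_inv_sub_le hcd hs ht).const_mul _).congr hh fun t ht => hardEdgeIntegrand_eq y s ht
  set H := stieltjesSum α θ y with hH
  set g := mellinBarnesIntegrand ((α + 1) / θ) θ x H with hg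
  have hloop : ∀ s : ℂ, s.re = c → s.im ≠ 0 → rightLoopIntegral d h (hardEdgeIntegrand α θ x y s)
      = -(2 * Real.pi * Complex.I * (x : ℂ) ^ (α : ℂ)) * g ((α + 1 : ℝ) + θ * s) := by
    intro s hs hs'
    have hz : (((α : ℂ) + 1 + θ * s) - (α + 1)) / θ = s := by
      have hθ' : (θ : ℂ) ≠ 0 := Complex.ofReal_ne_zero.2 hθ0.ne'
      field_simp
      ring
    have hS : HasSum (loopResidue (α + 1) θ y fun t => (s - t)⁻¹) (H (α + 1 + θ * s)) := by
      have h2 := (hasSum_stieltjesSum hα hθ0 y (z := α + 1 + θ * s) (δ := -c) (by linarith) fun j => by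
        rw [hz]
        refine le_trans ?_ (Complex.abs_re_le_norm _)
        rw [Complex.sub_re, hs, Complex.natCast_re]
        refine le_trans ?_ (neg_le_abs _)
        have : (0 : ℝ) ≤ j := j.cast_nonneg
        linarith).1
      rw [hz] at h2
      refine (congrArg (HasSum · _) (funext fun j => ?_)).mp h2
      rw [loopResidue_eq, div_eq_mul_inv]
    rw [rightLoopIntegral_congr hh fun t ht => hardEdgeIntegrand_eq y s ht, rightLoopIntegral_const_mul,
      rightLoopIntegral_loopIntegrand hβ hθ hy hd hh hcd (differentiableOn_inv_sub hs)
        (fun t ht => norm_inv_sub_le hcd hs ht) hS]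
    have := hardEdgeWeight_eq (α := α) hθ0 hx hs' H
    rw [← hg] at this
    calc _ = 2 * Complex.I * (hardEdgeWeight α θ x s * H (α + 1 + θ * s)) := by
          field_simp
      _ = _ := by
          rw [this]
          ring
  set m := ∑' j, ‖wrightBesselTerm (α + 1) θ (y ^ θ) j‖ with hm
  have hm0 : 0 ≤ m := tsum_nonneg fun j => norm_nonneg _
  have hδ : 0 < -c := by linarith
  -- One constant for two bounds: m/(-c) holds on the whole half plane, mθ/|Im z| away from the real
  -- axis.
  have hM0 : 0 ≤ m / (-c) + m * θ := by positivity
  have hM : ∀ z : ℂ, z.re ≤ α + 1 + θ * c → ‖H z‖ ≤ m / (-c) + m * θ := fun z hz => by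
    have h1 := (hasSum_stieltjesSum hα hθ0 y (z := z) hδ fun j => by
      have := le_norm_affine_sub (α := α) hθ0 hz j
      rwa [show (α + 1 - (α + 1 + θ * c)) / θ = -c by field_simp; ring] at this).2
    have : 0 ≤ m * θ := by positivity
    linarith
  have hMr : ∀ z : ℂ, z.re ≤ α + 1 + θ * c → 1 ≤ |z.im| → ‖H z‖ ≤ (m / (-c) + m * θ) * |z.im| ^ (-1 : ℝ) :=
    fun z _ hz => by
    have h1 := (hasSum_stieltjesSum hα hθ0 y (z := z) (δ := |z.im| / θ) (by positivity)
      fun j => abs_im_le_norm_affine_sub hθ0 z j).2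
    have h2 : 0 ≤ m / (-c) * |z.im|⁻¹ := by positivity
    rw [Real.rpow_neg_one, add_mul]
    have h3 : m / (|z.im| / θ) = m * θ * |z.im|⁻¹ := by field_simp
    rw [← hm, h3] at h1
    linarith
  have hdiff := differentiableOn_stieltjesSum hα hθ0 y
  have hae : ∀ᵐ τ : ℝ, -(2 * Real.pi * Complex.I * (x : ℂ) ^ (α : ℂ))
        * g ((α + 1 : ℝ) + θ * (c + τ * Complex.I))
      = rightLoopIntegral d h (hardEdgeIntegrand α θ x y (c + τ * Complex.I)) := by
    filter_upwards [Measure.ae_ne volume (0 : ℝ)] with τ hτ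
    exact (hloop _ (by simp) (by simpa using hτ)).symm
  refine ⟨hint, fun h1 => ?_, ?_⟩
  · have := LineIntegrable.comp_affine hθ0 (lineIntegrable_mellinBarnesIntegrand
      (a := (α + 1) / θ) h1 hx hM0 hc0 hcb hdiff hM)
    exact (Integrable.const_mul this _).congr hae
  · have hcond : 1 < θ ∨ 2 * (α + 1 + θ * c) - (α + 1) / θ * θ - 1 ≤ 0 := by
      rcases hθ.lt_or_eq with h | h
      · exact Or.inl h
      · refine hc3.imp id fun h' => ?_
        rw [div_mul_cancel₀ _ hθ0.ne', ← h]
        linarith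
    have h1 := HasLineIntegral.comp_affine hθ0 (hasLineIntegral_mellinBarnesIntegrand
      (a := (α + 1) / θ) (r := 1) hθ hx hM0 hc0 hcb hdiff hM hMr hcond
      (hasSum_mellinBarnesResidue_stieltjesSum hα hθ0 x y))
    have h2 := h1.const_mul (1 / (2 * Real.pi * Complex.I) ^ 2
      * -(2 * Real.pi * Complex.I * (x : ℂ) ^ (α : ℂ)))
    have h3 : 1 / (2 * Real.pi * Complex.I) ^ 2 * -(2 * Real.pi * Complex.I * (x : ℂ) ^ (α : ℂ))
        * (2 * Real.pi * Complex.I * ((-θ * ∑' i : ℕ × ℕ, kernelTerm α θ x y i : ℝ) : ℂ))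
        = (hardEdgeKernel α θ x y : ℂ) := by
      rw [hardEdgeKernel]
      push_cast
      rw [Complex.ofReal_cpow hx.le]
      field_simp
    rw [h3] at h2
    refine h2.congr_ae ?_
    filter_upwards [hae] with τ hτ
    rw [← hτ]
    ring

end

/-! ### Existence and uniqueness of the biorthogonal polynomials -/

/-- The linear map sending `X ^ i` to the rising factorial `z (z + 1) ⋯ (z + i - 1)`. -/
noncomputable def risingEval (P : Polynomial ℝ) (z : ℝ) : ℝ :=
  P.sum fun i c => c * (ascPochhammer ℝ i).eval z

/-- The pairing of the Laguerre biorthogonal ensemble. -/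
noncomputable def laguerrePairing (α θ : ℝ) (P Q : Polynomial ℝ) : ℝ :=
  ∫ x in Ioi (0 : ℝ), P.eval x * Q.eval (x ^ θ) * x ^ α * Real.exp (-x)

theorem risingEval_add (P Q : Polynomial ℝ) (z : ℝ) :
    risingEval (P + Q) z = risingEval P z + risingEval Q z :=
  Polynomial.sum_add_index _ _ _ (by simp) (by intros; ring)

theorem risingEval_monomial (i : ℕ) (c z : ℝ) :
    risingEval (Polynomial.monomial i c) z = c * (ascPochhammer ℝ i).eval z :=
  Polynomial.sum_monomial_index _ _ (by simp)

theorem Gamma_add_natCast {z : ℝ} (hz : 0 < z) (i : ℕ) :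
    Real.Gamma (z + i) = Real.Gamma z * (ascPochhammer ℝ i).eval z := by
  induction i with
  | zero => simp
  | succ i ih =>
    rw [ascPochhammer_succ_eval, ← mul_assoc, ← ih, Nat.cast_succ, ← add_assoc,
      Real.Gamma_add_one (by positivity)]
    ring

/-- Every polynomial is a combination of rising factorials, with the same leading term. -/
theorem exists_risingEval_eq_of_degree_lt (n : ℕ) (L : Polynomial ℝ) (hL : L.degree < n) :
    ∃ P : Polynomial ℝ, P.degree < n ∧ ∀ z, risingEval P z = L.eval z := by
  induction n generalizing L with
  | zero =>
    have h0 : L = 0 := by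
      rw [← Polynomial.degree_eq_bot]
      exact Nat.WithBot.lt_zero_iff.1 hL
    exact ⟨0, by simp, fun z => by simp [h0, risingEval]⟩
  | succ n ih =>
    rw [Polynomial.degree_lt_iff_coeff_zero] at hL
    have hmonic := monic_ascPochhammer ℝ n
    have hdeg := ascPochhammer_natDegree ℝ n
    have hlt : (L - Polynomial.C (L.coeff n) * ascPochhammer ℝ n).degree < n := by
      rw [Polynomial.degree_lt_iff_coeff_zero]
      intro m hm
      rw [Polynomial.coeff_sub, Polynomial.coeff_C_mul]
      rcases hm.lt_or_eq with h | rfl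
      · rw [hL m h, Polynomial.coeff_eq_zero_of_natDegree_lt (p := ascPochhammer ℝ n) (by omega)]
        simp
      · have : (ascPochhammer ℝ n).coeff n = 1 := by
          have := hmonic.coeff_natDegree
          rwa [hdeg] at this
        rw [this]
        simp
    obtain ⟨P, hP, hPe⟩ := ih _ hlt
    refine ⟨P + Polynomial.monomial n (L.coeff n), ?_, fun z => ?_⟩
    · rw [Polynomial.degree_lt_iff_coeff_zero] at hP ⊢
      intro m hm
      rw [Polynomial.coeff_add, hP m (by omega), Polynomial.coeff_monomial, if_neg (by omega), add_zero]
    · rw [risingEval_add, risingEval_monomial, hPe]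
      simp

/-- Rising factorials are monic of every degree, so the map is triangular with unit diagonal;
splitting off the top term preserves degree and leading coefficient. -/
theorem exists_risingEval_eq (L : Polynomial ℝ) (hL : L ≠ 0) :
    ∃ P : Polynomial ℝ, P.natDegree = L.natDegree ∧ P.leadingCoeff = L.leadingCoeff ∧
      ∀ z, risingEval P z = L.eval z := by
  set n := L.natDegree with hn
  have hmonic := monic_ascPochhammer ℝ n
  have hdeg := ascPochhammer_natDegree ℝ n
  have hlc : L.leadingCoeff ≠ 0 := Polynomial.leadingCoeff_ne_zero.2 hL
  have hlt : (L - Polynomial.C L.leadingCoeff * ascPochhammer ℝ n).degree < n := by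
    rw [Polynomial.degree_lt_iff_coeff_zero]
    intro m hm
    rw [Polynomial.coeff_sub, Polynomial.coeff_C_mul]
    rcases hm.lt_or_eq with h | h
    · rw [Polynomial.coeff_eq_zero_of_natDegree_lt (p := L) (by omega),
        Polynomial.coeff_eq_zero_of_natDegree_lt (p := ascPochhammer ℝ n) (by omega)]
      simp
    · have : (ascPochhammer ℝ n).coeff n = 1 := by
        have := hmonic.coeff_natDegree
        rwa [hdeg] at this
      rw [← h, this, Polynomial.leadingCoeff]
      simp [hn]
  obtain ⟨P, hP, hPe⟩ := exists_risingEval_eq_of_degree_lt n _ hlt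
  have hmd : (Polynomial.monomial n L.leadingCoeff).degree = n := Polynomial.degree_monomial n hlc
  have hPlt : P.degree < (Polynomial.monomial n L.leadingCoeff).degree := by rwa [hmd]
  refine ⟨P + Polynomial.monomial n L.leadingCoeff, ?_, ?_, fun z => ?_⟩
  · rw [Polynomial.natDegree, Polynomial.degree_add_eq_right_of_degree_lt hPlt, hmd]
    rfl
  · rw [Polynomial.leadingCoeff_add_of_degree_lt hPlt, Polynomial.leadingCoeff_monomial]
  · rw [risingEval_add, risingEval_monomial, hPe]
    simp

section
variable {α θ : ℝ}

theorem laguerre_monomial_eq {x : ℝ} (hx : 0 < x) (i k : ℕ) :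
    x ^ i * (x ^ θ) ^ k * x ^ α * Real.exp (-x)
      = Real.exp (-x) * x ^ ((α + 1 + θ * k + i) - 1) := by
  rw [show (α + 1 + θ * k + i) - 1 = (i : ℝ) + θ * k + α by ring, Real.rpow_add hx, Real.rpow_add hx,
    Real.rpow_natCast, Real.rpow_mul hx.le, Real.rpow_natCast]
  ring

theorem laguerre_integrand_eq (P Q : Polynomial ℝ) {x : ℝ} (hx : 0 < x) :
    P.eval x * Q.eval (x ^ θ) * x ^ α * Real.exp (-x)
      = ∑ k ∈ Q.support, ∑ i ∈ P.support, P.coeff i * Q.coeff k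
        * (Real.exp (-x) * x ^ ((α + 1 + θ * k + i) - 1)) := by
  rw [Polynomial.eval_eq_sum, Polynomial.eval_eq_sum, Polynomial.sum_def, Polynomial.sum_def,
    Finset.sum_mul_sum, Finset.sum_comm, Finset.sum_mul, Finset.sum_mul]
  refine Finset.sum_congr rfl fun k _ => ?_
  rw [Finset.sum_mul, Finset.sum_mul]
  refine Finset.sum_congr rfl fun i _ => ?_
  rw [← laguerre_monomial_eq hx]
  ring

theorem laguerre_exponent_pos (hα : -1 < α) (hθ : 0 < θ) (i k : ℕ) : 0 < α + 1 + θ * k + i := by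
  have : 0 ≤ θ * (k : ℝ) := by positivity
  have : (0 : ℝ) ≤ i := i.cast_nonneg
  linarith

theorem integrableOn_laguerre (hα : -1 < α) (hθ : 0 < θ) (P Q : Polynomial ℝ) :
    IntegrableOn (fun x => P.eval x * Q.eval (x ^ θ) * x ^ α * Real.exp (-x)) (Ioi 0) := by
  refine IntegrableOn.congr_fun ?_ (fun x hx => (laguerre_integrand_eq P Q hx).symm) measurableSet_Ioi
  refine integrable_finsetSum _ fun k _ => integrable_finsetSum _ fun i _ => ?_
  exact (Real.GammaIntegral_convergent (laguerre_exponent_pos hα hθ i k)).const_mul _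

/-- Each monomial integrates to Γ(α+1+θk+i) = Γ(z) (z)_i with z = α+1+θk. The pairing therefore sees
P only through the values of its rising transform at these points. -/
theorem laguerrePairing_eq (hα : -1 < α) (hθ : 0 < θ) (P Q : Polynomial ℝ) :
    laguerrePairing α θ P Q
      = Q.sum fun k b => b * (Real.Gamma (α + 1 + θ * k) * risingEval P (α + 1 + θ * k)) := by
  have hi : ∀ k i : ℕ, IntegrableOn (fun x => P.coeff i * Q.coeff k
        * (Real.exp (-x) * x ^ ((α + 1 + θ * k + i) - 1))) (Ioi 0) := fun k i =>
    (Real.GammaIntegral_convergent (laguerre_exponent_pos hα hθ i k)).const_mul _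
  rw [laguerrePairing, setIntegral_congr_fun measurableSet_Ioi fun x hx => laguerre_integrand_eq P Q hx,
    integral_finsetSum _ fun k _ => integrable_finsetSum _ fun i _ => hi k i, Polynomial.sum_def]
  refine Finset.sum_congr rfl fun k _ => ?_
  rw [integral_finsetSum _ fun i _ => hi k i, risingEval, Polynomial.sum_def, Finset.mul_sum,
    Finset.mul_sum]
  refine Finset.sum_congr rfl fun i _ => ?_
  rw [integral_const_mul, ← Real.Gamma_eq_integral (laguerre_exponent_pos hα hθ i k),
    Gamma_add_natCast (by simpa using laguerre_exponent_pos hα hθ 0 k)]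
  ring

theorem laguerrePairing_sub_left (hα : -1 < α) (hθ : 0 < θ) (P P' Q : Polynomial ℝ) :
    laguerrePairing α θ (P - P') Q = laguerrePairing α θ P Q - laguerrePairing α θ P' Q := by
  rw [laguerrePairing, laguerrePairing, laguerrePairing,
    ← integral_sub (integrableOn_laguerre hα hθ P Q) (integrableOn_laguerre hα hθ P' Q)]
  refine setIntegral_congr_fun measurableSet_Ioi fun x _ => ?_
  simp only [Polynomial.eval_sub]
  ring

theorem laguerrePairing_sub_right (hα : -1 < α) (hθ : 0 < θ) (P Q Q' : Polynomial ℝ) :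
    laguerrePairing α θ P (Q - Q') = laguerrePairing α θ P Q - laguerrePairing α θ P Q' := by
  rw [laguerrePairing, laguerrePairing, laguerrePairing,
    ← integral_sub (integrableOn_laguerre hα hθ P Q) (integrableOn_laguerre hα hθ P Q')]
  refine setIntegral_congr_fun measurableSet_Ioi fun x _ => ?_
  simp only [Polynomial.eval_sub]
  ring

theorem laguerrePairing_C_mul_left (c : ℝ) (P Q : Polynomial ℝ) :
    laguerrePairing α θ (Polynomial.C c * P) Q = c * laguerrePairing α θ P Q := by
  rw [laguerrePairing, laguerrePairing, ← integral_const_mul]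
  refine setIntegral_congr_fun measurableSet_Ioi fun x _ => ?_
  simp only [Polynomial.eval_mul, Polynomial.eval_C]
  ring

theorem laguerrePairing_C_mul_right (c : ℝ) (P Q : Polynomial ℝ) :
    laguerrePairing α θ P (Polynomial.C c * Q) = c * laguerrePairing α θ P Q := by
  rw [laguerrePairing, laguerrePairing, ← integral_const_mul]
  refine setIntegral_congr_fun measurableSet_Ioi fun x _ => ?_
  simp only [Polynomial.eval_mul, Polynomial.eval_C]
  ring

theorem degree_sub_C_mul_lt {R S : Polynomial ℝ} {n : ℕ} (hR : R.degree < (n + 1 : ℕ)) {c : ℝ}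
    (hS : S.natDegree = n) (hc : c * S.coeff n = R.coeff n) :
    (R - Polynomial.C c * S).degree < n := by
  rw [Polynomial.degree_lt_iff_coeff_zero] at hR ⊢
  intro m hm
  rw [Polynomial.coeff_sub, Polynomial.coeff_C_mul]
  rcases hm.lt_or_eq with h | rfl
  · rw [hR m h, Polynomial.coeff_eq_zero_of_natDegree_lt (p := S) (by omega)]
    simp
  · rw [hc, sub_self]

variable {p q : ℕ → Polynomial ℝ}

theorem IsLaguerreBiorthogonal.pairing_eq (h : IsLaguerreBiorthogonal α θ p q) (j k : ℕ) :
    laguerrePairing α θ (p j) (q k) = if j = k then 1 else 0 := h.biorthogonal j k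

theorem IsLaguerreBiorthogonal.coeff_left_pos (h : IsLaguerreBiorthogonal α θ p q) (j : ℕ) :
    0 < (p j).coeff j := by
  have := h.leadingCoeff_left_pos j
  rwa [Polynomial.leadingCoeff, h.natDegree_left] at this

theorem IsLaguerreBiorthogonal.coeff_right (h : IsLaguerreBiorthogonal α θ p q) (j : ℕ) :
    (q j).coeff j = 1 := by
  have := (h.monic_right j).coeff_natDegree
  rwa [h.natDegree_right] at this

/-- Subtracting the multiple of the monic q_n with the same top coefficient lowers the degree; only
q_k contributes, so the pairing reads off a coefficient. -/
theorem IsLaguerreBiorthogonal.pairing_left (h : IsLaguerreBiorthogonal α θ p q) (hα : -1 < α)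
    (hθ : 0 < θ) (k n : ℕ) (hn : n ≤ k + 1) (R : Polynomial ℝ) (hR : R.degree < n) :
    laguerrePairing α θ (p k) R = R.coeff k := by
  induction n generalizing R with
  | zero =>
    have h0 : R = 0 := by
      rw [← Polynomial.degree_eq_bot]
      exact Nat.WithBot.lt_zero_iff.1 hR
    simp [h0, laguerrePairing]
  | succ n ih =>
    have hlt := degree_sub_C_mul_lt hR (h.natDegree_right n) (c := R.coeff n)
      (by rw [h.coeff_right, mul_one])
    have h1 := ih (by omega) _ hlt
    have h2 : (R - Polynomial.C (R.coeff n) * q n).coeff k = 0 :=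
      (Polynomial.degree_lt_iff_coeff_zero _ _).1 hlt k (by omega)
    rw [laguerrePairing_sub_right hα hθ, laguerrePairing_C_mul_right, h.pairing_eq, h2] at h1
    rcases eq_or_ne k n with rfl | hne
    · rw [if_pos rfl] at h1
      linarith
    · rw [if_neg hne] at h1
      rw [(Polynomial.degree_lt_iff_coeff_zero _ _).1 hR k (by omega)]
      linarith

theorem IsLaguerreBiorthogonal.pairing_right (h : IsLaguerreBiorthogonal α θ p q) (hα : -1 < α)
    (hθ : 0 < θ) (k n : ℕ) (hn : n ≤ k + 1) (R : Polynomial ℝ) (hR : R.degree < n) :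
    laguerrePairing α θ R (q k) = R.coeff k / (p k).coeff k := by
  induction n generalizing R with
  | zero =>
    have h0 : R = 0 := by
      rw [← Polynomial.degree_eq_bot]
      exact Nat.WithBot.lt_zero_iff.1 hR
    simp [h0, laguerrePairing]
  | succ n ih =>
    have hlt := degree_sub_C_mul_lt hR (h.natDegree_left n) (c := R.coeff n / (p n).coeff n)
      (div_mul_cancel₀ _ (h.coeff_left_pos n).ne')
    have h1 := ih (by omega) _ hlt
    have h2 : (R - Polynomial.C (R.coeff n / (p n).coeff n) * p n).coeff k = 0 :=
      (Polynomial.degree_lt_iff_coeff_zero _ _).1 hlt k (by omega)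
    rw [laguerrePairing_sub_left hα hθ, laguerrePairing_C_mul_left, h.pairing_eq, h2] at h1
    rcases eq_or_ne n k with rfl | hne
    · rw [if_pos rfl] at h1
      simp only [zero_div] at h1
      linarith
    · rw [if_neg hne] at h1
      rw [(Polynomial.degree_lt_iff_coeff_zero _ _).1 hR k (by omega)]
      simp only [zero_div] at h1 ⊢
      linarith

variable {p' q' : ℕ → Polynomial ℝ}

theorem degree_lt_of_natDegree_eq {R : Polynomial ℝ} {m n : ℕ} (h : R.natDegree = m) (hmn : m < n) :
    R.degree < n :=
  lt_of_le_of_lt Polynomial.degree_le_natDegree (by rw [h]; exact_mod_cast hmn)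

/-- If R = q_k - q'_k is nonzero of degree m, then m < k. Pairing with p_m gives the leading
coefficient of R, yet p_m is orthogonal to both q_k and q'_k because its degree is below k. -/
theorem IsLaguerreBiorthogonal.right_unique (h : IsLaguerreBiorthogonal α θ p q)
    (h' : IsLaguerreBiorthogonal α θ p' q') (hα : -1 < α) (hθ : 0 < θ) : q = q' := by
  funext k
  by_contra hne
  set R := q k - q' k with hR
  have hR0 : R ≠ 0 := sub_ne_zero.2 hne
  have hdeg : R.degree < k := by
    have := degree_sub_C_mul_lt (R := q k) (S := q' k) (n := k) (c := 1)
      (degree_lt_of_natDegree_eq (h.natDegree_right k) (Nat.lt_succ_self k)) (h'.natDegree_right k)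
      (by rw [h.coeff_right, h'.coeff_right, one_mul])
    simpa using this
  have hm : R.natDegree < k := (Polynomial.natDegree_lt_iff_degree_lt hR0).2 hdeg
  have h1 := h.pairing_left hα hθ R.natDegree _ le_rfl R
    (degree_lt_of_natDegree_eq rfl (Nat.lt_succ_self _))
  rw [hR, laguerrePairing_sub_right hα hθ, ← hR, h.pairing_eq, if_neg hm.ne,
    h'.pairing_right hα hθ k k (by omega) (p R.natDegree)
      (degree_lt_of_natDegree_eq (h.natDegree_left _) hm),
    Polynomial.coeff_eq_zero_of_natDegree_lt (by rwa [h.natDegree_left])] at h1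
  simp only [zero_div, sub_zero] at h1
  exact Polynomial.leadingCoeff_ne_zero.2 hR0 h1.symm

/-- With q shared, p_j - p'_j pairs to zero with every q_m; but for m the degree of a nonzero
difference, the pairing is a nonzero multiple of the leading coefficient. -/
theorem IsLaguerreBiorthogonal.left_unique (h : IsLaguerreBiorthogonal α θ p q)
    (h' : IsLaguerreBiorthogonal α θ p' q) (hα : -1 < α) (hθ : 0 < θ) : p = p' := by
  funext j
  by_contra hne
  set R := p j - p' j with hR
  have hR0 : R ≠ 0 := sub_ne_zero.2 hne
  have h1 := h.pairing_right hα hθ R.natDegree _ le_rfl R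
    (degree_lt_of_natDegree_eq rfl (Nat.lt_succ_self _))
  rw [hR, laguerrePairing_sub_left hα hθ, ← hR, h.pairing_eq, h'.pairing_eq, sub_self] at h1
  exact div_ne_zero (Polynomial.leadingCoeff_ne_zero.2 hR0) (h.coeff_left_pos _).ne' h1.symm

/-- The sum is the k-th forward difference at 0 of i ↦ C(i, j). -/
theorem sum_neg_one_pow_mul_choose_mul_choose (j k : ℕ) :
    ∑ i ∈ Finset.range (k + 1), (-1 : ℝ) ^ (k + i) * k.choose i * i.choose j
      = if j = k then 1 else 0 := by
  have h := fwdDiff_iter_choose_zero j k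
  rw [fwdDiff_iter_eq_sum_shift] at h
  have h2 := congrArg (fun z : ℤ => (z : ℝ)) h
  simp only [eq_comm (a := j)]
  rw [apply_ite (fun z : ℤ => (z : ℝ))] at h2
  push_cast at h2
  rw [← h2]
  refine Finset.sum_congr rfl fun i hi => ?_
  have hi' : i ≤ k := Nat.lt_succ_iff.1 (Finset.mem_range.1 hi)
  have e : (-1 : ℝ) ^ (k + i) = (-1) ^ (k - i) := by
    obtain ⟨m, rfl⟩ := Nat.exists_eq_add_of_le hi'
    rw [Nat.add_sub_cancel_left, show i + m + i = m + 2 * i by ring, pow_add, pow_mul]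
    simp
  rw [e]
  simp

/-- Existence of the biorthogonal polynomials, with explicit formulas. -/
theorem exists_isLaguerreBiorthogonal (hα : -1 < α) (hθ : 0 < θ) :
    ∃ p q : ℕ → Polynomial ℝ, IsLaguerreBiorthogonal α θ p q ∧
      (∀ j z, risingEval (p j) z = (∏ l ∈ Finset.range j, ((z - (α + 1)) / θ - l))
        / (j.factorial * Real.Gamma (α + 1 + θ * j))) ∧
      ∀ k y, (q k).eval y = ∑ i ∈ Finset.range (k + 1), (-1 : ℝ) ^ (k + i) * k.choose i
        * (Real.Gamma (α + 1 + θ * k) / Real.Gamma (α + 1 + θ * i)) * y ^ i := by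
  have hΓ : ∀ k : ℕ, 0 < Real.Gamma (α + 1 + θ * k) := fun k =>
    Real.Gamma_pos_of_pos (by simpa using laguerre_exponent_pos hα hθ 0 k)
  have hθi : θ⁻¹ ≠ 0 := inv_ne_zero hθ.ne'
  set E : ℕ → Polynomial ℝ := fun l =>
    Polynomial.C θ⁻¹ * Polynomial.X + Polynomial.C (-((α + 1) / θ) - l) with hE
  have hE0 : ∀ l, E l ≠ 0 := fun l h0 => by
    have := Polynomial.natDegree_linear (R := ℝ) (b := -((α + 1) / θ) - l) hθi
    rw [show Polynomial.C θ⁻¹ * Polynomial.X + Polynomial.C (-((α + 1) / θ) - l) = E l from rfl, h0] at this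
    simp at this
  set c : ℕ → ℝ := fun j => ((j.factorial : ℝ) * Real.Gamma (α + 1 + θ * j))⁻¹ with hc
  have hc0 : ∀ j, 0 < c j := fun j => by
    have := hΓ j
    positivity
  set L : ℕ → Polynomial ℝ := fun j => Polynomial.C (c j) * ∏ l ∈ Finset.range j, E l with hL
  have hprod : ∀ j, ∏ l ∈ Finset.range j, E l ≠ 0 := fun j => Finset.prod_ne_zero_iff.2 fun l _ => hE0 l
  have hL0 : ∀ j, L j ≠ 0 := fun j =>
    mul_ne_zero (Polynomial.C_ne_zero.2 (hc0 j).ne') (hprod j)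
  have hLdeg : ∀ j, (L j).natDegree = j := fun j => by
    rw [hL]
    simp only
    rw [Polynomial.natDegree_C_mul (hc0 j).ne', Polynomial.natDegree_prod _ _ fun l _ => hE0 l,
      Finset.sum_congr rfl fun l _ => Polynomial.natDegree_linear hθi]
    simp
  have hLlc : ∀ j, 0 < (L j).leadingCoeff := fun j => by
    rw [hL]
    simp only
    rw [Polynomial.leadingCoeff_mul, Polynomial.leadingCoeff_C, Polynomial.leadingCoeff_prod,
      Finset.prod_congr rfl fun l _ => Polynomial.leadingCoeff_linear hθi, Finset.prod_const]
    exact mul_pos (hc0 j) (by positivity)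
  have hLeval : ∀ j z, (L j).eval z = (∏ l ∈ Finset.range j, ((z - (α + 1)) / θ - l))
        / (j.factorial * Real.Gamma (α + 1 + θ * j)) := fun j z => by
    rw [hL]
    simp only
    rw [Polynomial.eval_mul, Polynomial.eval_C, Polynomial.eval_prod, div_eq_inv_mul]
    refine congrArg (c j * ·) (Finset.prod_congr rfl fun l _ => ?_)
    rw [hE]
    simp
    ring
  choose p hp1 hp2 hp3 using fun j => exists_risingEval_eq (L j) (hL0 j)
  set b : ℕ → ℕ → ℝ := fun k i => (-1 : ℝ) ^ (k + i) * k.choose i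
        * (Real.Gamma (α + 1 + θ * k) / Real.Gamma (α + 1 + θ * i)) with hb
  set q : ℕ → Polynomial ℝ := fun k => ∑ i ∈ Finset.range (k + 1), Polynomial.monomial i (b k i) with hq
  have hqcoeff : ∀ k i, (q k).coeff i = if i ∈ Finset.range (k + 1) then b k i else 0 := fun k i => by
    rw [hq]
    simp only [Polynomial.finsetSum_coeff, Polynomial.coeff_monomial]
    rw [Finset.sum_ite_eq']
  have hbk : ∀ k, b k k = 1 := fun k => by
    rw [hb]
    simp only [Nat.choose_self, Nat.cast_one, mul_one]
    rw [div_self (hΓ k).ne', ← two_mul, pow_mul]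
    simp
  have hqdeg : ∀ k, (q k).natDegree = k := fun k => by
    refine Polynomial.natDegree_eq_of_le_of_coeff_ne_zero ?_ ?_
    · rw [Polynomial.natDegree_le_iff_coeff_eq_zero]
      intro m hm
      rw [hqcoeff, if_neg (by rw [Finset.mem_range]; omega)]
    · rw [hqcoeff, if_pos (by rw [Finset.mem_range]; omega), hbk]
      exact one_ne_zero
  refine ⟨p, q, ⟨fun j => (hp1 j).trans (hLdeg j), fun j => ?_, hqdeg, fun k => ?_, fun j k => ?_⟩,
    fun j z => (hp3 j z).trans (hLeval j z), fun k y => ?_⟩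
  · rw [hp2]
    exact hLlc j
  · rw [Polynomial.Monic, Polynomial.leadingCoeff, hqdeg, hqcoeff,
      if_pos (by rw [Finset.mem_range]; omega), hbk]
  · have h1 := laguerrePairing_eq hα hθ (p j) (q k)
    rw [Polynomial.sum_over_range' _ (by simp) (k + 1) (by rw [hqdeg]; omega)] at h1
    rw [laguerrePairing] at h1
    rw [h1]
    -- At z = α + 1 + θi the product is the falling factorial of the integer i, so the transform of
    -- p_j becomes a binomial coefficient and the Gamma factors depending on i cancel.
    have hterm : ∀ i ∈ Finset.range (k + 1), (q k).coeff i
        * (Real.Gamma (α + 1 + θ * i) * risingEval (p j) (α + 1 + θ * i))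
        = Real.Gamma (α + 1 + θ * k) / Real.Gamma (α + 1 + θ * j)
          * ((-1 : ℝ) ^ (k + i) * k.choose i * i.choose j) := by
      intro i hi
      have hdf : ∏ l ∈ Finset.range j, ((α + 1 + θ * i - (α + 1)) / θ - l)
          = j.factorial * i.choose j := by
        have e : (α + 1 + θ * i - (α + 1)) / θ = i := by
          field_simp
          ring
        rw [e, ← Nat.cast_mul, ← Nat.descFactorial_eq_factorial_mul_choose,
          ← descPochhammer_eval_eq_descFactorial ℝ, descPochhammer_eval_eq_prod_range]
      rw [hqcoeff, if_pos hi, hp3, hLeval, hdf, hb]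
      have := (hΓ i).ne'
      have := (hΓ j).ne'
      have : (j.factorial : ℝ) ≠ 0 := by exact_mod_cast j.factorial_ne_zero
      field_simp
    rw [Finset.sum_congr rfl hterm, ← Finset.mul_sum, sum_neg_one_pow_mul_choose_mul_choose]
    split_ifs with hjk
    · rw [hjk, div_self (hΓ k).ne', mul_one]
    · rw [mul_zero]
  · rw [hq]
    simp only [Polynomial.eval_finsetSum, Polynomial.eval_monomial, hb]

theorem existsUnique_isLaguerreBiorthogonal (hα : -1 < α) (hθ : 0 < θ) :
    ∃! P : (ℕ → Polynomial ℝ) × (ℕ → Polynomial ℝ), IsLaguerreBiorthogonal α θ P.1 P.2 := by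
  obtain ⟨p, q, h, -⟩ := exists_isLaguerreBiorthogonal hα hθ
  refine ⟨(p, q), h, fun P hP => ?_⟩
  have e2 : P.2 = q := hP.right_unique h hα hθ
  refine Prod.ext ?_ e2
  have hP' : IsLaguerreBiorthogonal α θ P.1 P.2 := hP
  rw [e2] at hP'
  exact hP'.left_unique h hα hθ

end

/-! ### Power series of the finite kernel -/

/-- Here (-m)_i is (-1)^i times the falling factorial of m: it kills the terms m < i and turns the
rest into the exponential series shifted by i. -/
theorem hasSum_exp_neg_mul_pow (x : ℝ) (i : ℕ) :
    HasSum (fun m : ℕ => (-x) ^ m / m.factorial * (ascPochhammer ℝ i).eval (-(m : ℝ)))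
      (Real.exp (-x) * x ^ i) := by
  have h0 : HasSum (fun m : ℕ => (-x) ^ m / m.factorial) (Real.exp (-x)) := by
    rw [Real.exp_eq_exp_ℝ]
    exact NormedSpace.expSeries_div_hasSum_exp (-x)
  have h1 := h0.mul_right (x ^ i)
  have hz : ∀ m : ℕ, m ∉ range (fun m => m + i) →
      (-x) ^ m / m.factorial * (ascPochhammer ℝ i).eval (-(m : ℝ)) = 0 := by
    intro m hm
    have hlt : m < i := by
      by_contra hge
      exact hm ⟨m - i, by simp only; omega⟩
    rw [ascPochhammer_eval_neg_eq_descPochhammer, descPochhammer_eval_eq_descFactorial,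
      Nat.descFactorial_of_lt hlt]
    simp
  rw [← Function.Injective.hasSum_iff (add_left_injective i) hz]
  refine (congrArg (HasSum · _) (funext fun m => ?_)).mp h1
  simp only [Function.comp]
  have hf := Nat.factorial_mul_descFactorial (n := m + i) (k := i) (by omega)
  rw [Nat.add_sub_cancel] at hf
  have hf' : ((m + i).factorial : ℝ) = m.factorial * (m + i).descFactorial i := by exact_mod_cast hf.symm
  have hne : ((m + i).factorial : ℝ) ≠ 0 := by exact_mod_cast (m + i).factorial_ne_zero
  have hm : (m.factorial : ℝ) ≠ 0 := by exact_mod_cast m.factorial_ne_zero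
  have hd : ((m + i).descFactorial i : ℝ) ≠ 0 := by
    rw [hf'] at hne
    exact right_ne_zero_of_mul hne
  rw [ascPochhammer_eval_neg_eq_descPochhammer, descPochhammer_eval_eq_descFactorial, hf', pow_add,
    neg_pow x i]
  have hs : ((-1 : ℝ) ^ i) * (-1) ^ i = 1 := by rw [← mul_pow]; simp
  field_simp
  rw [sq, mul_assoc ((-x) ^ m), hs, mul_one]

/-- Power series expansion of `e^{-x} P(x)` in terms of rising factorials at the nonpositive integers. -/
theorem hasSum_exp_neg_mul_eval (P : Polynomial ℝ) (x : ℝ) :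
    HasSum (fun m : ℕ => (-x) ^ m / m.factorial * risingEval P (-(m : ℝ))) (Real.exp (-x) * P.eval x) := by
  have h := hasSum_sum (f := fun (i m : ℕ) => P.coeff i
    * ((-x) ^ m / m.factorial * (ascPochhammer ℝ i).eval (-(m : ℝ)))) (s := P.support)
    fun i _ => (hasSum_exp_neg_mul_pow x i).mul_left (P.coeff i)
  have e : ∑ i ∈ P.support, P.coeff i * (Real.exp (-x) * x ^ i) = Real.exp (-x) * P.eval x := by
    rw [Polynomial.eval_eq_sum, Polynomial.sum_def, Finset.mul_sum]
    exact Finset.sum_congr rfl fun i _ => by ring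
  rw [e] at h
  refine (congrArg (HasSum · _) (funext fun m => ?_)).mp h
  rw [risingEval, Polynomial.sum_def, Finset.mul_sum]
  exact Finset.sum_congr rfl fun i _ => by ring

/-- Induction on n: the right side is 0 at n = 0, and its increments are the summands. This performs
the summation over the degree j in closed form. -/
theorem sum_ascPochhammer_mul_choose {a : ℝ} (i n : ℕ) (ha : a + i ≠ 0) :
    ∑ j ∈ Finset.range n, (ascPochhammer ℝ j).eval a / j.factorial * j.choose i
      = (ascPochhammer ℝ n).eval a * n.descFactorial (i + 1) / (n.factorial * i.factorial * (a + i)) := by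
  induction n with
  | zero => simp
  | succ n ih =>
    have h1 : ((n.descFactorial (i + 1) : ℕ) : ℝ) = (n - i) * n.descFactorial i := by
      rw [Nat.descFactorial_succ]
      rcases le_or_gt i n with h | h
      · rw [Nat.cast_mul, Nat.cast_sub h]
      · rw [Nat.descFactorial_of_lt h]
        simp
    have h2 : (((n + 1).descFactorial (i + 1) : ℕ) : ℝ) = (n + 1) * n.descFactorial i := by
      rw [Nat.succ_descFactorial_succ]
      push_cast
      ring
    have h3 : ((n.descFactorial i : ℕ) : ℝ) = i.factorial * n.choose i := by
      rw [Nat.descFactorial_eq_factorial_mul_choose]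
      push_cast
      ring
    have hn : (n.factorial : ℝ) ≠ 0 := by exact_mod_cast n.factorial_ne_zero
    have hi : (i.factorial : ℝ) ≠ 0 := by exact_mod_cast i.factorial_ne_zero
    have hn1 : (n : ℝ) + 1 ≠ 0 := by positivity
    rw [Finset.sum_range_succ, ih, h1, h2, h3, ascPochhammer_succ_eval, Nat.factorial_succ]
    push_cast
    field_simp
    ring

section
variable {α θ : ℝ}

/-- The sign (-1)^j and the factor Γ(α+1+θj) cancel between the two polynomials. As C(j, i) = 0 for
i > j, the range of i can be taken independent of j, so that the sums over i and j can be
interchanged. -/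
theorem risingEval_mul_eval_eq {p q : ℕ → Polynomial ℝ} (hα : -1 < α) (hθ : 0 < θ)
    (hp : ∀ j z, risingEval (p j) z = (∏ l ∈ Finset.range j, ((z - (α + 1)) / θ - l))
        / (j.factorial * Real.Gamma (α + 1 + θ * j)))
    (hq : ∀ k y, (q k).eval y = ∑ i ∈ Finset.range (k + 1), (-1 : ℝ) ^ (k + i) * k.choose i
        * (Real.Gamma (α + 1 + θ * k) / Real.Gamma (α + 1 + θ * i)) * y ^ i) {j n : ℕ} (hjn : j < n)
    (m : ℕ) (y : ℝ) :
    risingEval (p j) (-(m : ℝ)) * (q j).eval y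
      = ∑ i ∈ Finset.range n, (-y) ^ i / Real.Gamma (α + 1 + θ * i)
        * ((ascPochhammer ℝ j).eval ((α + 1 + m) / θ) / j.factorial * j.choose i) := by
  have hΓ : ∀ k : ℕ, Real.Gamma (α + 1 + θ * k) ≠ 0 := fun k =>
    (Real.Gamma_pos_of_pos (by simpa using laguerre_exponent_pos hα hθ 0 k)).ne'
  have hprod : ∏ l ∈ Finset.range j, ((-(m : ℝ) - (α + 1)) / θ - l)
      = (-1) ^ j * (ascPochhammer ℝ j).eval ((α + 1 + m) / θ) := by
    rw [← descPochhammer_eval_eq_prod_range,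
      show (-(m : ℝ) - (α + 1)) / θ = -((α + 1 + m) / θ) by ring]
    have h := ascPochhammer_eval_neg_eq_descPochhammer ℝ (-((α + 1 + m) / θ)) j
    rw [neg_neg] at h
    rw [h, ← mul_assoc, ← mul_pow]
    simp
  rw [hp, hq, hprod, Finset.mul_sum]
  have hsub : Finset.range (j + 1) ⊆ Finset.range n := Finset.range_subset_range.2 hjn
  rw [← Finset.sum_subset hsub]
  · refine Finset.sum_congr rfl fun i _ => ?_
    have h1 := hΓ j
    have h2 := hΓ i
    have h3 : (j.factorial : ℝ) ≠ 0 := by exact_mod_cast j.factorial_ne_zero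
    have hs : ((-1 : ℝ) ^ j) * (-1) ^ j = 1 := by rw [← mul_pow]; simp
    rw [neg_pow y, pow_add]
    field_simp
    rw [sq, hs, one_mul]
  · intro i _ hi
    rw [Finset.mem_range, not_lt] at hi
    rw [Nat.choose_eq_zero_of_lt (by omega)]
    simp

/-- The coefficients of the power series expansion of the kernel `K_n`. -/
noncomputable def kernelWeight (n : ℕ) (a : ℝ) (i : ℕ) : ℝ :=
  (ascPochhammer ℝ n).eval a * n.descFactorial (i + 1) / n.factorial

/-- The common factors of the series of `K_n` and of the hard edge kernel, in `X = x`, `Y = y ^ θ`. -/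
noncomputable def kernelMonomial (α θ X Y : ℝ) (i : ℕ × ℕ) : ℝ :=
  (-X) ^ i.1 / i.1.factorial * ((-Y) ^ i.2
    / (i.2.factorial * Real.Gamma (α + 1 + θ * i.2) * ((α + 1 + i.1) / θ + i.2)))

theorem hasSum_biorthogonalKernel {p q : ℕ → Polynomial ℝ} (hα : -1 < α) (hθ : 0 < θ)
    (hp : ∀ j z, risingEval (p j) z = (∏ l ∈ Finset.range j, ((z - (α + 1)) / θ - l))
        / (j.factorial * Real.Gamma (α + 1 + θ * j)))
    (hq : ∀ k y, (q k).eval y = ∑ i ∈ Finset.range (k + 1), (-1 : ℝ) ^ (k + i) * k.choose i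
        * (Real.Gamma (α + 1 + θ * k) / Real.Gamma (α + 1 + θ * i)) * y ^ i) (n : ℕ) (x y : ℝ) :
    HasSum (fun m : ℕ => x ^ α * ∑ i ∈ Finset.range n,
        kernelWeight n ((α + 1 + m) / θ) i * kernelMonomial α θ x (y ^ θ) (m, i))
      (biorthogonalKernel α θ p q n x y) := by
  have h := hasSum_sum (s := Finset.range n) (f := fun (j m : ℕ) => x ^ α * (q j).eval (y ^ θ)
      * ((-x) ^ m / m.factorial * risingEval (p j) (-(m : ℝ))))
    fun j _ => (hasSum_exp_neg_mul_eval (p j) x).mul_left (x ^ α * (q j).eval (y ^ θ))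
  have e : ∑ j ∈ Finset.range n, x ^ α * (q j).eval (y ^ θ) * (Real.exp (-x) * (p j).eval x)
      = biorthogonalKernel α θ p q n x y := by
    rw [biorthogonalKernel]
    exact Finset.sum_congr rfl fun j _ => by ring
  rw [e] at h
  refine (congrArg (HasSum · _) (funext fun m => ?_)).mp h
  calc _ = x ^ α * ((-x) ^ m / m.factorial
        * ∑ j ∈ Finset.range n, risingEval (p j) (-(m : ℝ)) * (q j).eval (y ^ θ)) := by
        rw [Finset.mul_sum, Finset.mul_sum]
        exact Finset.sum_congr rfl fun j _ => by ring
    _ = x ^ α * ((-x) ^ m / m.factorial * ∑ i ∈ Finset.range n, (-(y ^ θ)) ^ i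
          / Real.Gamma (α + 1 + θ * i) * ∑ j ∈ Finset.range n,
          (ascPochhammer ℝ j).eval ((α + 1 + m) / θ) / j.factorial * j.choose i) := by
        rw [Finset.sum_congr rfl fun j hj =>
          risingEval_mul_eval_eq hα hθ hp hq (Finset.mem_range.1 hj) m (y ^ θ), Finset.sum_comm]
        simp only [Finset.mul_sum]
    _ = _ := by
        rw [Finset.mul_sum]
        refine congrArg (x ^ α * ·) (Finset.sum_congr rfl fun i _ => ?_)
        have ha : (α + 1 + m) / θ + i ≠ 0 := by
          have : 0 < α + 1 := by linarith
          positivity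
        rw [sum_ascPochhammer_mul_choose i n ha, kernelWeight, kernelMonomial]
        simp only
        have hΓ : Real.Gamma (α + 1 + θ * i) ≠ 0 :=
          (Real.Gamma_pos_of_pos (by simpa using laguerre_exponent_pos hα hθ 0 i)).ne'
        have hn : (n.factorial : ℝ) ≠ 0 := by exact_mod_cast n.factorial_ne_zero
        have hi : (i.factorial : ℝ) ≠ 0 := by exact_mod_cast i.factorial_ne_zero
        have hm : (m.factorial : ℝ) ≠ 0 := by exact_mod_cast m.factorial_ne_zero
        generalize (α + 1 + m) / θ + (i : ℝ) = b at *
        generalize (α + 1 + m) / θ = a at *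
        field_simp

/-! ### The scaling limit -/

/-- The weight `n^{-a} (a)_n n^{\underline{i+1}} / (n! n^i)` of the rescaled kernel. -/
noncomputable def scaledWeight (n : ℕ) (a : ℝ) (i : ℕ) : ℝ :=
  (ascPochhammer ℝ n).eval a / (n : ℝ) ^ a * (n / n.factorial) * (n.descFactorial (i + 1) / (n : ℝ) ^ (i + 1))

theorem ascPochhammer_eval_eq_prod (a : ℝ) (n : ℕ) :
    (ascPochhammer ℝ n).eval a = ∏ j ∈ Finset.range n, (a + j) := by
  induction n with
  | zero => simp
  | succ n ih => rw [ascPochhammer_succ_eval, ih, Finset.prod_range_succ]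

/-- Factor out (j + 1) from a + j + 1 and use 1 + a/(j+1) ≤ e^{a/(j+1)}; the exponents add up to a
harmonic number. -/
theorem ascPochhammer_succ_le {a : ℝ} (ha : 0 < a) (n : ℕ) :
    (ascPochhammer ℝ (n + 1)).eval a ≤ a * n.factorial * Real.exp (a * harmonic n) := by
  induction n with
  | zero => simp
  | succ n ih =>
    rw [ascPochhammer_succ_eval, harmonic_succ, Nat.factorial_succ]
    push_cast
    have h1 : (1 : ℝ) + a * (n + 1 : ℝ)⁻¹ ≤ Real.exp (a * (n + 1 : ℝ)⁻¹) := by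
      have := Real.add_one_le_exp (a * (n + 1 : ℝ)⁻¹)
      linarith
    have hn1 : (n : ℝ) + 1 ≠ 0 := by positivity
    calc _ ≤ a * n.factorial * Real.exp (a * harmonic n) * (a + (n + 1)) := by gcongr
      _ = a * n.factorial * Real.exp (a * harmonic n) * ((n + 1) * (1 + a * (n + 1 : ℝ)⁻¹)) := by
          field_simp
          ring
      _ ≤ a * n.factorial * Real.exp (a * harmonic n) * ((n + 1) * Real.exp (a * (n + 1 : ℝ)⁻¹)) := by
          gcongr
      _ = _ := by
          rw [mul_add, Real.exp_add]
          ring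

/-- One factor e^a comes from H_k ≤ 1 + log(k + 1), the other from a ≤ e^a. Exponential growth in a
is harmless: a is affine in the index m, and 1/m! is available. -/
theorem ascPochhammer_div_le {a : ℝ} (ha : 0 < a) {n : ℕ} (hn : n ≠ 0) :
    (ascPochhammer ℝ n).eval a / (n : ℝ) ^ a * (n / n.factorial) ≤ Real.exp (2 * a) := by
  obtain ⟨k, rfl⟩ := Nat.exists_eq_succ_of_ne_zero hn
  have hk : (0 : ℝ) < ((k + 1 : ℕ) : ℝ) := by positivity
  have h1 := ascPochhammer_succ_le ha k
  have h2 : (harmonic k : ℝ) ≤ 1 + Real.log (k + 1 : ℕ) := by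
    refine (harmonic_le_one_add_log k).trans ?_
    rcases Nat.eq_zero_or_pos k with rfl | hpos
    · simp
    · have : (0 : ℝ) < k := by exact_mod_cast hpos
      gcongr
      simp
  have h3 : Real.exp (a * harmonic k) ≤ Real.exp a * ((k + 1 : ℕ) : ℝ) ^ a := by
    rw [Real.rpow_def_of_pos hk, ← Real.exp_add]
    refine Real.exp_le_exp.2 ?_
    nlinarith
  have h4 : a ≤ Real.exp a := by linarith [Real.add_one_le_exp a]
  have hf : (k.factorial : ℝ) ≠ 0 := by exact_mod_cast k.factorial_ne_zero
  have hpow : 0 < ((k + 1 : ℕ) : ℝ) ^ a := Real.rpow_pos_of_pos hk a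
  calc (ascPochhammer ℝ (k + 1)).eval a / ((k + 1 : ℕ) : ℝ) ^ a * (((k + 1 : ℕ) : ℝ) / (k + 1).factorial)
      ≤ Real.exp a * k.factorial * (Real.exp a * ((k + 1 : ℕ) : ℝ) ^ a) / ((k + 1 : ℕ) : ℝ) ^ a
        * (((k + 1 : ℕ) : ℝ) / (k + 1).factorial) := by
        gcongr
        exact h1.trans (by gcongr)
    _ = Real.exp (2 * a) := by
        rw [two_mul, Real.exp_add, Nat.factorial_succ]
        push_cast at hk hpow ⊢
        field_simp

/-- This is Euler's limit formula inverted; Euler's product has the additional factor a + n,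
compensated by n/(n + a) → 1. -/
theorem tendsto_ascPochhammer_div {a : ℝ} (ha : 0 < a) :
    Tendsto (fun n : ℕ => (ascPochhammer ℝ n).eval a / (n : ℝ) ^ a * (n / n.factorial)) atTop
      (𝓝 (Real.Gamma a)⁻¹) := by
  have h1 := (Real.GammaSeq_tendsto_Gamma a).inv₀ (Real.Gamma_pos_of_pos ha).ne'
  have h2 : Tendsto (fun n : ℕ => (n : ℝ) / (n + a)) atTop (𝓝 1) := tendsto_natCast_div_add_atTop a
  have h3 := h1.mul h2
  rw [mul_one] at h3
  refine h3.congr' ?_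
  filter_upwards [eventually_ne_atTop 0] with n hn
  have hn0 : (0 : ℝ) < n := by positivity
  have hprod : ∏ j ∈ Finset.range (n + 1), (a + (j : ℝ)) = (ascPochhammer ℝ n).eval a * (a + n) := by
    rw [← ascPochhammer_succ_eval, ascPochhammer_eval_eq_prod]
  have hpow : 0 < (n : ℝ) ^ a := Real.rpow_pos_of_pos hn0 a
  have hf : (n.factorial : ℝ) ≠ 0 := by exact_mod_cast n.factorial_ne_zero
  rw [Real.GammaSeq, hprod, inv_div]
  field_simp
  ring

theorem descFactorial_div_pow_le_one (n k : ℕ) : (n.descFactorial k : ℝ) / (n : ℝ) ^ k ≤ 1 := by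
  refine div_le_one_of_le₀ ?_ (by positivity)
  exact_mod_cast Nat.descFactorial_le_pow n k

theorem tendsto_descFactorial_div_pow (k : ℕ) :
    Tendsto (fun n : ℕ => (n.descFactorial k : ℝ) / (n : ℝ) ^ k) atTop (𝓝 1) := by
  induction k with
  | zero => simp
  | succ k ih =>
    have h1 : Tendsto (fun n : ℕ => 1 - (k : ℝ) / n) atTop (𝓝 1) := by
      simpa using (tendsto_const_div_atTop_nhds_zero_nat (k : ℝ)).const_sub 1
    have h2 := h1.mul ih
    rw [mul_one] at h2
    refine h2.congr' ?_
    filter_upwards [eventually_ge_atTop (k + 1)] with n hn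
    have hn0 : (0 : ℝ) < n := by
      have : 0 < n := by omega
      exact_mod_cast this
    rw [Nat.descFactorial_succ, Nat.cast_mul, Nat.cast_sub (by omega)]
    field_simp
    ring

theorem norm_scaledWeight_le {a : ℝ} (ha : 0 < a) {n : ℕ} (hn : n ≠ 0) (i : ℕ) :
    ‖scaledWeight n a i‖ ≤ Real.exp (2 * a) := by
  have hp : 0 ≤ (ascPochhammer ℝ n).eval a := by
    rw [ascPochhammer_eval_eq_prod]
    exact Finset.prod_nonneg fun j _ => by positivity
  rw [Real.norm_of_nonneg (by unfold scaledWeight; positivity), scaledWeight]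
  exact (mul_le_of_le_one_right (by positivity) (descFactorial_div_pow_le_one n _)).trans
    (ascPochhammer_div_le ha hn)

theorem tendsto_scaledWeight {a : ℝ} (ha : 0 < a) (i : ℕ) :
    Tendsto (fun n => scaledWeight n a i) atTop (𝓝 (Real.Gamma a)⁻¹) := by
  have h := (tendsto_ascPochhammer_div ha).mul (tendsto_descFactorial_div_pow (i + 1))
  rw [mul_one] at h
  exact h

theorem abs_kernelMonomial_le (hα : -1 < α) (hθ : 0 < θ) {X Y R : ℝ} (hX : |X| ≤ R) (hY : |Y| ≤ R)
    (i : ℕ × ℕ) : ‖kernelMonomial α θ X Y i‖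
      ≤ Real.exp 1 * (θ / (α + 1)) * (R ^ i.1 / i.1.factorial * (R ^ i.2 / i.2.factorial)) := by
  have hα' : 0 < α + 1 := by linarith
  have hR : 0 ≤ R := (abs_nonneg X).trans hX
  have hΓ := exp_neg_one_le_Gamma (x := α + 1 + θ * i.2) (by simpa using laguerre_exponent_pos hα hθ 0 i.2)
  have hd : (α + 1) / θ ≤ (α + 1 + i.1) / θ + i.2 := by
    have : (α + 1) / θ ≤ (α + 1 + i.1) / θ := by
      have : (0 : ℝ) ≤ i.1 := by positivity
      exact div_le_div_of_nonneg_right (by linarith) hθ.le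
    have : (0 : ℝ) ≤ i.2 := by positivity
    linarith
  have hΓ0 : 0 < Real.Gamma (α + 1 + θ * i.2) := lt_of_lt_of_le (Real.exp_pos _) hΓ
  have hd0 : 0 < (α + 1 + i.1) / θ + i.2 := lt_of_lt_of_le (by positivity) hd
  rw [kernelMonomial, norm_mul, norm_div, norm_div, norm_pow, norm_pow, norm_neg, norm_neg,
    Real.norm_natCast, Real.norm_of_nonneg
    (show 0 ≤ (i.2.factorial : ℝ) * Real.Gamma (α + 1 + θ * i.2) * ((α + 1 + i.1) / θ + i.2) by positivity)]
  calc _ ≤ R ^ i.1 / i.1.factorial * (R ^ i.2 / (i.2.factorial * Real.exp (-1) * ((α + 1) / θ))) := by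
        gcongr
        · exact hX
        · exact hY
    _ = _ := by
        rw [Real.exp_neg]
        field_simp

/-- The rescaled kernel as a double series. -/
theorem scaled_biorthogonalKernel_eq {p q : ℕ → Polynomial ℝ} (hα : -1 < α) (hθ : 0 < θ)
    (hp : ∀ j z, risingEval (p j) z = (∏ l ∈ Finset.range j, ((z - (α + 1)) / θ - l))
        / (j.factorial * Real.Gamma (α + 1 + θ * j)))
    (hq : ∀ k y, (q k).eval y = ∑ i ∈ Finset.range (k + 1), (-1 : ℝ) ^ (k + i) * k.choose i
        * (Real.Gamma (α + 1 + θ * k) / Real.Gamma (α + 1 + θ * i)) * y ^ i) {n : ℕ} (hn : n ≠ 0)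
    {x y : ℝ} (hx : 0 < x) (hy : 0 < y)
    (hs : Summable fun i : ℕ × ℕ => scaledWeight n ((α + 1 + i.1) / θ) i.2 * kernelMonomial α θ x (y ^ θ) i) :
    biorthogonalKernel α θ p q n (x / (n : ℝ) ^ (1 / θ)) (y / (n : ℝ) ^ (1 / θ)) / (n : ℝ) ^ (1 / θ)
      = x ^ α * ∑' i : ℕ × ℕ, scaledWeight n ((α + 1 + i.1) / θ) i.2 * kernelMonomial α θ x (y ^ θ) i := by
  have hn0 : (0 : ℝ) < n := by positivity
  have hN : 0 < (n : ℝ) ^ (1 / θ) := Real.rpow_pos_of_pos hn0 _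
  have h1 := (hasSum_biorthogonalKernel hα hθ hp hq n (x / (n : ℝ) ^ (1 / θ))
    (y / (n : ℝ) ^ (1 / θ))).div_const ((n : ℝ) ^ (1 / θ))
  -- Terms with i ≥ n vanish with the falling factorial of order i + 1, so the full double series
  -- has the finite inner sums of K_n.
  have h2 := (hs.hasSum.mul_left (x ^ α)).prod_fiberwise (g := fun m : ℕ => x ^ α * ∑ i ∈ Finset.range n,
      scaledWeight n ((α + 1 + m) / θ) i * kernelMonomial α θ x (y ^ θ) (m, i)) fun m => by
    refine HasSum.mul_left _ (hasSum_sum_of_ne_finset_zero fun i hi => ?_)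
    rw [Finset.mem_range, not_lt] at hi
    simp only
    rw [scaledWeight, Nat.descFactorial_of_lt (by omega)]
    simp
  refine h1.unique ?_
  refine (congrArg (HasSum · _) (funext fun m => ?_)).mp h2
  have hYpow : (y / (n : ℝ) ^ (1 / θ)) ^ θ = y ^ θ / n := by
    rw [Real.div_rpow hy.le hN.le, ← Real.rpow_mul hn0.le, one_div_mul_cancel hθ.ne', Real.rpow_one]
  rw [hYpow, Real.div_rpow hx.le hN.le, Finset.mul_sum, Finset.mul_sum, Finset.sum_div]
  refine Finset.sum_congr rfl fun i _ => ?_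
  -- With N = n^{1/θ} and a = (α+1+m)/θ, n^a = N^α · N · N^m collects the scalings of x^α, of the
  -- prefactor and of x^m; the powers n^i come from (y/N)^θ = y^θ/n.
  have hsplit : (n : ℝ) ^ ((α + 1 + m) / θ)
      = ((n : ℝ) ^ (1 / θ)) ^ α * (n : ℝ) ^ (1 / θ) * ((n : ℝ) ^ (1 / θ)) ^ m := by
    rw [← Real.rpow_mul hn0.le, ← Real.rpow_natCast ((n : ℝ) ^ (1 / θ)), ← Real.rpow_mul hn0.le,
      ← Real.rpow_add hn0, ← Real.rpow_add hn0]
    congr 1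
    ring
  have hNa : 0 < ((n : ℝ) ^ (1 / θ)) ^ α := Real.rpow_pos_of_pos hN _
  rw [scaledWeight, kernelWeight, kernelMonomial, kernelMonomial, hsplit]
  simp only
  rw [← neg_div, ← neg_div, div_pow, div_pow, pow_succ]
  generalize (n : ℝ) ^ (1 / θ) = N at *
  generalize N ^ α = Na at *
  field_simp

theorem hardEdgeKernel_eq_tsum (hα : -1 < α) (hθ : 0 < θ) (x y : ℝ) :
    hardEdgeKernel α θ x y = x ^ α * ∑' i : ℕ × ℕ,
      (Real.Gamma ((α + 1 + i.1) / θ))⁻¹ * kernelMonomial α θ x (y ^ θ) i := by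
  rw [hardEdgeKernel, mul_comm θ, mul_assoc, ← tsum_mul_left]
  congr 1
  refine tsum_congr fun i => ?_
  have h1 : (α + 1) / θ + 1 / θ * i.1 = (α + 1 + i.1) / θ := by ring
  have h2 : 0 < α + 1 + i.1 + θ * i.2 := by
    have := laguerre_exponent_pos hα hθ i.1 i.2
    linarith
  have h3 : (α + 1 + i.1) / θ + i.2 = (α + 1 + i.1 + θ * i.2) / θ := by
    field_simp
  rw [kernelTerm, kernelMonomial, wrightBesselTerm, wrightBesselTerm, h1, h3]
  field_simp

/-- The scaling limit at the hard edge, uniformly on compact sets. -/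
theorem tendstoUniformlyOn_scaled_biorthogonalKernel {p q : ℕ → Polynomial ℝ} (hα : -1 < α) (hθ : 0 < θ)
    (hp : ∀ j z, risingEval (p j) z = (∏ l ∈ Finset.range j, ((z - (α + 1)) / θ - l))
        / (j.factorial * Real.Gamma (α + 1 + θ * j)))
    (hq : ∀ k y, (q k).eval y = ∑ i ∈ Finset.range (k + 1), (-1 : ℝ) ^ (k + i) * k.choose i
        * (Real.Gamma (α + 1 + θ * k) / Real.Gamma (α + 1 + θ * i)) * y ^ i)
    {S : Set ℝ} (hS : IsCompact S) (hS0 : S ⊆ Ioi 0) :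
    TendstoUniformlyOn (fun (n : ℕ) (z : ℝ × ℝ) =>
        biorthogonalKernel α θ p q n (z.1 / (n : ℝ) ^ (1 / θ)) (z.2 / (n : ℝ) ^ (1 / θ)) / (n : ℝ) ^ (1 / θ))
      (fun z => hardEdgeKernel α θ z.1 z.2) atTop (S ×ˢ S) := by
  have hα' : 0 < α + 1 := by linarith
  obtain ⟨R₁, hR₁⟩ := hS.bddAbove
  obtain ⟨R₂, hR₂⟩ := (hS.image_of_continuousOn (f := fun x : ℝ => x ^ θ) fun x hx =>
    (Real.continuousAt_rpow_const x θ (Or.inr hθ.le)).continuousWithinAt).bddAbove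
  -- If α < 0, x^α is bounded on `S` only because `S` stays away from 0.
  obtain ⟨M, hM⟩ := (hS.image_of_continuousOn (f := fun x : ℝ => x ^ α) fun x hx =>
    (Real.continuousAt_rpow_const x α (Or.inl (ne_of_gt (hS0 hx)))).continuousWithinAt).bddAbove
  set R := max R₁ R₂ with hR
  set k : ℕ × ℕ → ℝ := fun i =>
    Real.exp 1 * (θ / (α + 1)) * (R ^ i.1 / i.1.factorial * (R ^ i.2 / i.2.factorial)) with hk
  have hmono : ∀ z ∈ S ×ˢ S, ∀ i, ‖kernelMonomial α θ z.1 (z.2 ^ θ) i‖ ≤ k i := by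
    intro z hz i
    refine abs_kernelMonomial_le hα hθ ?_ ?_ i
    · rw [abs_of_pos (hS0 hz.1)]
      exact (hR₁ hz.1).trans (le_max_left _ _)
    · rw [abs_of_pos (Real.rpow_pos_of_pos (hS0 hz.2) _)]
      exact (hR₂ ⟨z.2, hz.2, rfl⟩).trans (le_max_right _ _)
  set w : ℕ × ℕ → ℝ := fun i => Real.exp (2 * ((α + 1 + i.1) / θ)) with hw
  have ha : ∀ i : ℕ × ℕ, 0 < (α + 1 + i.1) / θ := fun i => by positivity
  have hWle : ∀ n ≠ 0, ∀ i : ℕ × ℕ, ‖scaledWeight n ((α + 1 + i.1) / θ) i.2‖ ≤ w i := fun n hn i =>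
    norm_scaledWeight_le (ha i) hn i.2
  -- The limit of the weights inherits their bound.
  have hGle : ∀ i : ℕ × ℕ, ‖(Real.Gamma ((α + 1 + i.1) / θ))⁻¹‖ ≤ w i := fun i => by
    refine le_of_tendsto (tendsto_scaledWeight (ha i) i.2).norm ?_
    filter_upwards [eventually_ne_atTop 0] with n hn using hWle n hn i
  have hk' : ∀ i, 0 ≤ |k i| := fun i => abs_nonneg _
  have hwk : Summable fun i => w i * |k i| := by
    have hA : Summable fun m : ℕ => |R * Real.exp (2 / θ)| ^ m / m.factorial :=
      Real.summable_pow_div_factorial _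
    have hB : Summable fun m : ℕ => |R| ^ m / m.factorial := Real.summable_pow_div_factorial _
    have := (hA.mul_of_nonneg hB (fun m => by positivity) fun m => by positivity).mul_left
      (Real.exp (2 * ((α + 1) / θ)) * (Real.exp 1 * (θ / (α + 1))))
    refine this.congr fun i => ?_
    rw [hw, hk]
    simp only [abs_mul, abs_div, abs_pow, Nat.abs_cast, Real.abs_exp, abs_of_pos hα', abs_of_pos hθ]
    rw [show 2 * ((α + 1 + i.1) / θ) = 2 * ((α + 1) / θ) + i.1 * (2 / θ) by ring, Real.exp_add,
      Real.exp_nat_mul, mul_pow]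
    ring
  have hsum : ∀ z ∈ S ×ˢ S, ∀ W : ℕ × ℕ → ℝ, (∀ i, ‖W i‖ ≤ w i) →
      Summable fun i => W i * kernelMonomial α θ z.1 (z.2 ^ θ) i := by
    intro z hz W hW
    refine Summable.of_norm_bounded hwk fun i => ?_
    rw [norm_mul]
    have := hW i
    have := (hmono z hz i).trans (le_abs_self _)
    gcongr
  -- An error bound independent of the point z, so dominated convergence of this one series gives
  -- uniformity.
  set δ : ℕ → ℝ := fun n => ∑' i : ℕ × ℕ,
    ‖scaledWeight n ((α + 1 + i.1) / θ) i.2 - (Real.Gamma ((α + 1 + i.1) / θ))⁻¹‖ * |k i| with hδ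
  have hdiff : ∀ n ≠ 0, ∀ i : ℕ × ℕ,
      ‖scaledWeight n ((α + 1 + i.1) / θ) i.2 - (Real.Gamma ((α + 1 + i.1) / θ))⁻¹‖ ≤ 2 * w i := by
    intro n hn i
    refine (norm_sub_le _ _).trans ?_
    linarith [hWle n hn i, hGle i]
  have hδ0 : Tendsto δ atTop (𝓝 0) := by
    have h := tendsto_tsum_of_dominated_convergence (𝓕 := atTop) (f := fun (n : ℕ) (i : ℕ × ℕ) =>
      ‖scaledWeight n ((α + 1 + i.1) / θ) i.2 - (Real.Gamma ((α + 1 + i.1) / θ))⁻¹‖ * |k i|)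
      (g := fun _ => (0 : ℝ)) (bound := fun i => 2 * (w i * |k i|)) (hwk.mul_left 2) (fun i => ?_) ?_
    · rw [tsum_zero] at h
      exact h
    · have h1 := ((tendsto_scaledWeight (ha i) i.2).sub_const (Real.Gamma ((α + 1 + i.1) / θ))⁻¹).norm
      simpa using h1.mul_const |k i|
    · filter_upwards [eventually_ne_atTop 0] with n hn i
      rw [norm_mul, norm_norm, Real.norm_of_nonneg (hk' i), ← mul_assoc]
      exact mul_le_mul_of_nonneg_right (hdiff n hn i) (hk' i)
  have hbound : ∀ n ≠ 0, ∀ z ∈ S ×ˢ S, ‖hardEdgeKernel α θ z.1 z.2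
      - biorthogonalKernel α θ p q n (z.1 / (n : ℝ) ^ (1 / θ)) (z.2 / (n : ℝ) ^ (1 / θ))
        / (n : ℝ) ^ (1 / θ)‖ ≤ M * δ n := by
    intro n hn z hz
    have hz1 : 0 < z.1 := hS0 hz.1
    have s1 := hsum z hz _ (hWle n hn)
    have s2 := hsum z hz _ hGle
    rw [norm_sub_rev, scaled_biorthogonalKernel_eq hα hθ hp hq hn hz1 (hS0 hz.2) s1,
      hardEdgeKernel_eq_tsum hα hθ, ← mul_sub, ← s1.tsum_sub s2, norm_mul,
      Real.norm_of_nonneg (Real.rpow_nonneg hz1.le _)]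
    have hle : ‖∑' i : ℕ × ℕ, (scaledWeight n ((α + 1 + i.1) / θ) i.2 * kernelMonomial α θ z.1 (z.2 ^ θ) i
        - (Real.Gamma ((α + 1 + i.1) / θ))⁻¹ * kernelMonomial α θ z.1 (z.2 ^ θ) i)‖ ≤ δ n := by
      refine tsum_of_norm_bounded (Summable.hasSum ?_) fun i => ?_
      · refine Summable.of_nonneg_of_le (fun i => by positivity) (fun i => ?_) (hwk.mul_left 2)
        rw [← mul_assoc]
        exact mul_le_mul_of_nonneg_right (hdiff n hn i) (hk' i)
      · rw [← sub_mul, norm_mul]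
        have := (hmono z hz i).trans (le_abs_self _)
        gcongr
    have hM' : z.1 ^ α ≤ M := hM ⟨z.1, hz.1, rfl⟩
    have hpos := Real.rpow_nonneg hz1.le α
    exact mul_le_mul hM' hle (norm_nonneg _) (hpos.trans hM')
  rw [Metric.tendstoUniformlyOn_iff]
  intro ε hε
  have hlim : Tendsto (fun n => M * δ n) atTop (𝓝 0) := by simpa using hδ0.const_mul M
  filter_upwards [hlim.eventually (gt_mem_nhds hε), eventually_ne_atTop 0] with n h1 h2 z hz
  rw [dist_eq_norm]
  exact (hbound n h2 z hz).trans_lt h1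

end

/-! ### Assembly -/

theorem corollary1p2 (α θ : ℝ) (hα : -1 < α) (hθ : 1 ≤ θ) :
    (∃! P : (ℕ → Polynomial ℝ) × (ℕ → Polynomial ℝ), IsLaguerreBiorthogonal α θ P.1 P.2) ∧
    ∃ (K : ℝ → ℝ → ℝ) (p q : ℝ → ℝ),
      -- the scaling limit, uniformly for `x`, `y` in compact subsets of `(0, ∞)`
      (∀ P Q : ℕ → Polynomial ℝ, IsLaguerreBiorthogonal α θ P Q →
        ∀ S : Set ℝ, IsCompact S → S ⊆ Ioi 0 →
          TendstoUniformlyOn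
            (fun (n : ℕ) (z : ℝ × ℝ) =>
              biorthogonalKernel α θ P Q n (z.1 / (n : ℝ) ^ (1 / θ)) (z.2 / (n : ℝ) ^ (1 / θ))
                / (n : ℝ) ^ (1 / θ))
            (fun z => K z.1 z.2) atTop (S ×ˢ S)) ∧
      -- the double contour integral
      (∀ x y : ℝ, 0 < x → 0 < y → ∀ c d h : ℝ, IsKernelAbscissa α θ c → c < d → d < 0 → 0 < h →
        (∀ s : ℂ, s.re = c → RightLoopIntegrable d h (hardEdgeIntegrand α θ x y s)) ∧
        (1 < θ → LineIntegrable
          (fun s => rightLoopIntegral d h (hardEdgeIntegrand α θ x y s)) c) ∧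
        HasLineIntegral
          (fun s => θ / (2 * Real.pi * Complex.I) ^ 2
            * rightLoopIntegral d h (hardEdgeIntegrand α θ x y s)) c (K x y)) ∧
      -- the Mellin-Barnes integrals for `p` and `q`
      (∀ x : ℝ, 0 < x → ∀ κ : ℝ, IsPAbscissa α θ κ →
        (1 < θ → LineIntegrable (mellinBarnesP α θ x) κ) ∧
        HasLineIntegral
          (fun s => 1 / (2 * Real.pi * Complex.I) * mellinBarnesP α θ x s) κ (p x)) ∧
      (∀ x : ℝ, 0 < x → ∀ d h : ℝ, 0 < d → 0 < h →
        LeftLoopIntegrable d h (mellinBarnesQ α θ x) ∧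
        (q x : ℂ) = 1 / (2 * Real.pi * Complex.I) * leftLoopIntegral d h (mellinBarnesQ α θ x)) ∧
      -- the kernel as an integral over `[0, 1]`
      (∀ x y : ℝ, 0 < x → 0 < y →
        IntervalIntegrable (fun u => p (u * x) * q (u * y)) volume 0 1 ∧
        K x y = ∫ u in (0 : ℝ)..1, p (u * x) * q (u * y)) ∧
      -- the form of the kernel in terms of Wright's generalized Bessel functions
      (∀ z : ℝ, Summable (wrightBesselTerm ((α + 1) / θ) (1 / θ) z) ∧
        Summable (wrightBesselTerm (α + 1) θ z)) ∧
      (∀ x y : ℝ, 0 < x → 0 < y →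
        IntervalIntegrable (fun u => wrightBessel ((α + 1) / θ) (1 / θ) (u * x)
            * wrightBessel (α + 1) θ ((u * y) ^ θ) * u ^ α) volume 0 1 ∧
        K x y = θ * x ^ α * ∫ u in (0 : ℝ)..1, wrightBessel ((α + 1) / θ) (1 / θ) (u * x)
            * wrightBessel (α + 1) θ ((u * y) ^ θ) * u ^ α) := by
  have hθ0 : 0 < θ := by linarith
  have hfactor : ∀ x y : ℝ, 0 < x → 0 < y → EqOn
      (fun u => θ * x ^ α * (wrightBessel ((α + 1) / θ) (1 / θ) (u * x)
        * wrightBessel (α + 1) θ ((u * y) ^ θ) * u ^ α))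
      (fun u => (u * x) ^ α * wrightBessel ((α + 1) / θ) (1 / θ) (u * x)
        * (θ * wrightBessel (α + 1) θ ((u * y) ^ θ))) (uIoc 0 1) := by
    intro x y hx _ u hu
    rw [uIoc_of_le zero_le_one] at hu
    simp only
    rw [Real.mul_rpow hu.1.le hx.le]
    ring
  refine ⟨existsUnique_isLaguerreBiorthogonal hα hθ0, hardEdgeKernel α θ,
    fun x => x ^ α * wrightBessel ((α + 1) / θ) (1 / θ) x, fun x => θ * wrightBessel (α + 1) θ (x ^ θ),
    fun P Q hPQ S hS hS0 => ?_,
    fun x y hx hy c d h hc hcd hd hh => lineIntegral_hardEdge hα hθ hx hy hc hcd hd hh,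
    fun x hx κ hκ => lineIntegral_mellinBarnesP hα hθ hx hκ,
    fun x hx d h hd hh => leftLoopIntegral_mellinBarnesQ hα hθ hx hd hh, fun x y hx hy => ⟨?_, ?_⟩,
    fun z => ⟨summable_wrightBesselTerm (div_pos (by linarith) hθ0) (one_div_pos.2 hθ0) z,
      summable_wrightBesselTerm (by linarith) hθ0 z⟩,
    fun x y _ hy => ⟨intervalIntegrable_wrightBessel_mul hα hθ0 x y,
      hardEdgeKernel_eq_integral hα hθ0 x hy⟩⟩
  -- By uniqueness any biorthogonal system is the explicit one, for which the power series of the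
  -- kernel is known.
  · obtain ⟨p, q, h, hp, hq⟩ := exists_isLaguerreBiorthogonal hα hθ0
    obtain rfl := hPQ.right_unique h hα hθ0
    obtain rfl := hPQ.left_unique h hα hθ0
    exact tendstoUniformlyOn_scaled_biorthogonalKernel hα hθ0 hp hq hS hS0
  · exact ((intervalIntegrable_wrightBessel_mul hα hθ0 x y).const_mul (θ * x ^ α)).congr
      (hfactor x y hx hy)
  · rw [hardEdgeKernel_eq_integral hα hθ0 x hy, ← intervalIntegral.integral_const_mul]
    exact intervalIntegral.integral_congr_ae (ae_of_all _ fun u hu => hfactor x y hx hy hu)
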